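/- Theorem A3. All algebras are over $\mathbb C$ and not necessarily associative or unital; $A^2$ is the linear span of all products $xy$ in $A$. A commutative algebra is a Jordan algebra if $(x^2y)x=x^2(yx)$; it is a derived Jordan algebra (respectively, a derived commutative associative algebra) if the algebra $A^2$ is Jordan (respectively, associative). In the multiplication tables below, with basis $e_1,e_2,e_3$ and parameters $\alpha,\beta,\gamma\in\mathbb C$, products that are zero or follow by commutativity are omitted. Let $A$ be a complex $3$-dimensional derived Jordan algebra with nonzero multiplication. Then at least one of the following holds. (1) $A$ is a Jordan algebra and is isomorphic to one of the commutative associative algebras - $\mathrm J_{01}:\ e_1e_1=e_1,\ e_2e_2=e_2$ - $\mathrm J_{02}:\ e_1e_1=e_1,\ e_1e_2=e_2$ - $\mathrm J_{03}:\ e_1e_1=e_1$ - $\mathrm J_{04}:\ e_1e_1=e_2$ - $\mathrm J_{05}:\ e_1e_2=e_3$ - $\mathrm J_{06}:\ e_1e_1=e_2,\ e_1e_2=e_3$ - $\mathrm J_{07}:\ e_1e_1=e_1,\ e_2e_2=e_2,\ e_3e_3=e_3$ - $\mathrm J_{08}:\ e_1e_1=e_1,\ e_2e_2=e_2,\ e_2e_3=e_3$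 - $\mathrm J_{09}:\ e_1e_1=e_1,\ e_1e_2=e_2,\ e_1e_3=e_3$ - $\mathrm J_{10}:\ e_1e_1=e_1,\ e_1e_2=e_2,\ e_1e_3=e_3,\ e_2e_2=e_3$ - $\mathrm J_{11}:\ e_1e_1=e_1,\ e_2e_2=e_3$ or to one of the algebras - $\mathrm J_{12}:\ e_1e_1=e_1,\ e_2e_2=e_2,\ e_3e_3=e_1+e_2,\ e_1e_3=\tfrac12 e_3,\ e_2e_3=\tfrac12 e_3$ - $\mathrm J_{13}:\ e_1e_1=e_1,\ e_1e_2=\tfrac12 e_2,\ e_1e_3=e_3$ - $\mathrm J_{14}:\ e_1e_1=e_1,\ e_1e_2=\tfrac12 e_2,\ e_1e_3=\tfrac12 e_3$ - $\mathrm J_{15}:\ e_1e_1=e_1,\ e_2e_2=e_3,\ e_1e_2=\tfrac12 e_2$ - $\mathrm J_{16}:\ e_1e_1=e_1,\ e_2e_2=e_3,\ e_1e_2=\tfrac12 e_2,\ e_1e_3=e_3$ - $\mathrm J_{17}:\ e_1e_1=e_1,\ e_2e_2=e_2,\ e_1e_3=\tfrac12 e_3,\ e_2e_3=\tfrac12 e_3$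 - $\mathrm J_{18}:\ e_1e_1=e_1,\ e_1e_2=\tfrac12 e_2$ - $\mathrm J_{19}:\ e_1e_1=e_1,\ e_2e_2=e_2,\ e_1e_3=\tfrac12 e_3$ (2) $A$ is a derived commutative associative algebra and is isomorphic to one of $\mathrm J_{01},\dots,\mathrm J_{11}$, or to one of the metabelian commutative algebras (those with $(xy)(zt)=0$) - $\mathrm M_{01}:\ e_1e_1=e_2$ - $\mathrm M_{02}:\ e_1e_2=e_3$ - $\mathrm M_{03}:\ e_1e_1=e_2,\ e_1e_2=e_3$ - $\mathrm M_{04}^{\alpha}:\ e_1e_3=e_1,\ e_2e_3=\alpha e_2$ - $\mathrm M_{05}:\ e_1e_3=e_1,\ e_3e_3=e_2$ - $\mathrm M_{06}:\ e_1e_3=e_1+e_2,\ e_2e_3=e_2$ - $\mathrm M_{07}:\ e_1e_3=e_1,\ e_2e_2=e_1$ or to one of the algebras - $\mathrm A_{01}^{\alpha,\beta,\gamma}:\ e_1e_1=e_1,\ e_2e_2=e_2,\ e_1e_3=\alpha e_2,\ e_2e_3=\beta e_1,\ e_3e_3=e_1+\gamma e_2$ - $\mathrm A_{02}^{\alpha}:\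 e_1e_1=e_1,\ e_2e_2=e_2,\ e_1e_3=e_2,\ e_2e_3=\alpha e_1$ - $\mathrm A_{03}^{\alpha}:\ e_1e_1=e_1,\ e_2e_3=e_2,\ e_3e_3=\alpha e_1$ - $\mathrm A_{04}^{\alpha}:\ e_1e_1=e_1,\ e_2e_3=e_1+e_2,\ e_3e_3=\alpha e_1$ - $\mathrm A_{05}^{\alpha,\beta}:\ e_1e_1=e_1,\ e_1e_3=e_2,\ e_2e_3=\alpha e_1+e_2,\ e_3e_3=\beta e_1$ - $\mathrm A_{06}^{\alpha}:\ e_1e_1=e_1,\ e_1e_3=e_2,\ e_2e_3=e_1,\ e_3e_3=\alpha e_2$ - $\mathrm A_{07}:\ e_1e_1=e_1,\ e_1e_3=e_2$ - $\mathrm A_{08}:\ e_1e_1=e_1,\ e_1e_3=e_2,\ e_3e_3=e_2$ - $\mathrm A_{09}^{\alpha}:\ e_1e_1=e_1,\ e_1e_3=e_2,\ e_3e_3=e_1+\alpha e_2$ - $\mathrm A_{10}:\ e_1e_1=e_1,\ e_2e_3=e_1,\ e_3e_3=e_2$ - $\mathrm A_{11}:\ e_1e_1=e_1,\ e_3e_3=e_1+e_2$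 - $\mathrm A_{12}^{\alpha,\beta}:\ e_1e_1=e_1,\ e_1e_2=e_2,\ e_1e_3=e_1,\ e_2e_3=\alpha e_1,\ e_3e_3=\beta e_1+e_2$ - $\mathrm A_{13}^{\alpha}:\ e_1e_1=e_1,\ e_1e_2=e_2,\ e_1e_3=e_1,\ e_2e_3=e_1,\ e_3e_3=\alpha e_1$ - $\mathrm A_{14}^{\alpha}:\ e_1e_1=e_1,\ e_1e_2=e_2,\ e_1e_3=e_1,\ e_3e_3=\alpha e_1$ - $\mathrm A_{15}^{\alpha}:\ e_1e_1=e_1,\ e_1e_2=e_2,\ e_2e_3=e_1,\ e_3e_3=e_1+\alpha e_2$ - $\mathrm A_{16}:\ e_1e_1=e_1,\ e_1e_2=e_2,\ e_3e_3=e_1+e_2$ - $\mathrm A_{17}:\ e_1e_1=e_1,\ e_1e_2=e_2,\ e_3e_3=e_1$ - $\mathrm A_{18}:\ e_1e_1=e_1,\ e_1e_2=e_2,\ e_2e_3=e_1,\ e_3e_3=e_2$ - $\mathrm A_{19}:\ e_1e_1=e_1,\ e_1e_2=e_2,\ e_2e_3=e_1$ - $\mathrm A_{20}:\ e_1e_1=e_1,\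 e_1e_2=e_2,\ e_3e_3=e_2$ - $\mathrm A_{21}^{\alpha}:\ e_1e_1=e_2,\ e_2e_3=e_1+e_2,\ e_3e_3=\alpha e_2$ - $\mathrm A_{22}:\ e_1e_1=e_2,\ e_2e_3=e_1$ - $\mathrm A_{23}:\ e_1e_1=e_2,\ e_2e_3=e_1,\ e_3e_3=e_2$ - $\mathrm A_{24}^{\alpha}:\ e_1e_1=e_2,\ e_1e_3=e_1,\ e_2e_3=\alpha e_2$ - $\mathrm A_{25}:\ e_1e_1=e_2,\ e_1e_3=e_1,\ e_3e_3=e_2$ - $\mathrm A_{26}:\ e_1e_1=e_2,\ e_1e_3=e_1+e_2,\ e_2e_3=e_2$ - $\mathrm A_{27}:\ e_1e_1=e_2,\ e_3e_3=e_1$ - $\mathrm A_{28}:\ e_1e_1=e_2,\ e_2e_3=e_2,\ e_3e_3=e_1$ - $\mathrm A_{29}:\ e_1e_1=e_1,\ e_2e_3=e_1$ - $\mathrm A_{30}:\ e_1e_1=e_1,\ e_3e_3=e_1$ (3) $A$ is isomorphic to one of the algebras - $\mathcal J_{01}^{\alpha}:\ e_1e_1=e_1,\ e_1e_2=\tfrac12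 e_2,\ e_2e_3=e_1,\ e_3e_3=e_1+\alpha e_2$ - $\mathcal J_{02}:\ e_1e_1=e_1,\ e_1e_2=\tfrac12 e_2,\ e_2e_3=e_1,\ e_3e_3=e_2$ - $\mathcal J_{03}:\ e_1e_1=e_1,\ e_1e_2=\tfrac12 e_2,\ e_2e_3=e_1$ - $\mathcal J_{04}^{\alpha}:\ e_1e_1=e_1,\ e_1e_2=\tfrac12 e_2,\ e_2e_3=e_2,\ e_3e_3=\alpha e_1$ - $\mathcal J_{05}:\ e_1e_1=e_1,\ e_1e_2=\tfrac12 e_2,\ e_2e_3=e_2,\ e_3e_3=-4e_1+e_2$ - $\mathcal J_{06}:\ e_1e_1=e_1,\ e_1e_2=\tfrac12 e_2,\ e_3e_3=e_1$ - $\mathcal J_{07}:\ e_1e_1=e_1,\ e_1e_2=\tfrac12 e_2,\ e_3e_3=e_2$ Moreover, let $\mathfrak J_{04}$ be the $2$-dimensional algebra $e_1e_1=e_1,\ e_1e_2=\tfrac12e_2$, which is a non-associative Jordan algebra. Each algebra $\mathcal J$ in (3), for every value of $\alpha$, is a derived Jordan algebra with $\mathcal J^2\cong\mathfrak J_{04}$,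 and is neither a Jordan algebra nor a derived commutative associative algebra. The algebras in (3) are pairwise non-isomorphic, except that $\mathcal J_{01}^{\alpha}\cong\mathcal J_{01}^{-\alpha}$ for every $\alpha$. -/

import Mathlib

namespace DerivedJordan

section Notions

/-- Isomorphism of (not necessarily associative or unital) complex algebras: a linear bijection
that preserves products. -/
def AlgIso (A B : Type*) [NonUnitalNonAssocRing A] [Module ℂ A] [NonUnitalNonAssocRing B]
    [Module ℂ B] : Prop :=
  ∃ f : A ≃ₗ[ℂ] B, ∀ x y : A, f (x * y) = f x * f y

/-- The derived algebra `A²`: the linear span of all products. -/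
def derivedAlgebra (A : Type*) [NonUnitalNonAssocCommRing A] [Module ℂ A] :
    NonUnitalSubalgebra ℂ A where
  toNonUnitalSubsemiring :=
    { (Submodule.span ℂ {z : A | ∃ x y : A, z = x * y}).toAddSubmonoid with
      mul_mem' := fun {a b} _ _ => Submodule.subset_span ⟨a, b, rfl⟩ }
  smul_mem' := fun c _ hx =>
    (Submodule.span ℂ {z : A | ∃ x y : A, z = x * y}).smul_mem c hx

/-- A subalgebra of a commutative algebra is commutative. -/
instance instCommSubalgebra {A : Type*} [NonUnitalNonAssocCommRing A] [Module ℂ A]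
    (S : NonUnitalSubalgebra ℂ A) : NonUnitalNonAssocCommRing S :=
  { (inferInstance : NonUnitalNonAssocRing S) with
    mul_comm := fun a b => Subtype.ext (mul_comm (a : A) (b : A)) }

/-- A commutative algebra is *derived Jordan* if its derived algebra is a Jordan algebra. -/
def IsDerivedJordan (A : Type*) [NonUnitalNonAssocCommRing A] [Module ℂ A] : Prop :=
  IsCommJordan (derivedAlgebra A)

/-- A commutative algebra is *derived commutative associative* if its derived algebra is
associative (it is always commutative). -/
def IsDerivedCommAssoc (A : Type*) [NonUnitalNonAssocCommRing A] [Module ℂ A] : Prop :=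
  ∀ x y z : derivedAlgebra A, (x * y) * z = x * (y * z)

end Notions

section Tables

/-- The multiplication table of a commutative algebra with basis `e₁, e₂, e₃`: the field `eiej`
holds the coordinates of `eᵢ eⱼ`. Products that are not mentioned are zero or follow by
commutativity. -/
structure Table : Type where
  e1e1 : Fin 3 → ℂ := 0
  e1e2 : Fin 3 → ℂ := 0
  e1e3 : Fin 3 → ℂ := 0
  e2e2 : Fin 3 → ℂ := 0
  e2e3 : Fin 3 → ℂ := 0
  e3e3 : Fin 3 → ℂ := 0

/-- The commutative algebra on `ℂ³` given by a multiplication table. -/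
def Table.Alg (_ : Table) : Type := Fin 3 → ℂ

noncomputable instance (t : Table) : AddCommGroup t.Alg :=
  inferInstanceAs (AddCommGroup (Fin 3 → ℂ))

noncomputable instance (t : Table) : Module ℂ t.Alg :=
  inferInstanceAs (Module ℂ (Fin 3 → ℂ))

/-- The product, extended bilinearly and symmetrically from the table. -/
noncomputable def Table.mul (t : Table) (x y : Fin 3 → ℂ) : Fin 3 → ℂ :=
  (x 0 * y 0) • t.e1e1 + (x 1 * y 1) • t.e2e2 + (x 2 * y 2) • t.e3e3
    + (x 0 * y 1 + x 1 * y 0) • t.e1e2 + (x 0 * y 2 + x 2 * y 0) • t.e1e3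
    + (x 1 * y 2 + x 2 * y 1) • t.e2e3

noncomputable instance (t : Table) : NonUnitalNonAssocCommRing t.Alg :=
  { (inferInstance : AddCommGroup t.Alg) with
    mul := fun x y => t.mul x y
    left_distrib := fun x y z => by
      change t.mul x (fun i => y i + z i) = fun i => t.mul x y i + t.mul x z i
      ext i; simp [Table.mul]; ring
    right_distrib := fun x y z => by
      change t.mul (fun i => x i + y i) z = fun i => t.mul x z i + t.mul y z i
      ext i; simp [Table.mul]; ring
    zero_mul := fun x => by
      change t.mul (fun _ => 0) x = fun _ => 0
      ext i; simp [Table.mul]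
    mul_zero := fun x => by
      change t.mul x (fun _ => 0) = fun _ => 0
      ext i; simp [Table.mul]
    mul_comm := fun x y => by
      change t.mul x y = t.mul y x
      ext i; simp [Table.mul]; ring }

/-- The `2`-dimensional algebra `𝔍04` on `ℂ²`: `e₁ e₁ = e₁`, `e₁ e₂ = ½ e₂`, `e₂ e₂ = 0`. -/
def J2 : Type := Fin 2 → ℂ

noncomputable instance : AddCommGroup J2 := inferInstanceAs (AddCommGroup (Fin 2 → ℂ))

noncomputable instance : Module ℂ J2 := inferInstanceAs (Module ℂ (Fin 2 → ℂ))

/-- The product of `𝔍04`. -/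
noncomputable def J2.mul (x y : Fin 2 → ℂ) : Fin 2 → ℂ :=
  ![x 0 * y 0, (1 / 2) * (x 0 * y 1 + x 1 * y 0)]

noncomputable instance : NonUnitalNonAssocCommRing J2 :=
  { (inferInstance : AddCommGroup J2) with
    mul := fun x y => J2.mul x y
    left_distrib := fun x y z => by
      change J2.mul x (fun i => y i + z i) = fun i => J2.mul x y i + J2.mul x z i
      ext i; fin_cases i <;> simp [J2.mul] <;> ring
    right_distrib := fun x y z => by
      change J2.mul (fun i => x i + y i) z = fun i => J2.mul x z i + J2.mul y z i
      ext i; fin_cases i <;> simp [J2.mul] <;> ring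
    zero_mul := fun x => by
      change J2.mul (fun _ => 0) x = fun _ => 0
      ext i; fin_cases i <;> simp [J2.mul]
    mul_zero := fun x => by
      change J2.mul x (fun _ => 0) = fun _ => 0
      ext i; fin_cases i <;> simp [J2.mul]
    mul_comm := fun x y => by
      change J2.mul x y = J2.mul y x
      ext i; fin_cases i <;> simp [J2.mul] <;> ring }

end Tables

noncomputable section Lists

/-- The nontrivial `3`-dimensional commutative associative algebras `J01`, …, `J11`. -/
inductive AssocLabel : Type where
  | J01
  | J02
  | J03
  | J04
  | J05
  | J06
  | J07
  | J08
  | J09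
  | J10
  | J11

/-- The multiplication tables of these algebras. -/
def AssocLabel.table : AssocLabel → Table
  | .J01 => { e1e1 := ![1, 0, 0], e2e2 := ![0, 1, 0] }
  | .J02 => { e1e1 := ![1, 0, 0], e1e2 := ![0, 1, 0] }
  | .J03 => { e1e1 := ![1, 0, 0] }
  | .J04 => { e1e1 := ![0, 1, 0] }
  | .J05 => { e1e2 := ![0, 0, 1] }
  | .J06 => { e1e1 := ![0, 1, 0], e1e2 := ![0, 0, 1] }
  | .J07 => { e1e1 := ![1, 0, 0], e2e2 := ![0, 1, 0], e3e3 := ![0, 0, 1] }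
  | .J08 => { e1e1 := ![1, 0, 0], e2e2 := ![0, 1, 0], e2e3 := ![0, 0, 1] }
  | .J09 => { e1e1 := ![1, 0, 0], e1e2 := ![0, 1, 0], e1e3 := ![0, 0, 1] }
  | .J10 => { e1e1 := ![1, 0, 0], e1e2 := ![0, 1, 0], e1e3 := ![0, 0, 1], e2e2 := ![0, 0, 1] }
  | .J11 => { e1e1 := ![1, 0, 0], e2e2 := ![0, 0, 1] }

/-- The `3`-dimensional non-associative Jordan algebras `J12`, …, `J19`. -/
inductive JordanLabel : Type where
  | J12
  | J13
  | J14
  | J15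
  | J16
  | J17
  | J18
  | J19

/-- The multiplication tables of these algebras. -/
def JordanLabel.table : JordanLabel → Table
  | .J12 => { e1e1 := ![1, 0, 0], e2e2 := ![0, 1, 0], e3e3 := ![1, 1, 0], e1e3 := ![0, 0, 1/2], e2e3 := ![0, 0, 1/2] }
  | .J13 => { e1e1 := ![1, 0, 0], e1e2 := ![0, 1/2, 0], e1e3 := ![0, 0, 1] }
  | .J14 => { e1e1 := ![1, 0, 0], e1e2 := ![0, 1/2, 0], e1e3 := ![0, 0, 1/2] }
  | .J15 => { e1e1 := ![1, 0, 0], e2e2 := ![0, 0, 1], e1e2 := ![0, 1/2, 0] }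
  | .J16 => { e1e1 := ![1, 0, 0], e2e2 := ![0, 0, 1], e1e2 := ![0, 1/2, 0], e1e3 := ![0, 0, 1] }
  | .J17 => { e1e1 := ![1, 0, 0], e2e2 := ![0, 1, 0], e1e3 := ![0, 0, 1/2], e2e3 := ![0, 0, 1/2] }
  | .J18 => { e1e1 := ![1, 0, 0], e1e2 := ![0, 1/2, 0] }
  | .J19 => { e1e1 := ![1, 0, 0], e2e2 := ![0, 1, 0], e1e3 := ![0, 0, 1/2] }

/-- The nontrivial `3`-dimensional metabelian commutative algebras `M01`, …, `M07`. -/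
inductive MetLabel : Type where
  | M01
  | M02
  | M03
  | M04 (α : ℂ)
  | M05
  | M06
  | M07

/-- The multiplication tables of these algebras. -/
def MetLabel.table : MetLabel → Table
  | .M01 => { e1e1 := ![0, 1, 0] }
  | .M02 => { e1e2 := ![0, 0, 1] }
  | .M03 => { e1e1 := ![0, 1, 0], e1e2 := ![0, 0, 1] }
  | .M04 α => { e1e3 := ![1, 0, 0], e2e3 := ![0, α, 0] }
  | .M05 => { e1e3 := ![1, 0, 0], e3e3 := ![0, 1, 0] }
  | .M06 => { e1e3 := ![1, 1, 0], e2e3 := ![0, 1, 0] }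
  | .M07 => { e1e3 := ![1, 0, 0], e2e2 := ![1, 0, 0] }

/-- The `3`-dimensional derived commutative associative algebras `A01`, …, `A30` that are neither
metabelian nor associative. -/
inductive DerAssocLabel : Type where
  | A01 (α β γ : ℂ)
  | A02 (α : ℂ)
  | A03 (α : ℂ)
  | A04 (α : ℂ)
  | A05 (α β : ℂ)
  | A06 (α : ℂ)
  | A07
  | A08
  | A09 (α : ℂ)
  | A10
  | A11
  | A12 (α β : ℂ)
  | A13 (α : ℂ)
  | A14 (α : ℂ)
  | A15 (α : ℂ)
  | A16
  | A17
  | A18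
  | A19
  | A20
  | A21 (α : ℂ)
  | A22
  | A23
  | A24 (α : ℂ)
  | A25
  | A26
  | A27
  | A28
  | A29
  | A30

/-- The multiplication tables of these algebras. -/
def DerAssocLabel.table : DerAssocLabel → Table
  | .A01 α β γ => { e1e1 := ![1, 0, 0], e2e2 := ![0, 1, 0], e1e3 := ![0, α, 0], e2e3 := ![β, 0, 0], e3e3 := ![1, γ, 0] }
  | .A02 α => { e1e1 := ![1, 0, 0], e2e2 := ![0, 1, 0], e1e3 := ![0, 1, 0], e2e3 := ![α, 0, 0] }
  | .A03 α => { e1e1 := ![1, 0, 0], e2e3 := ![0, 1, 0], e3e3 := ![α, 0, 0] }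
  | .A04 α => { e1e1 := ![1, 0, 0], e2e3 := ![1, 1, 0], e3e3 := ![α, 0, 0] }
  | .A05 α β => { e1e1 := ![1, 0, 0], e1e3 := ![0, 1, 0], e2e3 := ![α, 1, 0], e3e3 := ![β, 0, 0] }
  | .A06 α => { e1e1 := ![1, 0, 0], e1e3 := ![0, 1, 0], e2e3 := ![1, 0, 0], e3e3 := ![0, α, 0] }
  | .A07 => { e1e1 := ![1, 0, 0], e1e3 := ![0, 1, 0] }
  | .A08 => { e1e1 := ![1, 0, 0], e1e3 := ![0, 1, 0], e3e3 := ![0, 1, 0] }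
  | .A09 α => { e1e1 := ![1, 0, 0], e1e3 := ![0, 1, 0], e3e3 := ![1, α, 0] }
  | .A10 => { e1e1 := ![1, 0, 0], e2e3 := ![1, 0, 0], e3e3 := ![0, 1, 0] }
  | .A11 => { e1e1 := ![1, 0, 0], e3e3 := ![1, 1, 0] }
  | .A12 α β => { e1e1 := ![1, 0, 0], e1e2 := ![0, 1, 0], e1e3 := ![1, 0, 0], e2e3 := ![α, 0, 0], e3e3 := ![β, 1, 0] }
  | .A13 α => { e1e1 := ![1, 0, 0], e1e2 := ![0, 1, 0], e1e3 := ![1, 0, 0], e2e3 := ![1, 0, 0], e3e3 := ![α, 0, 0] }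
  | .A14 α => { e1e1 := ![1, 0, 0], e1e2 := ![0, 1, 0], e1e3 := ![1, 0, 0], e3e3 := ![α, 0, 0] }
  | .A15 α => { e1e1 := ![1, 0, 0], e1e2 := ![0, 1, 0], e2e3 := ![1, 0, 0], e3e3 := ![1, α, 0] }
  | .A16 => { e1e1 := ![1, 0, 0], e1e2 := ![0, 1, 0], e3e3 := ![1, 1, 0] }
  | .A17 => { e1e1 := ![1, 0, 0], e1e2 := ![0, 1, 0], e3e3 := ![1, 0, 0] }
  | .A18 => { e1e1 := ![1, 0, 0], e1e2 := ![0, 1, 0], e2e3 := ![1, 0, 0], e3e3 := ![0, 1, 0] }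
  | .A19 => { e1e1 := ![1, 0, 0], e1e2 := ![0, 1, 0], e2e3 := ![1, 0, 0] }
  | .A20 => { e1e1 := ![1, 0, 0], e1e2 := ![0, 1, 0], e3e3 := ![0, 1, 0] }
  | .A21 α => { e1e1 := ![0, 1, 0], e2e3 := ![1, 1, 0], e3e3 := ![0, α, 0] }
  | .A22 => { e1e1 := ![0, 1, 0], e2e3 := ![1, 0, 0] }
  | .A23 => { e1e1 := ![0, 1, 0], e2e3 := ![1, 0, 0], e3e3 := ![0, 1, 0] }
  | .A24 α => { e1e1 := ![0, 1, 0], e1e3 := ![1, 0, 0], e2e3 := ![0, α, 0] }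
  | .A25 => { e1e1 := ![0, 1, 0], e1e3 := ![1, 0, 0], e3e3 := ![0, 1, 0] }
  | .A26 => { e1e1 := ![0, 1, 0], e1e3 := ![1, 1, 0], e2e3 := ![0, 1, 0] }
  | .A27 => { e1e1 := ![0, 1, 0], e3e3 := ![1, 0, 0] }
  | .A28 => { e1e1 := ![0, 1, 0], e2e3 := ![0, 1, 0], e3e3 := ![1, 0, 0] }
  | .A29 => { e1e1 := ![1, 0, 0], e2e3 := ![1, 0, 0] }
  | .A30 => { e1e1 := ![1, 0, 0], e3e3 := ![1, 0, 0] }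

/-- The seven families `𝒥01^α`, `𝒥02`, `𝒥03`, `𝒥04^α`, `𝒥05`, `𝒥06`, `𝒥07`. -/
inductive DerJordanLabel : Type where
  | DJ01 (α : ℂ)
  | DJ02
  | DJ03
  | DJ04 (α : ℂ)
  | DJ05
  | DJ06
  | DJ07

/-- The multiplication tables of these algebras. -/
def DerJordanLabel.table : DerJordanLabel → Table
  | .DJ01 α => { e1e1 := ![1, 0, 0], e1e2 := ![0, 1/2, 0], e2e3 := ![1, 0, 0], e3e3 := ![1, α, 0] }
  | .DJ02 => { e1e1 := ![1, 0, 0], e1e2 := ![0, 1/2, 0], e2e3 := ![1, 0, 0], e3e3 := ![0, 1, 0] }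
  | .DJ03 => { e1e1 := ![1, 0, 0], e1e2 := ![0, 1/2, 0], e2e3 := ![1, 0, 0] }
  | .DJ04 α => { e1e1 := ![1, 0, 0], e1e2 := ![0, 1/2, 0], e2e3 := ![0, 1, 0], e3e3 := ![α, 0, 0] }
  | .DJ05 => { e1e1 := ![1, 0, 0], e1e2 := ![0, 1/2, 0], e2e3 := ![0, 1, 0], e3e3 := ![-4, 1, 0] }
  | .DJ06 => { e1e1 := ![1, 0, 0], e1e2 := ![0, 1/2, 0], e3e3 := ![1, 0, 0] }
  | .DJ07 => { e1e1 := ![1, 0, 0], e1e2 := ![0, 1/2, 0], e3e3 := ![0, 1, 0] }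

end Lists

section Listed

variable (A : Type*) [NonUnitalNonAssocCommRing A] [Module ℂ A]

/-- `A` is isomorphic to one of `J01`, …, `J11`. -/
def IsListedAssoc : Prop := ∃ l : AssocLabel, AlgIso A l.table.Alg

/-- `A` is isomorphic to one of the Jordan algebras `J01`, …, `J19`. -/
def IsListedJordan : Prop := IsListedAssoc A ∨ ∃ l : JordanLabel, AlgIso A l.table.Alg

/-- `A` is isomorphic to one of `M01`, …, `M07`, `J01`, …, `J11`, `A01`, …, `A30`. -/
def IsListedDerivedCommAssoc : Prop :=
  (∃ l : MetLabel, AlgIso A l.table.Alg) ∨ IsListedAssoc A ∨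
    ∃ l : DerAssocLabel, AlgIso A l.table.Alg

end Listed

end DerivedJordan

namespace DerivedJordan

/-! ### Isomorphisms and changes of basis. -/

section Isomorphisms

/-! Everything depends on whether `A²` is all of `A`.

Suppose `A² ≠ A`. Then `A²` lies in a plane `P` that is closed under multiplication and is one of
the two-dimensional Jordan algebras of `planeTables`; if `A²` is only a line, it is first enlarged
to such a plane. A third basis vector `e₃` adds six numbers, the coordinates in `P` of `e₁e₃`,
`e₂e₃` and `e₃e₃`. They are normalized by the substitutions `e₃ ↦ c e₃ + b₁ e₁ + b₂ e₂` together
with automorphisms of `P`: shifts clear as many parameters as possible, and square or cube roots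
rescale the rest. Five of the six planes are associative and lead to case (2). The sixth, `𝔍04`,
gives only `J18` and the seven families of case (3).

Suppose `A² = A`. Then `A` is itself Jordan, and perfect. It contains a nonzero idempotent `e`:
otherwise all `x⁴` vanish, and either some `x³ ≠ 0`, so that `x, x², x³` is a basis and `A²` lies in
the span of `x², x³`, or all cubes vanish, which again confines products to a proper subspace.
Multiplication `L` by `e` satisfies `L(2L - 1)(L - 1) = 0`, so `e` extends to a basis of
eigenvectors with eigenvalues among `1, 1/2, 0`. For each pair of eigenvalues the Peirce rules leave
few structure constants, and perfection excludes the degenerate ones. If both eigenvalues are `1`,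
then `e` is a unit. Another nonzero idempotent cannot be a unit and returns the argument to the
earlier cases; if there is none, `A` is `ℂe` plus nilpotent elements and is `J09` or `J10`.

For the non-isomorphism statement, an isomorphism between two extensions of `𝔍04` preserves the
plane. It sends `e₁` to a nonzero idempotent `e₁ + u e₂` and `e₂` to `s e₂`, and `e₁e₃ = 0` then
determines the plane part of the image of `e₃`. The effect on the remaining parameters is explicit
(`params_of_algIso_extend_J18`), and comparing two labels is elementary algebra. -/

theorem AlgIso.trans {A B C : Type*} [NonUnitalNonAssocRing A] [Module ℂ A]
    [NonUnitalNonAssocRing B] [Module ℂ B] [NonUnitalNonAssocRing C] [Module ℂ C]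
    (h : AlgIso A B) (h' : AlgIso B C) : AlgIso A C := by
  obtain ⟨f, hf⟩ := h
  obtain ⟨g, hg⟩ := h'
  exact ⟨f.trans g, fun x y => by simp [hf, hg]⟩

theorem AlgIso.symm {A B : Type*} [NonUnitalNonAssocRing A] [Module ℂ A]
    [NonUnitalNonAssocRing B] [Module ℂ B] (h : AlgIso A B) : AlgIso B A := by
  obtain ⟨f, hf⟩ := h
  exact ⟨f.symm, fun x y => f.injective (by simp [hf])⟩

theorem AlgIso.refl (A : Type*) [NonUnitalNonAssocRing A] [Module ℂ A] : AlgIso A A :=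
  ⟨LinearEquiv.refl ℂ A, fun _ _ => rfl⟩

theorem AlgIso.isCommJordan {A B : Type*} [NonUnitalNonAssocCommRing A] [Module ℂ A]
    [NonUnitalNonAssocCommRing B] [Module ℂ B] (h : AlgIso A B) (hB : IsCommJordan B) :
    IsCommJordan A := by
  obtain ⟨f, hf⟩ := h
  exact ⟨fun x y => f.injective (by simp only [hf]; exact hB.lmul_comm_rmul_rmul _ _)⟩

/-- A table gives the structure constants of an algebra in a basis. -/
theorem algIso_of_linearIndependent {A : Type*} [NonUnitalNonAssocCommRing A] [Module ℂ A]
    [IsScalarTower ℂ A A] [SMulCommClass ℂ A A] (hA : Module.finrank ℂ A = 3) (s : Table)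
    {x y z : A} (hli : LinearIndependent ℂ ![x, y, z])
    (hxx : x * x = s.e1e1 0 • x + s.e1e1 1 • y + s.e1e1 2 • z)
    (hxy : x * y = s.e1e2 0 • x + s.e1e2 1 • y + s.e1e2 2 • z)
    (hxz : x * z = s.e1e3 0 • x + s.e1e3 1 • y + s.e1e3 2 • z)
    (hyy : y * y = s.e2e2 0 • x + s.e2e2 1 • y + s.e2e2 2 • z)
    (hyz : y * z = s.e2e3 0 • x + s.e2e3 1 • y + s.e2e3 2 • z)
    (hzz : z * z = s.e3e3 0 • x + s.e3e3 1 • y + s.e3e3 2 • z) : AlgIso A s.Alg := by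
  let b := basisOfLinearIndependentOfCardEqFinrank hli (by simp [hA])
  let g : s.Alg ≃ₗ[ℂ] A := b.equivFun.symm
  have hg : ∀ v : Fin 3 → ℂ, g v = v 0 • x + v 1 • y + v 2 • z := fun v => by
    change b.equivFun.symm v = _
    simp [Module.Basis.equivFun_symm_apply, Fin.sum_univ_three, b]
  have key : ∀ v w : Fin 3 → ℂ,
      s.mul v w 0 • x + s.mul v w 1 • y + s.mul v w 2 • z =
        (v 0 • x + v 1 • y + v 2 • z) * (w 0 • x + w 1 • y + w 2 • z) := fun v w => by
    simp only [add_mul, mul_add, smul_mul_assoc, mul_smul_comm, mul_comm y x, mul_comm z x,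
      mul_comm z y, hxx, hxy, hxz, hyy, hyz, hzz]
    simp only [Table.mul, Pi.add_apply, Pi.smul_apply, smul_eq_mul]
    module
  exact AlgIso.symm ⟨g, fun v w => (hg _).trans ((key v w).trans
    (congrArg₂ (· * ·) (hg v).symm (hg w).symm))⟩

instance (t : Table) : IsScalarTower ℂ t.Alg t.Alg := ⟨fun c x y => by
  change t.mul (fun i => c * x i) y = fun i => c * t.mul x y i
  ext i; simp [Table.mul]; ring⟩

instance (t : Table) : SMulCommClass ℂ t.Alg t.Alg := ⟨fun c x y => by
  change (fun i => c * t.mul x y i) = t.mul x (fun i => c * y i)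
  ext i; simp [Table.mul]; ring⟩

theorem Table.finrank_alg (t : Table) : Module.finrank ℂ t.Alg = 3 :=
  (Module.finrank_fin_fun ℂ : Module.finrank ℂ (Fin 3 → ℂ) = 3)

/-- Change of basis between two tables: `x`, `y`, `z` are the coordinates of the new basis. -/
theorem Table.algIso (t s : Table) (x y z : Fin 3 → ℂ)
    (hdet : (Matrix.of ![x, y, z]).det ≠ 0)
    (hxx : t.mul x x = s.e1e1 0 • x + s.e1e1 1 • y + s.e1e1 2 • z)
    (hxy : t.mul x y = s.e1e2 0 • x + s.e1e2 1 • y + s.e1e2 2 • z)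
    (hxz : t.mul x z = s.e1e3 0 • x + s.e1e3 1 • y + s.e1e3 2 • z)
    (hyy : t.mul y y = s.e2e2 0 • x + s.e2e2 1 • y + s.e2e2 2 • z)
    (hyz : t.mul y z = s.e2e3 0 • x + s.e2e3 1 • y + s.e2e3 2 • z)
    (hzz : t.mul z z = s.e3e3 0 • x + s.e3e3 1 • y + s.e3e3 2 • z) : AlgIso t.Alg s.Alg := by
  have h : LinearIndependent ℂ (Matrix.of ![x, y, z]).row :=
    Matrix.linearIndependent_rows_iff_isUnit.2 ((Matrix.isUnit_iff_isUnit_det _).2 hdet.isUnit)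
  exact algIso_of_linearIndependent (A := t.Alg) t.finrank_alg s (x := x) (y := y) (z := z)
    h hxx hxy hxz hyy hyz hzz

theorem Table.isCommJordan_iff (t : Table) : IsCommJordan t.Alg ↔
    ∀ x y : Fin 3 → ℂ, t.mul (t.mul x y) (t.mul x x) = t.mul x (t.mul y (t.mul x x)) :=
  ⟨fun h x y => h.lmul_comm_rmul_rmul (A := t.Alg) x y, fun h => ⟨fun x y => h x y⟩⟩

end Isomorphisms

/-! ### Change of parameters for extensions of a plane. -/

section Extensions

/-- The extension of a multiplication on the span of `e₁`, `e₂` by a third basis vector with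
`e₁ e₃ = a e₁ + b e₂`, `e₂ e₃ = p e₁ + d e₂` and `e₃ e₃ = v e₁ + w e₂`. -/
def Table.extend (B : Table) (a b p d v w : ℂ) : Table :=
  { B with e1e3 := ![a, b, 0], e2e3 := ![p, d, 0], e3e3 := ![v, w, 0] }

theorem vec3_zero : (![0, 0, 0] : Fin 3 → ℂ) = 0 := by
  ext i; fin_cases i <;> rfl

variable {a b p d v w a' b' p' d' v' w' : ℂ}

/-- The new third vector is `c e₃ + b₁ e₁ + b₂ e₂`, and primed letters are the new structure
constants. In the analogues for the other planes an automorphism of the plane also acts, with scale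
`s` and shear `u` where available. Their conditions compare coordinates in the old basis, which
avoids dividing by the scale. -/
theorem Table.extend_J01_algIso (c b₁ b₂ : ℂ) (hc : c ≠ 0)
    (ha : a' = c * a + b₁) (hb : b' = c * b) (hp : p' = c * p) (hd : d' = c * d + b₂)
    (hv : v' = c ^ 2 * v + 2 * c * (b₁ * a + b₂ * p) + b₁ ^ 2)
    (hw : w' = c ^ 2 * w + 2 * c * (b₁ * b + b₂ * d) + b₂ ^ 2) :
    AlgIso (AssocLabel.J01.table.extend a b p d v w).Alg
      (AssocLabel.J01.table.extend a' b' p' d' v' w').Alg := by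
  subst ha hb hp hd hv hw
  refine Table.algIso _ _ ![1, 0, 0] ![0, 1, 0] ![b₁, b₂, c] ?_ ?_ ?_ ?_ ?_ ?_ ?_
  · simpa [Matrix.det_fin_three] using hc
  all_goals
    ext i
    fin_cases i <;> simp [Table.mul, Table.extend, AssocLabel.table] <;> ring

theorem Table.extend_J01_swap :
    AlgIso (AssocLabel.J01.table.extend a b p d v w).Alg
      (AssocLabel.J01.table.extend d p b a w v).Alg := by
  refine Table.algIso _ _ ![0, 1, 0] ![1, 0, 0] ![0, 0, 1] ?_ ?_ ?_ ?_ ?_ ?_ ?_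
  · simp [Matrix.det_fin_three]
  all_goals
    ext i
    fin_cases i <;> simp [Table.mul, Table.extend, AssocLabel.table]

theorem Table.extend_J03_algIso (c s b₁ b₂ : ℂ) (hc : c ≠ 0) (hs : s ≠ 0)
    (ha : a' = c * a + b₁) (hb : b' * s = c * b) (hp : p' = s * c * p) (hd : d' = c * d)
    (hv : v' = c ^ 2 * v + 2 * c * (b₁ * a + b₂ * p) + b₁ ^ 2)
    (hw : w' * s = c ^ 2 * w + 2 * c * (b₁ * b + b₂ * d)) :
    AlgIso (AssocLabel.J03.table.extend a b p d v w).Alg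
      (AssocLabel.J03.table.extend a' b' p' d' v' w').Alg := by
  subst ha hp hd hv
  refine Table.algIso _ _ ![1, 0, 0] ![0, s, 0] ![b₁, b₂, c] ?_ ?_ ?_ ?_ ?_ ?_ ?_
  · simpa [Matrix.det_fin_three] using ⟨hs, hc⟩
  all_goals
    ext i
    fin_cases i <;> simp [Table.mul, Table.extend, AssocLabel.table, hb, hw] <;> ring

theorem Table.extend_J02_algIso (c s b₁ b₂ : ℂ) (hc : c ≠ 0) (hs : s ≠ 0)
    (ha : a' = c * a + b₁) (hb : b' * s = c * b + b₂) (hp : p' = s * c * p)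
    (hd : d' = c * d + b₁)
    (hv : v' = c ^ 2 * v + 2 * c * (b₁ * a + b₂ * p) + b₁ ^ 2)
    (hw : w' * s = c ^ 2 * w + 2 * c * (b₁ * b + b₂ * d) + 2 * b₁ * b₂) :
    AlgIso (AssocLabel.J02.table.extend a b p d v w).Alg
      (AssocLabel.J02.table.extend a' b' p' d' v' w').Alg := by
  subst ha hp hd hv
  refine Table.algIso _ _ ![1, 0, 0] ![0, s, 0] ![b₁, b₂, c] ?_ ?_ ?_ ?_ ?_ ?_ ?_
  · simpa [Matrix.det_fin_three] using ⟨hs, hc⟩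
  all_goals
    ext i
    fin_cases i <;> simp [Table.mul, Table.extend, AssocLabel.table, hb, hw] <;> ring

theorem Table.extend_J04_algIso (c s u b₁ b₂ : ℂ) (hc : c ≠ 0) (hs : s ≠ 0)
    (ha : a' * s = c * (s * a + u * p)) (hb : a' * u + b' * s ^ 2 = c * (s * b + u * d) + s * b₁)
    (hp : p' = s * c * p) (hd : p' * u + d' * s ^ 2 = s ^ 2 * c * d)
    (hv : v' * s = c ^ 2 * v + 2 * c * (b₁ * a + b₂ * p))
    (hw : v' * u + w' * s ^ 2 = c ^ 2 * w + 2 * c * (b₁ * b + b₂ * d) + b₁ ^ 2) :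
    AlgIso (AssocLabel.J04.table.extend a b p d v w).Alg
      (AssocLabel.J04.table.extend a' b' p' d' v' w').Alg := by
  subst hp
  refine Table.algIso _ _ ![s, u, 0] ![0, s ^ 2, 0] ![b₁, b₂, c] ?_ ?_ ?_ ?_ ?_ ?_ ?_
  · simpa [Matrix.det_fin_three] using ⟨hs, hc⟩
  all_goals
    ext i
    fin_cases i <;> simp [Table.mul, Table.extend, AssocLabel.table, ha, hb, hd, hv, hw] <;> ring

theorem Table.extend_J18_algIso (c s u b₁ b₂ : ℂ) (hc : c ≠ 0) (hs : s ≠ 0)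
    (ha : a' = c * (a + u * p) + b₁)
    (hb : a' * u + b' * s = c * (b + u * d) + b₂ / 2 + u * b₁ / 2)
    (hp : p' = s * c * p) (hd : p' * u + d' * s = s * (c * d + b₁ / 2))
    (hv : v' = c ^ 2 * v + 2 * c * (b₁ * a + b₂ * p) + b₁ ^ 2)
    (hw : v' * u + w' * s = c ^ 2 * w + 2 * c * (b₁ * b + b₂ * d) + b₁ * b₂) :
    AlgIso (JordanLabel.J18.table.extend a b p d v w).Alg
      (JordanLabel.J18.table.extend a' b' p' d' v' w').Alg := by
  refine Table.algIso _ _ ![1, u, 0] ![0, s, 0] ![b₁, b₂, c] ?_ ?_ ?_ ?_ ?_ ?_ ?_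
  · simpa [Matrix.det_fin_three] using ⟨hs, hc⟩
  all_goals
    ext i
    fin_cases i <;> simp [Table.mul, Table.extend, JordanLabel.table, hb, hd, hw] <;>
      (try simp only [ha, hp, hv]) <;> ring

/-- The multiplication table of the zero algebra. -/
def zeroTable : Table := {}

theorem Table.extend_zeroTable_algIso (c s₁ s₂ t₁ t₂ b₁ b₂ : ℂ) (hc : c ≠ 0)
    (hs : s₁ * t₂ - s₂ * t₁ ≠ 0)
    (ha : a' * s₁ + b' * t₁ = c * (s₁ * a + s₂ * p))
    (hb : a' * s₂ + b' * t₂ = c * (s₁ * b + s₂ * d))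
    (hp : p' * s₁ + d' * t₁ = c * (t₁ * a + t₂ * p))
    (hd : p' * s₂ + d' * t₂ = c * (t₁ * b + t₂ * d))
    (hv : v' * s₁ + w' * t₁ = c ^ 2 * v + 2 * c * (b₁ * a + b₂ * p))
    (hw : v' * s₂ + w' * t₂ = c ^ 2 * w + 2 * c * (b₁ * b + b₂ * d)) :
    AlgIso (zeroTable.extend a b p d v w).Alg (zeroTable.extend a' b' p' d' v' w').Alg := by
  refine Table.algIso _ _ ![s₁, s₂, 0] ![t₁, t₂, 0] ![b₁, b₂, c] ?_ ?_ ?_ ?_ ?_ ?_ ?_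
  · rw [Matrix.det_fin_three]
    simpa [← sub_mul, hc] using hs
  all_goals
    ext i
    fin_cases i <;> simp [Table.mul, Table.extend, zeroTable, ha, hb, hp, hd, hv, hw] <;> ring

end Extensions

/-! ### Extensions of `J01`. -/

section Listing

theorem AlgIso.isListedAssoc {A B : Type*} [NonUnitalNonAssocCommRing A] [Module ℂ A]
    [NonUnitalNonAssocCommRing B] [Module ℂ B] (h : AlgIso A B) (hB : IsListedAssoc B) :
    IsListedAssoc A :=
  hB.imp fun _ hl => h.trans hl

theorem AlgIso.isListedDerivedCommAssoc {A B : Type*} [NonUnitalNonAssocCommRing A] [Module ℂ A]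
    [NonUnitalNonAssocCommRing B] [Module ℂ B] (h : AlgIso A B)
    (hB : IsListedDerivedCommAssoc B) : IsListedDerivedCommAssoc A :=
  hB.imp (fun ⟨l, hl⟩ => ⟨l, h.trans hl⟩)
    (Or.imp h.isListedAssoc fun ⟨l, hl⟩ => ⟨l, h.trans hl⟩)

theorem isListedDerivedCommAssoc_of_eq_assoc {T : Table} (l : AssocLabel) (h : T = l.table) :
    IsListedDerivedCommAssoc T.Alg :=
  .inr (.inl ⟨l, h ▸ AlgIso.refl _⟩)

theorem isListedDerivedCommAssoc_of_eq_met {T : Table} (l : MetLabel) (h : T = l.table) :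
    IsListedDerivedCommAssoc T.Alg :=
  .inl ⟨l, h ▸ AlgIso.refl _⟩

theorem isListedDerivedCommAssoc_of_eq_derAssoc {T : Table} (l : DerAssocLabel)
    (h : T = l.table) : IsListedDerivedCommAssoc T.Alg :=
  .inr (.inr ⟨l, h ▸ AlgIso.refl _⟩)

theorem exists_sq_mul_eq_one {v : ℂ} (hv : v ≠ 0) : ∃ c : ℂ, c ≠ 0 ∧ c ^ 2 * v = 1 := by
  obtain ⟨c, hc⟩ := IsAlgClosed.exists_pow_nat_eq v⁻¹ (n := 2) (by norm_num)
  refine ⟨c, fun h => ?_, by rw [hc, inv_mul_cancel₀ hv]⟩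
  exact hv (by simpa [h] using hc.symm)

theorem exists_pow_three_mul_eq_one {v : ℂ} (hv : v ≠ 0) : ∃ c : ℂ, c ≠ 0 ∧ c ^ 3 * v = 1 := by
  obtain ⟨c, hc⟩ := IsAlgClosed.exists_pow_nat_eq v⁻¹ (n := 3) (by norm_num)
  refine ⟨c, fun h => ?_, by rw [hc, inv_mul_cancel₀ hv]⟩
  exact hv (by simpa [h] using hc.symm)

/-- With `a = d = 0` only the scaling of `e₃` and the exchange of the two idempotents remain. The
exchange reduces to `v ≠ 0`, or to `v = w = 0` and `b ≠ 0`, unless everything vanishes. -/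
theorem isListed_extend_J01_zero (b p v w : ℂ) :
    IsListedDerivedCommAssoc (AssocLabel.J01.table.extend 0 b p 0 v w).Alg := by
  have case₁ : ∀ b p v w : ℂ, v ≠ 0 →
      IsListedDerivedCommAssoc (AssocLabel.J01.table.extend 0 b p 0 v w).Alg := by
    intro b p v w hv
    obtain ⟨c, hc, hcv⟩ := exists_sq_mul_eq_one hv
    refine (Table.extend_J01_algIso (a' := 0) (b' := c * b) (p' := c * p) (d' := 0) (v' := 1)
      (w' := c ^ 2 * w) c 0 0 hc ?_ ?_ ?_ ?_ ?_ ?_).isListedDerivedCommAssoc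
      (isListedDerivedCommAssoc_of_eq_derAssoc (.A01 (c * b) (c * p) (c ^ 2 * w))
        (by simp [Table.extend, AssocLabel.table, DerAssocLabel.table])) <;> simp [hcv]
  have case₂ : ∀ b p : ℂ, b ≠ 0 →
      IsListedDerivedCommAssoc (AssocLabel.J01.table.extend 0 b p 0 0 0).Alg := by
    intro b p hb
    refine (Table.extend_J01_algIso (a' := 0) (b' := 1) (p' := b⁻¹ * p) (d' := 0) (v' := 0)
      (w' := 0) b⁻¹ 0 0 (inv_ne_zero hb) ?_ ?_ ?_ ?_ ?_ ?_).isListedDerivedCommAssoc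
      (isListedDerivedCommAssoc_of_eq_derAssoc (.A02 (b⁻¹ * p))
        (by simp [Table.extend, AssocLabel.table, DerAssocLabel.table, vec3_zero])) <;> simp [hb]
  by_cases hv : v = 0
  · by_cases hw : w = 0
    · subst hv hw
      by_cases hb : b = 0
      · by_cases hp : p = 0
        · exact isListedDerivedCommAssoc_of_eq_assoc .J01
            (by simp [Table.extend, AssocLabel.table, hb, hp, vec3_zero])
        · exact Table.extend_J01_swap.isListedDerivedCommAssoc (case₂ _ _ hp)
      · exact case₂ b p hb
    · exact Table.extend_J01_swap.isListedDerivedCommAssoc (case₁ _ _ _ _ hw)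
  · exact case₁ _ _ _ _ hv

theorem isListed_extend_J01 (a b p d v w : ℂ) :
    IsListedDerivedCommAssoc (AssocLabel.J01.table.extend a b p d v w).Alg :=
  (Table.extend_J01_algIso 1 (-a) (-d) one_ne_zero (by ring) rfl rfl (by ring) rfl
    rfl).isListedDerivedCommAssoc (isListed_extend_J01_zero _ _ _ _)

end Listing

/-! ### Extensions of `J03` and `J02`. -/

section ListingTwo

/-- The shift along `e₁` has been spent on `a = 0`. The shift along `e₂` clears `w` when `d ≠ 0`,
and clears `v` when `d = 0` and `p ≠ 0`; what is left is rescaled by `c` and `s`. -/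
theorem isListed_extend_J03_zero (b p d v w : ℂ) :
    IsListedDerivedCommAssoc (AssocLabel.J03.table.extend 0 b p d v w).Alg := by
  by_cases hd : d = 0
  · subst hd
    by_cases hb : b = 0
    · subst hb
      by_cases hp : p = 0
      · subst hp
        by_cases hv : v = 0
        · subst hv
          by_cases hw : w = 0
          · exact isListedDerivedCommAssoc_of_eq_assoc .J03
              (by simp [Table.extend, AssocLabel.table, hw, vec3_zero])
          -- Only `e₃² = w e₂` survives besides `e₁² = e₁`, so `e₁, e₃, e₃²` is the basis wanted.
          · refine .inr (.inl ⟨.J11, Table.algIso _ _ ![1, 0, 0] ![0, 0, 1] ![0, w, 0]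
              ?_ ?_ ?_ ?_ ?_ ?_ ?_⟩)
            · simpa [Matrix.det_fin_three] using hw
            all_goals
              ext i
              fin_cases i <;> simp [Table.mul, Table.extend, AssocLabel.table]
        · obtain ⟨c, hc, hcv⟩ := exists_sq_mul_eq_one hv
          by_cases hw : w = 0
          · refine (Table.extend_J03_algIso (a' := 0) (b' := 0) (p' := 0) (d' := 0) (v' := 1)
              (w' := 0) c 1 0 0 hc one_ne_zero ?_ ?_ ?_ ?_ ?_ ?_).isListedDerivedCommAssoc
              (isListedDerivedCommAssoc_of_eq_derAssoc .A30 (by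
                simp [Table.extend, AssocLabel.table, DerAssocLabel.table, vec3_zero])) <;>
              simp [hcv, hw]
          · refine (Table.extend_J03_algIso (a' := 0) (b' := 0) (p' := 0) (d' := 0) (v' := 1)
              (w' := 1) c (c ^ 2 * w) 0 0 hc (by positivity) ?_ ?_ ?_ ?_ ?_
              ?_).isListedDerivedCommAssoc
              (isListedDerivedCommAssoc_of_eq_derAssoc .A11 (by
                simp [Table.extend, AssocLabel.table, DerAssocLabel.table, vec3_zero])) <;>
              simp [hcv]
      · by_cases hw : w = 0
        · refine (Table.extend_J03_algIso (a' := 0) (b' := 0) (p' := 1) (d' := 0) (v' := 0)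
            (w' := 0) 1 p⁻¹ 0 (-v / (2 * p)) one_ne_zero (inv_ne_zero hp) ?_ ?_ ?_ ?_ ?_
            ?_).isListedDerivedCommAssoc
            (isListedDerivedCommAssoc_of_eq_derAssoc .A29 (by
              simp [Table.extend, AssocLabel.table, DerAssocLabel.table, vec3_zero])) <;>
            simp [hw, hp]
          field_simp
          ring
        · obtain ⟨c, hc, hcv⟩ := exists_pow_three_mul_eq_one (mul_ne_zero hp hw)
          refine (Table.extend_J03_algIso (a' := 0) (b' := 0) (p' := 1) (d' := 0) (v' := 0)
            (w' := 1) c (c ^ 2 * w) 0 (-(c * v) / (2 * p)) hc (by positivity) ?_ ?_ ?_ ?_ ?_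
            ?_).isListedDerivedCommAssoc
            (isListedDerivedCommAssoc_of_eq_derAssoc .A10 (by
              simp [Table.extend, AssocLabel.table, DerAssocLabel.table, vec3_zero]))
          · simp
          · simp
          · linear_combination -hcv
          · simp
          · field_simp
            ring
          · ring
    · by_cases hp : p = 0
      · subst hp
        by_cases hv : v = 0
        · subst hv
          by_cases hw : w = 0
          · refine (Table.extend_J03_algIso (a' := 0) (b' := 1) (p' := 0) (d' := 0) (v' := 0)
              (w' := 0) 1 b 0 0 one_ne_zero hb ?_ ?_ ?_ ?_ ?_ ?_).isListedDerivedCommAssoc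
              (isListedDerivedCommAssoc_of_eq_derAssoc .A07 (by
                simp [Table.extend, AssocLabel.table, DerAssocLabel.table, vec3_zero])) <;>
              simp [hw]
          · refine (Table.extend_J03_algIso (a' := 0) (b' := 1) (p' := 0) (d' := 0) (v' := 0)
              (w' := 1) (b / w) (b / w * b) 0 0 (div_ne_zero hb hw) (by positivity) ?_ ?_ ?_ ?_ ?_
              ?_).isListedDerivedCommAssoc
              (isListedDerivedCommAssoc_of_eq_derAssoc .A08 (by
                simp [Table.extend, AssocLabel.table, DerAssocLabel.table, vec3_zero])) <;>
              simp
            field_simp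
        · obtain ⟨c, hc, hcv⟩ := exists_sq_mul_eq_one hv
          refine (Table.extend_J03_algIso (a' := 0) (b' := 1) (p' := 0) (d' := 0) (v' := 1)
            (w' := c * w / b) c (c * b) 0 0 hc (by positivity) ?_ ?_ ?_ ?_ ?_
            ?_).isListedDerivedCommAssoc
            (isListedDerivedCommAssoc_of_eq_derAssoc (.A09 (c * w / b)) (by
              simp [Table.extend, AssocLabel.table, DerAssocLabel.table, vec3_zero])) <;>
            simp [hcv]
          field_simp
      · obtain ⟨c, hc, hcv⟩ := exists_sq_mul_eq_one (mul_ne_zero hb hp)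
        refine (Table.extend_J03_algIso (a' := 0) (b' := 1) (p' := 1) (d' := 0) (v' := 0)
          (w' := c * w / b) c (c * b) 0 (-(c * v) / (2 * p)) hc (by positivity) ?_ ?_ ?_ ?_ ?_
          ?_).isListedDerivedCommAssoc
          (isListedDerivedCommAssoc_of_eq_derAssoc (.A06 (c * w / b)) (by
            simp [Table.extend, AssocLabel.table, DerAssocLabel.table]))
        · simp
        · simp
        · linear_combination -hcv
        · simp
        · field_simp
          ring
        · field_simp
          ring
  · by_cases hb : b = 0
    · by_cases hp : p = 0
      · refine (Table.extend_J03_algIso (a' := 0) (b' := 0) (p' := 0) (d' := 1) (v' := v / d ^ 2)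
          (w' := 0) d⁻¹ 1 0 (-w / (2 * d ^ 2)) (inv_ne_zero hd) one_ne_zero ?_ ?_ ?_ ?_ ?_
          ?_).isListedDerivedCommAssoc
          (isListedDerivedCommAssoc_of_eq_derAssoc (.A03 (v / d ^ 2)) (by
            simp [Table.extend, AssocLabel.table, DerAssocLabel.table, vec3_zero])) <;>
          simp [hb, hp, hd]
        · field_simp
        · field_simp
          ring
      · refine (Table.extend_J03_algIso (a' := 0) (b' := 0) (p' := 1) (d' := 1)
          (v' := v / d ^ 2 - w * p / d ^ 3)
          (w' := 0) d⁻¹ (d / p) 0 (-w / (2 * d ^ 2)) (inv_ne_zero hd) (div_ne_zero hd hp)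
          ?_ ?_ ?_ ?_ ?_ ?_).isListedDerivedCommAssoc
          (isListedDerivedCommAssoc_of_eq_derAssoc (.A04 (v / d ^ 2 - w * p / d ^ 3)) (by
            simp [Table.extend, AssocLabel.table, DerAssocLabel.table, vec3_zero])) <;>
          (try simp [hb, hd])
        all_goals
          field_simp
          try ring
    · refine (Table.extend_J03_algIso (a' := 0) (b' := 1) (p' := b * p / d ^ 2) (d' := 1)
        (v' := v / d ^ 2 - w * p / d ^ 3)
        (w' := 0) d⁻¹ (b / d) 0 (-w / (2 * d ^ 2)) (inv_ne_zero hd) (div_ne_zero hb hd)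
        ?_ ?_ ?_ ?_ ?_ ?_).isListedDerivedCommAssoc
        (isListedDerivedCommAssoc_of_eq_derAssoc
          (.A05 (b * p / d ^ 2) (v / d ^ 2 - w * p / d ^ 3)) (by
          simp [Table.extend, AssocLabel.table, DerAssocLabel.table])) <;>
        (try simp [hd])
      all_goals
        field_simp
        try ring

theorem isListed_extend_J03 (a b p d v w : ℂ) :
    IsListedDerivedCommAssoc (AssocLabel.J03.table.extend a b p d v w).Alg :=
  (Table.extend_J03_algIso (b' := b) (w' := w - 2 * a * b) 1 1 (-a) 0 one_ne_zero one_ne_zero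
    (by ring) (by ring) rfl rfl rfl (by ring)).isListedDerivedCommAssoc
    (isListed_extend_J03_zero _ _ _ _ _)

/-- Both shifts are used up by `b = d = 0`, so only the two scalings `c` and `s` act on `a, p, v,
w`. -/
theorem isListed_extend_J02_zero (a p v w : ℂ) :
    IsListedDerivedCommAssoc (AssocLabel.J02.table.extend a 0 p 0 v w).Alg := by
  by_cases ha : a = 0
  · subst ha
    by_cases hv : v = 0
    · subst hv
      by_cases hp : p = 0
      · subst hp
        by_cases hw : w = 0
        · exact isListedDerivedCommAssoc_of_eq_assoc .J02
            (by simp [Table.extend, AssocLabel.table, hw, vec3_zero])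
        · refine (Table.extend_J02_algIso (a' := 0) (b' := 0) (p' := 0) (d' := 0) (v' := 0)
            (w' := 1) 1 w 0 0 one_ne_zero hw ?_ ?_ ?_ ?_ ?_ ?_).isListedDerivedCommAssoc
            (isListedDerivedCommAssoc_of_eq_derAssoc .A20 (by
              simp [Table.extend, AssocLabel.table, DerAssocLabel.table, vec3_zero])) <;>
            simp
      · by_cases hw : w = 0
        · refine (Table.extend_J02_algIso (a' := 0) (b' := 0) (p' := 1) (d' := 0) (v' := 0)
            (w' := 0) 1 p⁻¹ 0 0 one_ne_zero (inv_ne_zero hp) ?_ ?_ ?_ ?_ ?_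
            ?_).isListedDerivedCommAssoc
            (isListedDerivedCommAssoc_of_eq_derAssoc .A19 (by
              simp [Table.extend, AssocLabel.table, DerAssocLabel.table, vec3_zero])) <;>
            simp [hp, hw]
        · obtain ⟨c, hc, hcv⟩ := exists_pow_three_mul_eq_one (mul_ne_zero hp hw)
          refine (Table.extend_J02_algIso (a' := 0) (b' := 0) (p' := 1) (d' := 0) (v' := 0)
            (w' := 1) c (c ^ 2 * w) 0 0 hc (by positivity) ?_ ?_ ?_ ?_ ?_
            ?_).isListedDerivedCommAssoc
            (isListedDerivedCommAssoc_of_eq_derAssoc .A18 (by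
              simp [Table.extend, AssocLabel.table, DerAssocLabel.table, vec3_zero])) <;>
            (try simp)
          linear_combination -hcv
    · obtain ⟨c, hc, hcv⟩ := exists_sq_mul_eq_one hv
      by_cases hp : p = 0
      · subst hp
        by_cases hw : w = 0
        · refine (Table.extend_J02_algIso (a' := 0) (b' := 0) (p' := 0) (d' := 0) (v' := 1)
            (w' := 0) c 1 0 0 hc one_ne_zero ?_ ?_ ?_ ?_ ?_ ?_).isListedDerivedCommAssoc
            (isListedDerivedCommAssoc_of_eq_derAssoc .A17 (by
              simp [Table.extend, AssocLabel.table, DerAssocLabel.table, vec3_zero])) <;>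
            simp [hcv, hw]
        · refine (Table.extend_J02_algIso (a' := 0) (b' := 0) (p' := 0) (d' := 0) (v' := 1)
            (w' := 1) c (c ^ 2 * w) 0 0 hc (by positivity) ?_ ?_ ?_ ?_ ?_
            ?_).isListedDerivedCommAssoc
            (isListedDerivedCommAssoc_of_eq_derAssoc .A16 (by
              simp [Table.extend, AssocLabel.table, DerAssocLabel.table, vec3_zero])) <;>
            simp [hcv]
      · refine (Table.extend_J02_algIso (a' := 0) (b' := 0) (p' := 1) (d' := 0) (v' := 1)
          (w' := c ^ 3 * p * w) c (c * p)⁻¹ 0 0 hc (inv_ne_zero (mul_ne_zero hc hp)) ?_ ?_ ?_ ?_ ?_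
          ?_).isListedDerivedCommAssoc
          (isListedDerivedCommAssoc_of_eq_derAssoc (.A15 (c ^ 3 * p * w)) (by
            simp [Table.extend, AssocLabel.table, DerAssocLabel.table, vec3_zero])) <;>
          simp [hcv] <;> field_simp
  · have hc : a⁻¹ ≠ 0 := inv_ne_zero ha
    by_cases hw : w = 0
    · by_cases hp : p = 0
      · refine (Table.extend_J02_algIso (a' := 1) (b' := 0) (p' := 0) (d' := 0)
          (v' := a⁻¹ ^ 2 * v) (w' := 0) a⁻¹ 1 0 0 hc one_ne_zero ?_ ?_ ?_ ?_ ?_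
          ?_).isListedDerivedCommAssoc
          (isListedDerivedCommAssoc_of_eq_derAssoc (.A14 (a⁻¹ ^ 2 * v)) (by
            simp [Table.extend, AssocLabel.table, DerAssocLabel.table, vec3_zero])) <;>
          simp [ha, hp, hw]
      · refine (Table.extend_J02_algIso (a' := 1) (b' := 0) (p' := 1) (d' := 0)
          (v' := a⁻¹ ^ 2 * v) (w' := 0) a⁻¹ (a / p) 0 0 hc (div_ne_zero ha hp) ?_ ?_ ?_ ?_ ?_
          ?_).isListedDerivedCommAssoc
          (isListedDerivedCommAssoc_of_eq_derAssoc (.A13 (a⁻¹ ^ 2 * v)) (by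
            simp [Table.extend, AssocLabel.table, DerAssocLabel.table])) <;>
          (try simp [ha, hw])
        field_simp
    · refine (Table.extend_J02_algIso (a' := 1) (b' := 0) (p' := a⁻¹ ^ 3 * w * p) (d' := 0)
        (v' := a⁻¹ ^ 2 * v) (w' := 1) a⁻¹ (a⁻¹ ^ 2 * w) 0 0 hc (by positivity) ?_ ?_ ?_ ?_ ?_
        ?_).isListedDerivedCommAssoc
        (isListedDerivedCommAssoc_of_eq_derAssoc (.A12 (a⁻¹ ^ 3 * w * p) (a⁻¹ ^ 2 * v)) (by
          simp [Table.extend, AssocLabel.table, DerAssocLabel.table])) <;>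
        simp [ha]
      field_simp
      simp

theorem isListed_extend_J02 (a b p d v w : ℂ) :
    IsListedDerivedCommAssoc (AssocLabel.J02.table.extend a b p d v w).Alg :=
  (Table.extend_J02_algIso (b' := 0) (w' := w - 2 * b * d) 1 1 (-d) (-b) one_ne_zero one_ne_zero
    rfl (by ring) rfl (by ring) rfl (by ring)).isListedDerivedCommAssoc
    (isListed_extend_J02_zero _ _ _ _)

end ListingTwo

/-! ### Extensions of the nilpotent plane `J04`. -/

section ListingNilpotent

theorem isListed_extend_J04_of_ne (d w : ℂ) {p : ℂ} (hp : p ≠ 0) :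
    IsListedDerivedCommAssoc (AssocLabel.J04.table.extend 0 0 p d 0 w).Alg := by
  by_cases hd : d = 0
  · subst hd
    by_cases hw : w = 0
    · refine (Table.extend_J04_algIso (a' := 0) (b' := 0) (p' := 1) (d' := 0) (v' := 0)
        (w' := 0) 1 p⁻¹ 0 0 0 one_ne_zero (inv_ne_zero hp) ?_ ?_ ?_ ?_ ?_
        ?_).isListedDerivedCommAssoc
        (isListedDerivedCommAssoc_of_eq_derAssoc .A22 (by
          simp [Table.extend, AssocLabel.table, DerAssocLabel.table, vec3_zero])) <;>
        simp [hp, hw]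
    -- The targets `p' = w' = 1` require `s c p = 1` and `s² = c² w`. With `k² w = 1` and `s = c /
    -- k` the second holds, and the first becomes `c² (p / k) = 1`.
    · obtain ⟨k, hk, hkw⟩ := exists_sq_mul_eq_one hw
      obtain ⟨c, hc, hck⟩ := exists_sq_mul_eq_one (div_ne_zero hp hk)
      refine (Table.extend_J04_algIso (a' := 0) (b' := 0) (p' := 1) (d' := 0) (v' := 0)
        (w' := 1) c (c / k) 0 0 0 hc (div_ne_zero hc hk) ?_ ?_ ?_ ?_ ?_
        ?_).isListedDerivedCommAssoc
        (isListedDerivedCommAssoc_of_eq_derAssoc .A23 (by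
          simp [Table.extend, AssocLabel.table, DerAssocLabel.table, vec3_zero])) <;>
        (try simp)
      · linear_combination -hck
      · field_simp
        linear_combination -hkw
  · refine (Table.extend_J04_algIso (a' := 0) (b' := 0) (p' := 1) (d' := 1) (v' := 0)
      (w' := w * p ^ 2 / d ^ 4) d⁻¹ (d / p) 0 0 0 (inv_ne_zero hd) (div_ne_zero hd hp)
      ?_ ?_ ?_ ?_ ?_ ?_).isListedDerivedCommAssoc
      (isListedDerivedCommAssoc_of_eq_derAssoc (.A21 (w * p ^ 2 / d ^ 4)) (by
        simp [Table.extend, AssocLabel.table, DerAssocLabel.table, vec3_zero])) <;>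
      (try simp) <;> field_simp

/-- A shift along `e₂` changes `w` by a multiple of `d`, so `w` can be cleared unless `d = 0`; the
exception is `A25`. -/
theorem isListed_extend_J04_of_ne_one (w : ℂ) {d : ℂ} (hd : d ≠ 1) :
    IsListedDerivedCommAssoc (AssocLabel.J04.table.extend 1 0 0 d 0 w).Alg := by
  by_cases h : d ≠ 0 ∨ w = 0
  · refine (Table.extend_J04_algIso (a' := 1) (b' := 0) (p' := 0) (d' := d) (v' := 0)
      (w' := 0) 1 1 0 0 (-w / (2 * d)) one_ne_zero one_ne_zero
      ?_ ?_ ?_ ?_ ?_ ?_).isListedDerivedCommAssoc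
      (isListedDerivedCommAssoc_of_eq_derAssoc (.A24 d) (by
        simp [Table.extend, AssocLabel.table, DerAssocLabel.table, vec3_zero])) <;>
      (try simp)
    rcases h with h | h
    · field_simp
      ring
    · simp [h]
  · push Not at h
    obtain ⟨rfl, hw⟩ := h
    obtain ⟨k, hk, hkw⟩ := exists_sq_mul_eq_one hw
    refine (Table.extend_J04_algIso (a' := 1) (b' := 0) (p' := 0) (d' := 0) (v' := 0)
      (w' := 1) 1 k⁻¹ 0 0 0 one_ne_zero (inv_ne_zero hk)
      ?_ ?_ ?_ ?_ ?_ ?_).isListedDerivedCommAssoc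
      (isListedDerivedCommAssoc_of_eq_derAssoc .A25 (by
        simp [Table.extend, AssocLabel.table, DerAssocLabel.table, vec3_zero])) <;>
      (try simp)
    field_simp
    linear_combination -hkw

theorem isListed_extend_J04_one (b : ℂ) :
    IsListedDerivedCommAssoc (AssocLabel.J04.table.extend 1 b 0 1 0 0).Alg := by
  by_cases hb : b = 0
  · exact isListedDerivedCommAssoc_of_eq_derAssoc (.A24 1) (by
      simp [Table.extend, AssocLabel.table, DerAssocLabel.table, vec3_zero, hb])
  · refine (Table.extend_J04_algIso (a' := 1) (b' := 1) (p' := 0) (d' := 1) (v' := 0)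
      (w' := 0) 1 b 0 0 0 one_ne_zero hb
      ?_ ?_ ?_ ?_ ?_ ?_).isListedDerivedCommAssoc
      (isListedDerivedCommAssoc_of_eq_derAssoc .A26 (by
        simp [Table.extend, AssocLabel.table, DerAssocLabel.table, vec3_zero])) <;>
      (try simp)
    ring

theorem isListed_extend_J04_zero (v : ℂ) :
    IsListedDerivedCommAssoc (AssocLabel.J04.table.extend 0 0 0 1 v 0).Alg := by
  by_cases hv : v = 0
  · refine .inl ⟨.M07, Table.algIso _ _ ![0, 1, 0] ![1, 0, 0] ![0, 0, 1] ?_ ?_ ?_ ?_ ?_ ?_ ?_⟩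
    · simp [Matrix.det_fin_three]
    all_goals
      ext i
      fin_cases i <;> simp [Table.mul, Table.extend, AssocLabel.table, MetLabel.table, hv]
  · refine (Table.extend_J04_algIso (a' := 0) (b' := 0) (p' := 0) (d' := 1) (v' := 1)
      (w' := 0) 1 v 0 0 0 one_ne_zero hv
      ?_ ?_ ?_ ?_ ?_ ?_).isListedDerivedCommAssoc
      (isListedDerivedCommAssoc_of_eq_derAssoc .A28 (by
        simp [Table.extend, AssocLabel.table, DerAssocLabel.table, vec3_zero])) <;>
      simp

theorem isListed_extend_J04_nilpotent (v w : ℂ) :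
    IsListedDerivedCommAssoc (AssocLabel.J04.table.extend 0 0 0 0 v w).Alg := by
  by_cases hv : v = 0
  · by_cases hw : w = 0
    · exact isListedDerivedCommAssoc_of_eq_assoc .J04 (by
        simp [Table.extend, AssocLabel.table, vec3_zero, hv, hw])
    · obtain ⟨k, hk, hkw⟩ := exists_sq_mul_eq_one hw
      have hI : (k * Complex.I) * (k * Complex.I) * w = -1 := by
        linear_combination k ^ 2 * w * Complex.I_mul_I - hkw
      -- On the span of `e₁, e₃` the product is a nondegenerate symmetric form with values in `ℂ
      -- e₂`. The vectors `e₁ ± i k e₃` are isotropic for it, with product `2 e₂`.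
      refine .inr (.inl ⟨.J05, Table.algIso _ _ ![1, 0, k * Complex.I] ![1, 0, -(k * Complex.I)]
        ![0, 2, 0] ?_ ?_ ?_ ?_ ?_ ?_ ?_⟩)
      · rw [Matrix.det_fin_three]
        simp only [Matrix.of_apply, Matrix.cons_val]
        ring_nf
        simp [hk]
      all_goals
        ext i
        fin_cases i <;> simp [Table.mul, Table.extend, AssocLabel.table, hv, hI,
          -mul_eq_mul_left_iff, -mul_eq_mul_right_iff]
      norm_num
  · refine (Table.extend_J04_algIso (a' := 0) (b' := 0) (p' := 0) (d' := 0) (v' := 1)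
      (w' := 0) 1 v w 0 0 one_ne_zero hv
      ?_ ?_ ?_ ?_ ?_ ?_).isListedDerivedCommAssoc
      (isListedDerivedCommAssoc_of_eq_derAssoc .A27 (by
        simp [Table.extend, AssocLabel.table, DerAssocLabel.table, vec3_zero])) <;>
      simp

/-- The square of the plane is `ℂ e₂`, and `p` measures its failure to be stable under
multiplication by `e₃`. If `p ≠ 0`, the shear and the two shifts clear `a`, `b` and `v`. If `p = 0`,
multiplication by `e₃` is triangular on the plane with eigenvalues `a, d`, and the shear removes `b`
when these differ and `a ≠ 0`. -/
theorem isListed_extend_J04 (a b p d v w : ℂ) :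
    IsListedDerivedCommAssoc (AssocLabel.J04.table.extend a b p d v w).Alg := by
  by_cases hp : p = 0
  · subst hp
    by_cases ha : a = 0
    · subst ha
      by_cases hd : d = 0
      · subst hd
        exact (Table.extend_J04_algIso (b' := 0) (d' := 0) (v' := v)
          (w' := w - b ^ 2) 1 1 0 (-b) 0 one_ne_zero one_ne_zero
          (by ring) (by ring) (by ring) (by ring) (by ring) (by ring)).isListedDerivedCommAssoc
          (isListed_extend_J04_nilpotent _ _)
      · refine (Table.extend_J04_algIso (a' := 0) (b' := 0) (p' := 0) (d' := 1) (v' := v / d ^ 2)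
          (w' := 0) d⁻¹ 1 0 (-b / d) (b ^ 2 / (2 * d ^ 2) - w / (2 * d ^ 2))
          (inv_ne_zero hd) one_ne_zero
          ?_ ?_ ?_ ?_ ?_ ?_).isListedDerivedCommAssoc
          (isListed_extend_J04_zero (v / d ^ 2)) <;> field_simp <;> ring
    · by_cases hd : d = a
      · subst hd
        refine (Table.extend_J04_algIso (a' := 1) (b' := b / d - v / (2 * d ^ 2)) (p' := 0)
          (d' := 1) (v' := 0) (w' := 0) d⁻¹ 1 0 (-v / (2 * d ^ 2))
          (b * v / (2 * d ^ 3) - v ^ 2 / (8 * d ^ 4) - w / (2 * d ^ 2))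
          (inv_ne_zero ha) one_ne_zero
          ?_ ?_ ?_ ?_ ?_ ?_).isListedDerivedCommAssoc
          (isListed_extend_J04_one _) <;> field_simp <;> ring
      · have h : a - d ≠ 0 := sub_ne_zero.2 (Ne.symm hd)
        refine (Table.extend_J04_algIso (a' := 1) (b' := 0) (p' := 0)
          (d' := d / a) (v' := 0) (w' := w / a ^ 2 - b * v / a ^ 3 + v ^ 2 / (4 * a ^ 4)) a⁻¹ 1
          ((b / a - v / (2 * a ^ 2)) * a / (a - d)) (-v / (2 * a ^ 2)) 0
          (inv_ne_zero ha) one_ne_zero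
          ?_ ?_ ?_ ?_ ?_ ?_).isListedDerivedCommAssoc
          (isListed_extend_J04_of_ne_one _ (by rwa [Ne, div_eq_one_iff_eq ha])) <;>
          field_simp <;> ring
  · refine (Table.extend_J04_algIso (a' := 0) (b' := 0) (p' := p) (d' := d + a) (v' := 0)
      (w' := w + 2 * (-(b - a * d / p) * b + (-(v - 2 * (b - a * d / p) * a) / (2 * p)) * d)
        + (b - a * d / p) ^ 2)
      1 1 (-a / p) (-(b - a * d / p)) (-(v - 2 * (b - a * d / p) * a) / (2 * p))
      one_ne_zero one_ne_zero
      ?_ ?_ ?_ ?_ ?_ ?_).isListedDerivedCommAssoc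
      (isListed_extend_J04_of_ne _ _ hp) <;> field_simp <;> ring

end ListingNilpotent

/-! ### Extensions of the zero plane: metabelian algebras. -/

section ListingZero

theorem isListed_extend_zeroTable_scaled (d v w : ℂ) :
    IsListedDerivedCommAssoc (zeroTable.extend 1 0 0 d v w).Alg := by
  by_cases h : d ≠ 0 ∨ w = 0
  · refine (Table.extend_zeroTable_algIso (a' := 1) (b' := 0) (p' := 0) (d' := d) (v' := 0)
      (w' := 0) 1 1 0 0 1 (-v / 2) (-w / (2 * d)) one_ne_zero (by simp)
      ?_ ?_ ?_ ?_ ?_ ?_).isListedDerivedCommAssoc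
      (isListedDerivedCommAssoc_of_eq_met (.M04 d) (by
        simp [Table.extend, zeroTable, MetLabel.table, vec3_zero])) <;>
      (try simp)
    · ring
    rcases h with h | h
    · field_simp
      ring
    · simp [h]
  · push Not at h
    obtain ⟨rfl, hw⟩ := h
    refine (Table.extend_zeroTable_algIso (a' := 1) (b' := 0) (p' := 0) (d' := 0) (v' := 0)
      (w' := 1) 1 1 0 0 w (-v / 2) 0 one_ne_zero (by simpa using hw)
      ?_ ?_ ?_ ?_ ?_ ?_).isListedDerivedCommAssoc
      (isListedDerivedCommAssoc_of_eq_met .M05 (by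
        simp [Table.extend, zeroTable, MetLabel.table, vec3_zero])) <;>
      (try simp)
    ring

theorem isListed_extend_zeroTable_diag {a d v w : ℂ} (h : ¬(a = 0 ∧ d = 0 ∧ v = 0 ∧ w = 0)) :
    IsListedDerivedCommAssoc (zeroTable.extend a 0 0 d v w).Alg := by
  by_cases ha : a = 0
  · by_cases hd : d = 0
    · subst ha hd
      by_cases hv : v = 0
      · have hw : w ≠ 0 := fun hw => h ⟨rfl, rfl, hv, hw⟩
        refine .inl ⟨.M01, Table.algIso _ _ ![0, 0, 1] ![0, w, 0] ![1, 0, 0]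
          ?_ ?_ ?_ ?_ ?_ ?_ ?_⟩
        · simpa [Matrix.det_fin_three] using hw
        all_goals
          ext i
          fin_cases i <;> simp [Table.mul, Table.extend, zeroTable, MetLabel.table, hv]
      · refine .inl ⟨.M01, Table.algIso _ _ ![0, 0, 1] ![v, w, 0] ![0, 1, 0]
          ?_ ?_ ?_ ?_ ?_ ?_ ?_⟩
        · simpa [Matrix.det_fin_three] using hv
        all_goals
          ext i
          fin_cases i <;> simp [Table.mul, Table.extend, zeroTable, MetLabel.table]
    · refine (Table.extend_zeroTable_algIso (a' := 1) (b' := 0) (p' := 0) (d' := a / d)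
        (v' := w / d ^ 2) (w' := v / d ^ 2) d⁻¹ 0 1 1 0 0 0 (inv_ne_zero hd) (by simp)
        ?_ ?_ ?_ ?_ ?_ ?_).isListedDerivedCommAssoc
        (isListed_extend_zeroTable_scaled _ _ _) <;> field_simp <;> ring
  · refine (Table.extend_zeroTable_algIso (a' := 1) (b' := 0) (p' := 0) (d' := d / a)
      (v' := v / a ^ 2) (w' := w / a ^ 2) a⁻¹ 1 0 0 1 0 0 (inv_ne_zero ha) (by simp)
      ?_ ?_ ?_ ?_ ?_ ?_).isListedDerivedCommAssoc
      (isListed_extend_zeroTable_scaled _ _ _) <;> field_simp <;> ring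

theorem isListed_extend_zeroTable_block (a v w : ℂ) {b : ℂ} (hb : b ≠ 0) :
    IsListedDerivedCommAssoc (zeroTable.extend a b 0 a v w).Alg := by
  by_cases ha : a = 0
  · subst ha
    by_cases hv : v = 0
    -- The vector `e₃ - (w / 2b) e₁` has square zero, because `e₁e₃ = b e₂` and `e₃² = w e₂`.
    · refine .inl ⟨.M02, Table.algIso _ _ ![1, 0, 0] ![-w / (2 * b), 0, 1] ![0, b, 0]
        ?_ ?_ ?_ ?_ ?_ ?_ ?_⟩
      · simpa [Matrix.det_fin_three] using hb
      all_goals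
        ext i
        fin_cases i <;> simp [Table.mul, Table.extend, zeroTable, MetLabel.table, hv]
      field_simp
      ring
    -- The basis is `e₃`, `e₃²`, `e₃ e₃²`.
    · refine .inl ⟨.M03, Table.algIso _ _ ![0, 0, 1] ![v, w, 0] ![0, v * b, 0]
        ?_ ?_ ?_ ?_ ?_ ?_ ?_⟩
      · simpa [Matrix.det_fin_three] using ⟨hv, hb⟩
      all_goals
        ext i
        fin_cases i <;> simp [Table.mul, Table.extend, zeroTable, MetLabel.table]
  · refine (Table.extend_zeroTable_algIso (a' := 1) (b' := 1) (p' := 0) (d' := 1) (v' := 0)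
      (w' := 0) a⁻¹ 1 0 0 (b / a) (-v / (2 * a ^ 2))
      (b * v / (2 * a ^ 3) - w / (2 * a ^ 2)) (inv_ne_zero ha) (by simp [ha, hb])
      ?_ ?_ ?_ ?_ ?_ ?_).isListedDerivedCommAssoc
      (isListedDerivedCommAssoc_of_eq_met .M06 (by
        simp [Table.extend, zeroTable, MetLabel.table, vec3_zero])) <;>
      field_simp <;> ring

theorem isListed_extend_zeroTable_triangular {a b d v w : ℂ}
    (h : ¬(a = 0 ∧ b = 0 ∧ d = 0 ∧ v = 0 ∧ w = 0)) :
    IsListedDerivedCommAssoc (zeroTable.extend a b 0 d v w).Alg := by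
  by_cases hb : b = 0
  · subst hb
    exact isListed_extend_zeroTable_diag fun ⟨h₁, h₂, h₃, h₄⟩ => h ⟨h₁, rfl, h₂, h₃, h₄⟩
  · by_cases had : a = d
    · subst had
      exact isListed_extend_zeroTable_block _ _ _ hb
    · have had' := sub_ne_zero.2 had
      refine (Table.extend_zeroTable_algIso (a' := a) (b' := 0) (p' := 0) (d' := d) (v' := v)
        (w' := w - b / (a - d) * v) 1 1 (b / (a - d)) 0 1 0 0 one_ne_zero (by simp)
        ?_ ?_ ?_ ?_ ?_ ?_).isListedDerivedCommAssoc
        (isListed_extend_zeroTable_diag ?_)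
      · ring
      · field_simp
        ring
      · ring
      · ring
      · ring
      · ring
      · rintro ⟨rfl, rfl, -⟩
        exact had rfl

/-- The algebra is encoded by the operator of multiplication by `e₃` on the plane and by the vector
`e₃²`. Every basis of the plane is allowed, so the operator is put in triangular form and then,
according to its eigenvalues, in diagonal or Jordan form. -/
theorem isListed_extend_zeroTable {a b p d v w : ℂ}
    (h : ∃ x y : (zeroTable.extend a b p d v w).Alg, x * y ≠ 0) :
    IsListedDerivedCommAssoc (zeroTable.extend a b p d v w).Alg := by
  by_cases hp : p = 0
  · subst hp
    refine isListed_extend_zeroTable_triangular ?_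
    rintro ⟨rfl, rfl, rfl, rfl, rfl⟩
    obtain ⟨x, y, hxy⟩ := h
    refine hxy ?_
    change Table.mul _ x y = 0
    simp [Table.mul, Table.extend, zeroTable, vec3_zero]
  · obtain ⟨k, hk⟩ := IsAlgClosed.exists_pow_nat_eq ((a - d) ^ 2 + 4 * p * b) (n := 2) (by norm_num)
    set l := (a + d + k) / 2 with hl
    have hl' : l ^ 2 = (a + d) * l - a * d + p * b := by
      rw [hl]
      linear_combination hk / 4
    -- For the eigenvalue `l` the vector `p e₁ + (l - a) e₂` is an eigenvector. It becomes the
    -- second basis vector, after `e₂`, and the off-diagonal entry is then `1`.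
    refine (Table.extend_zeroTable_algIso (a' := d - l + a) (b' := 1) (p' := 0) (d' := l)
      (v' := w - v / p * (l - a)) (w' := v / p) 1 0 1 p (l - a) 0 0 one_ne_zero (by simpa using hp)
      ?_ ?_ ?_ ?_ ?_ ?_).isListedDerivedCommAssoc
      (isListed_extend_zeroTable_triangular (by simp))
    · ring
    · ring
    · ring
    · linear_combination hl'
    · field_simp
      ring
    · ring

end ListingZero

/-! ### Extensions of the plane `𝔍04`. -/

section ListingJordan

theorem AlgIso.of_table_eq {T S : Table} (h : T = S) : AlgIso T.Alg S.Alg :=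
  h ▸ AlgIso.refl _

/-- Requiring `s c p = 1` turns `v` and `w` into `c² v` and `c³ p w`. When `v ≠ 0` this normalizes
`v` and leaves the sign of `c` free, which is the source of the identification of `α` with `-α`. -/
theorem exists_derJordanLabel_of_ne {p : ℂ} (hp : p ≠ 0) (v w : ℂ) :
    ∃ l : DerJordanLabel,
      AlgIso (JordanLabel.J18.table.extend 0 0 p 0 v w).Alg l.table.Alg := by
  by_cases hv : v = 0
  · subst hv
    by_cases hw : w = 0
    · refine ⟨.DJ03, (Table.extend_J18_algIso (a' := 0) (b' := 0) (p' := 1) (d' := 0) (v' := 0)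
        (w' := 0) 1 p⁻¹ 0 0 0 one_ne_zero (inv_ne_zero hp) ?_ ?_ ?_ ?_ ?_ ?_).trans
        (AlgIso.of_table_eq ?_)⟩ <;>
        simp [Table.extend, JordanLabel.table, DerJordanLabel.table, vec3_zero, hp, hw]
    · obtain ⟨c, hc, hcv⟩ := exists_pow_three_mul_eq_one (mul_ne_zero hp hw)
      refine ⟨.DJ02, (Table.extend_J18_algIso (a' := 0) (b' := 0) (p' := 1) (d' := 0) (v' := 0)
        (w' := 1) c (c ^ 2 * w) 0 0 0 hc (by positivity) ?_ ?_ ?_ ?_ ?_ ?_).trans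
        (AlgIso.of_table_eq ?_)⟩ <;>
        (try simp [Table.extend, JordanLabel.table, DerJordanLabel.table, vec3_zero])
      linear_combination -hcv
  · obtain ⟨c, hc, hcv⟩ := exists_sq_mul_eq_one hv
    refine ⟨.DJ01 (c ^ 3 * p * w), (Table.extend_J18_algIso (a' := 0) (b' := 0) (p' := 1)
      (d' := 0) (v' := 1) (w' := c ^ 3 * p * w) c (c * p)⁻¹ 0 0 0 hc
      (inv_ne_zero (mul_ne_zero hc hp)) ?_ ?_ ?_ ?_ ?_ ?_).trans
      (AlgIso.of_table_eq ?_)⟩ <;>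
      (try simp [Table.extend, JordanLabel.table, DerJordanLabel.table, hcv]) <;> field_simp

/-- The shear by `u`, followed by the shift `b₂ = -2u` that restores `e₁e₃ = 0`, replaces `w` by `w
- (4 + v) u`. Hence `w` can be cleared except at `v = -4`, where it can only be scaled to `1`. -/
theorem exists_derJordanLabel_one (v w : ℂ) :
    ∃ l : DerJordanLabel,
      AlgIso (JordanLabel.J18.table.extend 0 0 0 1 v w).Alg l.table.Alg := by
  by_cases h : v = -4 ∧ w ≠ 0
  · obtain ⟨rfl, hw⟩ := h
    refine ⟨.DJ05, (Table.extend_J18_algIso (a' := 0) (b' := 0) (p' := 0) (d' := 1) (v' := -4)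
      (w' := 1) 1 w 0 0 0 one_ne_zero hw ?_ ?_ ?_ ?_ ?_ ?_).trans
      (AlgIso.of_table_eq ?_)⟩ <;>
      simp [Table.extend, JordanLabel.table, DerJordanLabel.table, vec3_zero]
  · have hu : ∃ u, (4 + v) * u = w := by
      by_cases hv : 4 + v = 0
      · exact ⟨0, by rw [mul_zero]; by_contra hw; exact h ⟨by linear_combination hv, Ne.symm hw⟩⟩
      · exact ⟨w / (4 + v), mul_div_cancel₀ w hv⟩
    obtain ⟨u, rfl⟩ := hu
    refine ⟨.DJ04 v, (Table.extend_J18_algIso (a' := 0) (b' := 0) (p' := 0) (d' := 1) (v' := v)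
      (w' := 0) 1 1 u 0 (-2 * u) one_ne_zero one_ne_zero ?_ ?_ ?_ ?_ ?_ ?_).trans
      (AlgIso.of_table_eq ?_)⟩ <;>
      (try simp [Table.extend, JordanLabel.table, DerJordanLabel.table, vec3_zero])
    all_goals ring

theorem exists_derJordanLabel_zero (v w : ℂ) :
    AlgIso (JordanLabel.J18.table.extend 0 0 0 0 v w).Alg JordanLabel.J18.table.Alg ∨
    ∃ l : DerJordanLabel,
      AlgIso (JordanLabel.J18.table.extend 0 0 0 0 v w).Alg l.table.Alg := by
  by_cases hv : v = 0
  · subst hv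
    by_cases hw : w = 0
    · exact .inl (AlgIso.of_table_eq
        (by simp [Table.extend, JordanLabel.table, vec3_zero, hw]))
    · refine .inr ⟨.DJ07, (Table.extend_J18_algIso (a' := 0) (b' := 0) (p' := 0) (d' := 0)
        (v' := 0) (w' := 1) 1 w 0 0 0 one_ne_zero hw ?_ ?_ ?_ ?_ ?_ ?_).trans
        (AlgIso.of_table_eq ?_)⟩ <;>
        simp [Table.extend, JordanLabel.table, DerJordanLabel.table, vec3_zero]
  · obtain ⟨c, hc, hcv⟩ := exists_sq_mul_eq_one hv
    refine .inr ⟨.DJ06, (Table.extend_J18_algIso (a' := 0) (b' := 0) (p' := 0)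
      (d' := 0) (v' := 1) (w' := 0) c 1 (c ^ 2 * w) 0 0 hc one_ne_zero
      ?_ ?_ ?_ ?_ ?_ ?_).trans
      (AlgIso.of_table_eq ?_)⟩ <;>
      simp [Table.extend, JordanLabel.table, DerJordanLabel.table, vec3_zero, hcv]

/-- The extensions of `𝔍04`. -/
theorem exists_derJordanLabel (a b p d v w : ℂ) :
    AlgIso (JordanLabel.J18.table.extend a b p d v w).Alg JordanLabel.J18.table.Alg ∨
    ∃ l : DerJordanLabel,
      AlgIso (JordanLabel.J18.table.extend a b p d v w).Alg l.table.Alg := by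
  have h : ∃ d' v' w', AlgIso (JordanLabel.J18.table.extend a b p d v w).Alg
      (JordanLabel.J18.table.extend 0 0 p d' v' w').Alg :=
    ⟨d - a / 2, v - a ^ 2 - 4 * b * p, w - 4 * b * d,
      Table.extend_J18_algIso 1 1 0 (-a) (-2 * b) one_ne_zero one_ne_zero
      (by ring) (by ring) (by ring) (by ring) (by ring) (by ring)⟩
  obtain ⟨d, v, w, h⟩ := h
  by_cases hp : p = 0
  · subst hp
    by_cases hd : d = 0
    · subst hd
      exact (exists_derJordanLabel_zero v w).imp h.trans fun ⟨l, hl⟩ => ⟨l, h.trans hl⟩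
    · have h' := h.trans (Table.extend_J18_algIso (a' := 0) (b' := 0) (p' := 0) (d' := 1)
        (v' := v / d ^ 2) (w' := w / d ^ 2) d⁻¹ 1 0 0 0 (inv_ne_zero hd) one_ne_zero
        (by ring) (by ring) (by ring) (by field_simp; ring) (by field_simp; ring)
        (by field_simp; ring))
      obtain ⟨l, hl⟩ := exists_derJordanLabel_one (v / d ^ 2) (w / d ^ 2)
      exact .inr ⟨l, h'.trans hl⟩
  -- The shear by `u` forces the shifts `b₁ = -up` and `b₂ = -2pu²` if `e₁e₃ = 0` is to persist.
  -- Together they lower `d` by `3pu/2`, which fixes `u`.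
  · obtain ⟨u, rfl⟩ : ∃ u, d = 3 * p * u / 2 := ⟨2 * d / (3 * p), by field_simp⟩
    have h' := h.trans (Table.extend_J18_algIso (a' := 0) (b' := 0) (p' := p) (d' := 0)
      (v' := v - 3 * p ^ 2 * u ^ 2) (w' := w - v * u - p ^ 2 * u ^ 3) 1 1 u (-u * p)
      (-2 * p * u ^ 2) one_ne_zero one_ne_zero (by ring) (by ring) (by ring) (by ring) (by ring)
      (by ring))
    obtain ⟨l, hl⟩ := exists_derJordanLabel_of_ne hp (v - 3 * p ^ 2 * u ^ 2)
      (w - v * u - p ^ 2 * u ^ 3)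
    exact .inr ⟨l, h'.trans hl⟩

end ListingJordan

/-! ### Jordan identities, powers and idempotents. -/

section JordanIdentities

/-- The four powers are dependent for dimension reasons. A relation whose last nonzero coefficient
is at a lower power is multiplied by `x` until it ends in the fourth. -/
theorem exists_fourth_power_eq {A : Type*} [NonUnitalNonAssocCommRing A] [Module ℂ A]
    [SMulCommClass ℂ A A] [FiniteDimensional ℂ A] (hA : Module.finrank ℂ A < 4) (x : A) :
    ∃ a b c : ℂ, x * (x * (x * x)) = a • (x * (x * x)) + b • (x * x) + c • x := by
  have h : ¬LinearIndependent ℂ ![x, x * x, x * (x * x), x * (x * (x * x))] := fun hli => by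
    have := hli.fintype_card_le_finrank
    simp at this
    omega
  obtain ⟨g, hg, i, hi⟩ := Fintype.not_linearIndependent_iff.1 h
  simp only [Fin.sum_univ_four, Matrix.cons_val] at hg
  by_cases h₃ : g 3 = 0
  · by_cases h₂ : g 2 = 0
    · by_cases h₁ : g 1 = 0
      · have h₀ : g 0 ≠ 0 := by
          fin_cases i
          exacts [hi, (hi h₁).elim, (hi h₂).elim, (hi h₃).elim]
        have : x = 0 := by
          simpa [h₁, h₂, h₃, h₀] using hg
        exact ⟨0, 0, 0, by simp [this]⟩
      · simp only [h₂, h₃, zero_smul, add_zero] at hg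
        have := congrArg (fun y => x * (x * y)) hg
        simp only [mul_add, mul_smul_comm, mul_zero] at this
        refine ⟨-g 0 / g 1, 0, 0, ?_⟩
        linear_combination (norm := (match_scalars <;> field_simp <;> ring)) (g 1)⁻¹ • this
    · simp only [h₃, zero_smul, add_zero] at hg
      have := congrArg (fun y => x * y) hg
      simp only [mul_add, mul_smul_comm, mul_zero] at this
      refine ⟨-g 1 / g 2, -g 0 / g 2, 0, ?_⟩
      linear_combination (norm := (match_scalars <;> field_simp <;> ring)) (g 2)⁻¹ • this
  · refine ⟨-g 2 / g 3, -g 1 / g 3, -g 0 / g 3, ?_⟩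
    linear_combination (norm := (match_scalars <;> field_simp <;> ring)) (g 3)⁻¹ • hg

theorem mul_sq_mul {A : Type*} [NonUnitalNonAssocCommRing A] [IsCommJordan A] (x y : A) :
    x * y * (x * x) = x * (y * (x * x)) :=
  IsCommJordan.lmul_comm_rmul_rmul x y

variable {A : Type*} [NonUnitalNonAssocCommRing A] [Module ℂ A] [IsCommJordan A]

/-- Polarization: this is the part of the Jordan identity at `x + z` that is linear in `z`.
Subtracting the identity at `x - z` leaves the terms odd in `z`, and the identity at `z` removes the
cubic one. -/
theorem jordan_linearized (x y z : A) :
    (2 : ℂ) • (x * (y * (x * z))) + z * (y * (x * x)) =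
      (2 : ℂ) • (x * z * (x * y)) + x * x * (y * z) := by
  have h₁ := mul_sq_mul (x + z) y
  have h₂ := mul_sq_mul (x - z) y
  have h₃ := mul_sq_mul z y
  simp only [mul_add, add_mul, mul_sub, mul_comm] at *
  linear_combination (norm := module) (-1 / 2 : ℂ) • (h₁ - h₂ - (2 : ℂ) • h₃)

theorem jordan_trilinear (x y z w : A) :
    x * (y * (w * z)) + w * (y * (x * z)) + z * (y * (x * w)) =
      w * z * (x * y) + x * z * (w * y) + x * w * (y * z) := by
  have h₁ := jordan_linearized (x + w) y z
  have h₂ := jordan_linearized x y z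
  have h₃ := jordan_linearized w y z
  simp only [mul_add, add_mul, mul_comm] at *
  linear_combination (norm := module) (1 / 2 : ℂ) • (h₁ - h₂ - h₃)

theorem sq_mul_sq {A : Type*} [NonUnitalNonAssocCommRing A] [IsCommJordan A] (x : A) :
    x * x * (x * x) = x * (x * (x * x)) := mul_sq_mul x x

theorem sq_mul_cube {A : Type*} [NonUnitalNonAssocCommRing A] [IsCommJordan A] (x : A) :
    x * x * (x * (x * x)) = x * (x * (x * (x * x))) := by
  rw [mul_comm, mul_sq_mul, sq_mul_sq]

/-- Putting `y = z = x²` in the linearized identity cancels `x²(x²x²)` on both sides and leaves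
`x(x²x³) = x³x³`. -/
theorem cube_mul_cube (x : A) :
    x * (x * x) * (x * (x * x)) = x * (x * (x * (x * (x * x)))) := by
  have h := jordan_linearized x (x * x) (x * x)
  rw [add_left_inj, sq_mul_cube] at h
  exact (smul_right_injective A (two_ne_zero (α := ℂ)) h).symm

/-! ### Peirce decomposition. -/

section Peirce

variable {e : A}

/-- For `j ≠ 1/2` the factor cancels, and multiplication by the `j`-eigenspace preserves the
`i`-eigenspace. In particular the eigenspaces for `1` and `0` are subalgebras annihilating each
other. For `j = 1/2` the statement is empty, and `peirce_half_mul` takes its place. -/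
theorem peirce_mul (he : e * e = e) {i j : ℂ} {y z : A} (hy : e * y = i • y) (hz : e * z = j • z)
    [IsScalarTower ℂ A A] [SMulCommClass ℂ A A] :
    (2 * j - 1) • (e * (y * z)) = ((2 * j - 1) * i) • (y * z) := by
  have h := jordan_linearized e y z
  rw [hz, he, mul_comm y e, hy, mul_comm z] at h
  simp only [mul_smul_comm, smul_mul_assoc, mul_comm z y] at h
  linear_combination (norm := module) h

theorem peirce_half_mul (he : e * e = e) {y z : A} (hy : e * y = (1 / 2 : ℂ) • y)
    (hz : e * z = (1 / 2 : ℂ) • z) [IsScalarTower ℂ A A] [SMulCommClass ℂ A A] :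
    e * (e * (y * z)) = e * (y * z) := by
  have h := jordan_trilinear e e y z
  rw [hy, he] at h
  simp only [mul_comm z e, mul_comm (y * z) e, hy, hz, mul_smul_comm, smul_mul_assoc,
    mul_comm z y] at h
  linear_combination (norm := module) h

theorem peirce_cubic (he : e * e = e) (z : A) :
    (2 : ℂ) • (e * (e * (e * z))) = (3 : ℂ) • (e * (e * z)) - e * z := by
  have h := jordan_linearized e e z
  rw [he, he, mul_comm z e, mul_comm (e * z) e] at h
  linear_combination (norm := module) h

theorem exists_peirce_decomposition (he : e * e = e) [IsScalarTower ℂ A A] [SMulCommClass ℂ A A]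
    (z : A) : ∃ a b c : A, z = a + b + c ∧ e * a = (1 : ℂ) • a ∧ e * b = (1 / 2 : ℂ) • b ∧
      e * c = (0 : ℂ) • c := by
  have h := peirce_cubic he z
  -- With `L` the multiplication by `e`, these are the Lagrange polynomials `2L² - L`, `4L - 4L²`,
  -- `1 - 3L + 2L²` for the roots `1, 1/2, 0` of `L(2L - 1)(L - 1)`.
  refine ⟨(2 : ℂ) • (e * (e * z)) - e * z, (4 : ℂ) • (e * z) - (4 : ℂ) • (e * (e * z)),
    z - (3 : ℂ) • (e * z) + (2 : ℂ) • (e * (e * z)), ?_, ?_, ?_, ?_⟩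
  · module
  · simp only [mul_sub, mul_smul_comm]
    linear_combination (norm := module) h
  · simp only [mul_sub, mul_smul_comm]
    linear_combination (norm := module) (-2 : ℂ) • h
  · simp only [mul_sub, mul_add, mul_smul_comm]
    linear_combination (norm := module) h

end Peirce

variable [IsScalarTower ℂ A A] [SMulCommClass ℂ A A]

/-- The powers of `x` needed here multiply as in a polynomial ring without constant term modulo `t⁴
- at³ - bt² - ct`. The idempotent is the polynomial that is `1` modulo the part of the relation
prime to `t`. -/
theorem exists_idempotent_of_fourth_power {x : A} {a b c : ℂ}
    (h : x * (x * (x * x)) = a • (x * (x * x)) + b • (x * x) + c • x)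
    (h₀ : x * (x * (x * x)) ≠ 0) :
    ∃ p q r : ℂ, ∃ e : A, e = p • x + q • (x * x) + r • (x * (x * x)) ∧ e ≠ 0 ∧ e * e = e := by
  have h₅ : x * (x * (x * (x * x))) =
      a • (x * (x * (x * x))) + b • (x * (x * x)) + c • (x * x) := by
    rw [h]; simp only [mul_add, mul_smul_comm]; rw [h]
  have h₆ : x * (x * (x * (x * (x * x)))) =
      a • (x * (x * (x * (x * x)))) + b • (x * (x * (x * x))) + c • (x * (x * x)) := by
    rw [h₅]; simp only [mul_add, mul_smul_comm]; rw [h₅]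
  have hqq := sq_mul_sq x
  have hqr := sq_mul_cube x
  have hrr := cube_mul_cube x
  have hrx : x * (x * x) * x = x * (x * (x * x)) := mul_comm _ _
  have hqx : x * x * x = x * (x * x) := mul_comm _ _
  have hrq : x * (x * x) * (x * x) = x * (x * (x * (x * x))) := by rw [mul_comm, hqr]
  by_cases hc : c = 0
  · subst hc
    simp only [zero_smul, add_zero] at h h₅ h₆
    by_cases hb : b = 0
    · subst hb
      have ha : a ≠ 0 := by
        rintro rfl
        exact h₀ (by rw [h]; simp)
      simp only [zero_smul, add_zero] at h h₅ h₆
      refine ⟨0, 0, (a ^ 3)⁻¹, (a ^ 3)⁻¹ • (x * (x * x)), by module, fun he => h₀ ?_, ?_⟩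
      · rw [smul_eq_zero] at he
        rw [he.resolve_left (by positivity), mul_zero]
      · rw [smul_mul_smul_comm, hrr, h₆, h₅, h]
        match_scalars
        field_simp
    -- Modulo `t² - at - b` the inverse of `t²` is `m + l t`, so `m t² + l t³` acts as the identity
    -- on `x²` and `x³`.
    · set l := -a / b ^ 2 with hl
      set m := 1 / b + a ^ 2 / b ^ 2 with hm
      have hqe : x * x * (m • (x * x) + l • (x * (x * x))) = x * x := by
        simp only [mul_add, mul_smul_comm]
        rw [hqq, hqr, h₅, h]
        match_scalars
        · rw [hl, hm]
          field_simp
          ring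
        · rw [hl, hm]
          field_simp
          ring
      have hre : x * (x * x) * (m • (x * x) + l • (x * (x * x))) = x * (x * x) := by
        have := congrArg (x * ·) hqe
        simp only [mul_add, mul_smul_comm, hqq, hqr] at this
        simp only [mul_add, mul_smul_comm, hrq, hrr]
        exact this
      refine ⟨0, m, l, m • (x * x) + l • (x * (x * x)), by module, fun he => h₀ ?_, ?_⟩
      · rw [he, mul_zero] at hqe
        rw [← hqe, mul_zero, mul_zero]
      · conv_lhs => rw [add_mul, smul_mul_assoc, smul_mul_assoc, hqe, hre]
  -- Dividing the relation by `c t` shows that this element fixes `x`.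
  · set e := (-b / c) • x + (-a / c) • (x * x) + (1 / c) • (x * (x * x)) with he
    have hxe : x * e = x := by
      simp only [he, mul_add, mul_smul_comm]
      rw [h]
      match_scalars <;> field_simp <;> ring
    have hqe : x * x * e = x * x := by
      simp only [he, mul_add, mul_smul_comm]
      rw [hqx, hqq, hqr, h₅]
      match_scalars <;> field_simp <;> ring
    have hre : x * (x * x) * e = x * (x * x) := by
      simp only [he, mul_add, mul_smul_comm]
      rw [hrx, hrq, hrr, h₆]
      match_scalars <;> field_simp <;> ring
    refine ⟨-b / c, -a / c, 1 / c, e, he, fun h0 => h₀ ?_, ?_⟩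
    · rw [h0, mul_zero] at hxe
      rw [← hxe]
      simp
    · conv_lhs => enter [1]; rw [he]
      rw [add_mul, add_mul, smul_mul_assoc, smul_mul_assoc, smul_mul_assoc, hxe, hqe, hre]

end JordanIdentities

/-! ### Linear algebra in dimensions two and three. -/

section LinearAlgebra

variable {V : Type*} [AddCommGroup V] [Module ℂ V]

theorem linearIndependent_three {x y z : V} (h : LinearIndependent ℂ ![x, y])
    (hz : z ∉ Submodule.span ℂ {x, y}) : LinearIndependent ℂ ![x, y, z] := by
  have : LinearIndependent ℂ ![z, x, y] := by
    refine linearIndependent_finCons.2 ⟨h, ?_⟩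
    rwa [Matrix.range_cons, Matrix.range_cons, Matrix.range_empty, Set.union_empty,
      Set.singleton_union]
  rw [LinearIndependent.pair_iff] at h
  rw [Fintype.linearIndependent_iff] at this ⊢
  intro g hg
  have h' := this ![g 2, g 0, g 1] (by
    simp only [Fin.sum_univ_three, Matrix.cons_val] at hg ⊢
    rw [← hg]; abel)
  intro i
  fin_cases i
  exacts [h' 1, h' 2, h' 0]

theorem LinearIndependent.exists_coords_two (hV : Module.finrank ℂ V = 2) {x y : V}
    (h : LinearIndependent ℂ ![x, y]) (z : V) : ∃ a b : ℂ, z = a • x + b • y := by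
  have := h.span_eq_top_of_card_eq_finrank (by simp [hV])
  have hz : z ∈ Submodule.span ℂ (Set.range ![x, y]) := this ▸ Submodule.mem_top
  simp only [Matrix.range_cons, Matrix.range_empty, Set.union_empty, Set.singleton_union,
    Submodule.mem_span_pair] at hz
  obtain ⟨a, b, hab⟩ := hz
  exact ⟨a, b, hab.symm⟩

theorem LinearIndependent.exists_coords_three (hV : Module.finrank ℂ V = 3) {x y z : V}
    (h : LinearIndependent ℂ ![x, y, z]) (w : V) :
    ∃ a b c : ℂ, w = a • x + b • y + c • z := by
  have := h.span_eq_top_of_card_eq_finrank (by simp [hV])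
  have hw : w ∈ Submodule.span ℂ (Set.range ![x, y, z]) := this ▸ Submodule.mem_top
  simp only [Matrix.range_cons, Matrix.range_empty, Set.union_empty, Set.singleton_union,
    Submodule.mem_span_triple] at hw
  obtain ⟨a, b, c, hab⟩ := hw
  exact ⟨a, b, c, hab.symm⟩

theorem linearIndependent_three_iff {x y z : V} : LinearIndependent ℂ ![x, y, z] ↔
    ∀ a b c : ℂ, a • x + b • y + c • z = 0 → a = 0 ∧ b = 0 ∧ c = 0 := by
  rw [Fintype.linearIndependent_iff]
  constructor
  · intro h a b c habc
    have := h ![a, b, c] (by simpa [Fin.sum_univ_three] using habc)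
    exact ⟨this 0, this 1, this 2⟩
  · intro h g hg i
    simp only [Fin.sum_univ_three, Matrix.cons_val] at hg
    obtain ⟨h₀, h₁, h₂⟩ := h _ _ _ hg
    fin_cases i
    exacts [h₀, h₁, h₂]

theorem span_pair_ne_top (hV : Module.finrank ℂ V = 3) (x y : V) :
    Submodule.span ℂ {x, y} ≠ ⊤ := by
  intro h
  classical
  have h₁ := finrank_span_finset_le_card (R := ℂ) ({x, y} : Finset V)
  rw [Finset.coe_pair, Set.finrank, h, finrank_top, hV] at h₁
  have h₂ := Finset.card_le_two (a := x) (b := y)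
  omega

theorem span_singleton_ne_top (hV : 1 < Module.finrank ℂ V) (x : V) :
    Submodule.span ℂ {x} ≠ ⊤ := by
  intro h
  have h₁ := finrank_span_le_card (R := ℂ) (M := V) {x}
  rw [h, finrank_top] at h₁
  simp at h₁
  omega

theorem linearIndependent_two {x y : V} (hx : x ≠ 0) (hy : y ∉ Submodule.span ℂ {x}) :
    LinearIndependent ℂ ![x, y] :=
  (LinearIndependent.pair_iff' hx).2 fun a h => hy (Submodule.mem_span_singleton.2 ⟨a, h⟩)

end LinearAlgebra

/-! ### Two-dimensional Jordan algebras. -/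

section TwoDimensional

theorem eq_zero_of_mul_self {A : Type*} [NonUnitalNonAssocCommRing A] [Module ℂ A] {x : A}
    (h : ∀ y : A, y * y = 0) (y : A) : x * y = 0 := by
  have h' := h (x + y)
  rw [mul_add, add_mul, add_mul, h x, h y, mul_comm y x, zero_add, add_zero, ← two_smul ℂ] at h'
  simpa using h'

theorem linearIndependent_powers {A : Type*} [NonUnitalNonAssocCommRing A] [Module ℂ A]
    [SMulCommClass ℂ A A] {x : A} (h₃ : x * (x * x) ≠ 0) (h₄ : x * (x * (x * x)) = 0) :
    LinearIndependent ℂ ![x, x * x, x * (x * x)] := by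
  rw [linearIndependent_three_iff]
  intro a b c h
  have h₂ := congrArg (fun y => x * (x * y)) h
  have h₁ := congrArg (fun y => x * y) h
  simp only [mul_add, mul_smul_comm, h₄, mul_zero, smul_zero, add_zero,
    smul_eq_zero, h₃, or_false] at h₂
  simp only [mul_add, mul_smul_comm, h₄, smul_zero, add_zero, h₂, zero_smul, zero_add,
    smul_eq_zero, h₃, or_false, mul_zero] at h₁
  simp only [h₁, h₂, zero_smul, zero_add, smul_eq_zero, h₃, or_false] at h
  exact ⟨h₂, h₁, h⟩

/-- The vectors `x` and `y` multiply like `e₁` and `e₂` in the table `T`. -/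
structure Table.Matches (T : Table) {A : Type*} [NonUnitalNonAssocCommRing A] [Module ℂ A]
    (x y : A) : Prop where
  xx : x * x = T.e1e1 0 • x + T.e1e1 1 • y
  xy : x * y = T.e1e2 0 • x + T.e1e2 1 • y
  yy : y * y = T.e2e2 0 • x + T.e2e2 1 • y

/-- The tables of the two-dimensional Jordan algebras. -/
def planeTables : Set Table :=
  {AssocLabel.J01.table, AssocLabel.J02.table, AssocLabel.J03.table, AssocLabel.J04.table,
    zeroTable, JordanLabel.J18.table}

variable {A : Type*} [NonUnitalNonAssocCommRing A] [Module ℂ A]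

theorem exists_eigenvector_notMem [IsCommJordan A] [IsScalarTower ℂ A A] [SMulCommClass ℂ A A]
    {e : A} (he : e * e = e) {S : Submodule ℂ A} (hS : S ≠ ⊤) :
    ∃ i : ℂ, (i = 1 ∨ i = 1 / 2 ∨ i = 0) ∧ ∃ u, u ∉ S ∧ e * u = i • u := by
  by_contra! h
  refine hS ((Submodule.eq_top_iff').2 fun z => ?_)
  obtain ⟨a, b, c, rfl, ha, hb, hc⟩ := exists_peirce_decomposition he z
  refine S.add_mem (S.add_mem ?_ ?_) ?_
  · by_contra h'
    exact h 1 (.inl rfl) a h' ha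
  · by_contra h'
    exact h _ (.inr (.inl rfl)) b h' hb
  · by_contra h'
    exact h _ (.inr (.inr rfl)) c h' hc

/-- Computing the fourth power in two ways gives `(u²)² = c² e` and `u(u u²) = (c²/2) e`. -/
theorem isHalf_sq_eq_zero [IsCommJordan A] [IsScalarTower ℂ A A] [SMulCommClass ℂ A A]
    {e u : A} {c : ℂ} (he : e * e = e) (he₀ : e ≠ 0) (hu : e * u = (1 / 2 : ℂ) • u)
    (huu : u * u = c • e) : c = 0 := by
  have h := sq_mul_sq u
  simp only [huu, mul_smul_comm, smul_mul_assoc, he, hu, mul_comm u e, smul_smul] at h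
  have h' : (c * c / 2) • e = 0 := by
    linear_combination (norm := module) h
  simpa [he₀] using h'

/-- An idempotent `e` has a second eigenvector `u`. Eigenvalue `1` gives `J02` or `J01` after
completing the square, `1/2` gives `𝔍04`, and `0` gives `J03` or `J01`. Without idempotents all
cubes vanish, which leaves `J04` and the zero algebra. -/
theorem exists_matches_planeTables [IsCommJordan A] [IsScalarTower ℂ A A] [SMulCommClass ℂ A A]
    (hA : Module.finrank ℂ A = 2) :
    ∃ T ∈ planeTables, ∃ x y : A, LinearIndependent ℂ ![x, y] ∧ T.Matches x y := by
  have hfin : FiniteDimensional ℂ A := Module.finite_of_finrank_pos (by omega)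
  by_cases hid : ∃ e : A, e ≠ 0 ∧ e * e = e
  · obtain ⟨e, he₀, he⟩ := hid
    obtain ⟨i, hi, u, hu, heu⟩ :=
      exists_eigenvector_notMem he (span_singleton_ne_top (by omega) e)
    have hli := linearIndependent_two he₀ hu
    have hu₀ : u ≠ 0 := fun h => hu (h ▸ Submodule.zero_mem _)
    obtain ⟨a, b, huu⟩ := LinearIndependent.exists_coords_two hA hli (u * u)
    rcases hi with rfl | rfl | rfl
    · rw [one_smul] at heu
      set t := u - (b / 2) • e with ht
      have het : e * t = t := by
        simp only [ht, mul_sub, mul_smul_comm, heu, he]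
      have htt : t * t = (a + b ^ 2 / 4) • e := by
        simp only [ht, mul_sub, sub_mul, mul_smul_comm, smul_mul_assoc, mul_comm u e, heu, he, huu]
        module
      have hlt : LinearIndependent ℂ ![e, t] := by
        refine linearIndependent_two he₀ fun h => hu ?_
        have : u = t + (b / 2) • e := by rw [ht]; abel
        rw [this]
        exact Submodule.add_mem _ h (Submodule.smul_mem _ _ (Submodule.mem_span_singleton_self e))
      by_cases hk : a + b ^ 2 / 4 = 0
      · exact ⟨_, by simp [planeTables], e, t, hlt,
          (show AssocLabel.J02.table.Matches e t from ⟨by simp [AssocLabel.table, he],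
            by simp [AssocLabel.table, het], by simp [AssocLabel.table, htt, hk]⟩)⟩
      -- Now `(k t)² = e`, so the unital plane splits along the orthogonal idempotents `(e ± k t) /
      -- 2`.
      · obtain ⟨k, hk₀, hk⟩ := exists_sq_mul_eq_one hk
        refine ⟨_, by simp [planeTables], (1 / 2 : ℂ) • (e + k • t), (1 / 2 : ℂ) • (e - k • t), ?_,
          (show AssocLabel.J01.table.Matches _ _ from ⟨?_, ?_, ?_⟩)⟩
        · rw [LinearIndependent.pair_iff] at hlt ⊢
          intro p q hpq
          obtain ⟨h₁, h₂⟩ := hlt ((p + q) / 2) (k * (p - q) / 2) (by rw [← hpq]; module)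
          have h₃ : p - q = 0 := by simpa [hk₀] using h₂
          constructor
          · linear_combination h₁ + h₃ / 2
          · linear_combination h₁ - h₃ / 2
        all_goals
          simp only [AssocLabel.table, Matrix.cons_val, mul_sub, sub_mul, mul_add, add_mul,
            mul_smul_comm, smul_mul_assoc, mul_comm t e, het, he, htt, smul_smul, Pi.zero_apply]
          match_scalars
        · linear_combination hk / 4
        · ring
        · linear_combination -hk / 4
        · ring
        · linear_combination hk / 4
        · ring
    · have h := peirce_half_mul he heu heu
      simp only [huu, mul_add, mul_smul_comm, he, heu, smul_smul] at h
      have hb : (b * (1 / 4)) • u = 0 := by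
        linear_combination (norm := module) -h
      have hb : b = 0 := by simpa [hu₀] using hb
      rw [hb, zero_smul, add_zero] at huu
      have ha := isHalf_sq_eq_zero he he₀ heu huu
      exact ⟨_, by simp [planeTables], e, u, hli,
        (show JordanLabel.J18.table.Matches e u from ⟨by simp [JordanLabel.table, he],
          by simp [JordanLabel.table, heu], by simp [JordanLabel.table, huu, ha]⟩)⟩
    · have h := peirce_mul he heu heu
      rw [zero_smul] at heu
      simp only [huu, mul_add, mul_smul_comm, he, heu, mul_zero, zero_smul, zero_sub, smul_zero,
        add_zero, neg_smul, one_smul, neg_eq_zero, smul_eq_zero, he₀, or_false] at h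
      subst h
      rw [zero_smul, zero_add] at huu
      by_cases hb : b = 0
      · exact ⟨_, by simp [planeTables], e, u, hli,
          (show AssocLabel.J03.table.Matches e u from ⟨by simp [AssocLabel.table, he],
            by simp [AssocLabel.table, heu], by simp [AssocLabel.table, huu, hb]⟩)⟩
      · refine ⟨_, by simp [planeTables], e, b⁻¹ • u, ?_,
          (show AssocLabel.J01.table.Matches e (b⁻¹ • u) from ⟨by simp [AssocLabel.table, he],
            by simp [AssocLabel.table, heu, mul_smul_comm], ?_⟩)⟩
        · refine linearIndependent_two he₀ fun h => hu ?_
          have := Submodule.smul_mem _ b h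
          rwa [smul_inv_smul₀ hb] at this
        · rw [smul_mul_smul_comm, huu, smul_smul, inv_mul_cancel_right₀ hb]
          simp [AssocLabel.table]
  · have hnil : ∀ x : A, x * (x * (x * x)) = 0 := by
      intro x
      obtain ⟨a, b, c, h⟩ := exists_fourth_power_eq (by omega) x
      by_contra h₀
      obtain ⟨p, q, r, e, -, he₀, he⟩ := exists_idempotent_of_fourth_power h h₀
      exact hid ⟨e, he₀, he⟩
    by_cases hsq : ∀ x : A, x * x = 0
    · have hzero : ∀ x y : A, x * y = 0 := fun x => eq_zero_of_mul_self hsq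
      let b := Module.finBasisOfFinrankEq ℂ A hA
      refine ⟨_, by simp [planeTables], b 0, b 1, ?_,
        (show zeroTable.Matches (b 0) (b 1) from
          ⟨by simp [zeroTable, hzero], by simp [zeroTable, hzero], by simp [zeroTable, hzero]⟩)⟩
      convert b.linearIndependent
      ext i
      fin_cases i <;> rfl
    · push Not at hsq
      obtain ⟨x, hx⟩ := hsq
      have hr : x * (x * x) = 0 := by
        by_contra hr
        have := (linearIndependent_powers hr (hnil x)).fintype_card_le_finrank
        simp at this
        omega
      refine ⟨_, by simp [planeTables], x, x * x, ?_,
        (show AssocLabel.J04.table.Matches x (x * x) from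
          ⟨by simp [AssocLabel.table], by simp [AssocLabel.table, hr], ?_⟩)⟩
      · rw [LinearIndependent.pair_iff]
        intro a b h
        have h₁ := congrArg (fun y => x * y) h
        simp only [mul_add, mul_smul_comm, hr, smul_zero, add_zero, smul_eq_zero, hx, or_false,
          mul_zero] at h₁
        simp only [h₁, zero_smul, zero_add, smul_eq_zero, hx, or_false] at h
        exact ⟨h₁, h⟩
      · rw [sq_mul_sq, hr]
        simp [AssocLabel.table]

end TwoDimensional

/-! ### Derived algebras and the case `A² ≠ A`. -/

section DerivedAlgebra

variable {A B : Type*} [NonUnitalNonAssocCommRing A] [Module ℂ A]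
  [NonUnitalNonAssocCommRing B] [Module ℂ B]

theorem mul_mem_derivedAlgebra (x y : A) : x * y ∈ derivedAlgebra A :=
  Submodule.subset_span ⟨x, y, rfl⟩

instance [IsScalarTower ℂ A A] :
    IsScalarTower ℂ (derivedAlgebra A) (derivedAlgebra A) :=
  ⟨fun c x y => Subtype.ext (smul_mul_assoc c (x : A) (y : A))⟩

instance [SMulCommClass ℂ A A] :
    SMulCommClass ℂ (derivedAlgebra A) (derivedAlgebra A) :=
  ⟨fun c x y => Subtype.ext (mul_smul_comm c (x : A) (y : A)).symm⟩

theorem derivedAlgebra_le {S : Submodule ℂ A} (h : ∀ x y : A, x * y ∈ S) {x : A}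
    (hx : x ∈ derivedAlgebra A) : x ∈ S :=
  Submodule.span_le.2 (by rintro _ ⟨x, y, rfl⟩; exact h x y) hx

theorem isDerivedCommAssoc_iff : IsDerivedCommAssoc A ↔
    ∀ x ∈ derivedAlgebra A, ∀ y ∈ derivedAlgebra A, ∀ z ∈ derivedAlgebra A,
      x * y * z = x * (y * z) :=
  ⟨fun h x hx y hy z hz => congrArg Subtype.val (h ⟨x, hx⟩ ⟨y, hy⟩ ⟨z, hz⟩),
    fun h x y z => Subtype.ext (h x x.2 y y.2 z z.2)⟩

theorem isDerivedJordan_iff : IsDerivedJordan A ↔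
    ∀ x ∈ derivedAlgebra A, ∀ y ∈ derivedAlgebra A, x * y * (x * x) = x * (y * (x * x)) :=
  ⟨fun h x hx y hy => congrArg Subtype.val (h.lmul_comm_rmul_rmul ⟨x, hx⟩ ⟨y, hy⟩),
    fun h => ⟨fun x y => Subtype.ext (h x x.2 y y.2)⟩⟩

theorem AlgIso.isDerivedCommAssoc (h : AlgIso A B) (hB : IsDerivedCommAssoc B) :
    IsDerivedCommAssoc A := by
  obtain ⟨f, hf⟩ := h
  have hmem : ∀ x ∈ derivedAlgebra A, f x ∈ derivedAlgebra B := fun x hx =>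
    derivedAlgebra_le (S := (derivedAlgebra B).toSubmodule.comap f.toLinearMap)
      (fun x y => show f (x * y) ∈ _ by rw [hf]; exact mul_mem_derivedAlgebra _ _) hx
  rw [isDerivedCommAssoc_iff] at *
  intro x hx y hy z hz
  apply f.injective
  simp only [hf]
  exact hB _ (hmem x hx) _ (hmem y hy) _ (hmem z hz)

/-- The vectors of `ℂ³` whose last coordinate vanishes. -/
def planeSubmodule : Submodule ℂ (Fin 3 → ℂ) := LinearMap.ker (LinearMap.proj 2)

theorem mem_planeSubmodule {x : Fin 3 → ℂ} : x ∈ planeSubmodule ↔ x 2 = 0 := Iff.rfl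

/-- All products in the algebra of the table have vanishing last coordinate. -/
structure Table.IsPlane (t : Table) : Prop where
  e1e1 : t.e1e1 2 = 0
  e1e2 : t.e1e2 2 = 0
  e1e3 : t.e1e3 2 = 0
  e2e2 : t.e2e2 2 = 0
  e2e3 : t.e2e3 2 = 0
  e3e3 : t.e3e3 2 = 0

theorem Table.IsPlane.mul_two {t : Table} (h : t.IsPlane) (x y : Fin 3 → ℂ) :
    t.mul x y 2 = 0 := by
  simp [Table.mul, h.e1e1, h.e1e2, h.e1e3, h.e2e2, h.e2e3, h.e3e3]

theorem Table.IsPlane.mem {t : Table} (h : t.IsPlane) {x : t.Alg}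
    (hx : x ∈ derivedAlgebra t.Alg) : (show Fin 3 → ℂ from x) 2 = 0 :=
  derivedAlgebra_le (A := t.Alg) (S := (planeSubmodule : Submodule ℂ (Fin 3 → ℂ)))
    (fun x y => mem_planeSubmodule.2 (h.mul_two x y)) hx

theorem Table.isPlane_extend {T : Table} (hT : T ∈ planeTables) (a b p d v w : ℂ) :
    (T.extend a b p d v w).IsPlane := by
  rcases hT with rfl | rfl | rfl | rfl | rfl | rfl <;>
    constructor <;> simp [Table.extend, AssocLabel.table, JordanLabel.table, zeroTable]

/-- All products have vanishing third coordinate, so the derived algebra sits in the plane of `T`;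
each of the five planes other than `𝔍04` is associative. -/
theorem isDerivedCommAssoc_extend {T : Table} (hT : T ∈ planeTables)
    (hT' : T ≠ JordanLabel.J18.table) (a b p d v w : ℂ) :
    IsDerivedCommAssoc (T.extend a b p d v w).Alg := by
  rw [isDerivedCommAssoc_iff]
  have key : ∀ x y z : Fin 3 → ℂ, x 2 = 0 → y 2 = 0 → z 2 = 0 →
      (T.extend a b p d v w).mul ((T.extend a b p d v w).mul x y) z =
        (T.extend a b p d v w).mul x ((T.extend a b p d v w).mul y z) := by
    intro x y z hx hy hz
    rcases hT with rfl | rfl | rfl | rfl | rfl | rfl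
    on_goal 6 => exact absurd rfl hT'
    all_goals
      ext i
      fin_cases i <;>
        simp [Table.mul, Table.extend, AssocLabel.table, zeroTable, hx, hy, hz] <;> ring
  have h := Table.isPlane_extend hT a b p d v w
  exact fun x hx y hy z hz => key x y z (h.mem hx) (h.mem hy) (h.mem hz)

/-- Multiplication by `z` has rank at most one, so its kernel has dimension at least two and is not
contained in `ℂz`. -/
theorem exists_annihilated [SMulCommClass ℂ A A] (hA : Module.finrank ℂ A = 3) {z : A}
    (hmul : ∀ s t : A, s * t ∈ Submodule.span ℂ {z}) :
    ∃ w, w ∉ Submodule.span ℂ {z} ∧ z * w = 0 := by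
  simp only [Submodule.mem_span_singleton] at hmul
  obtain ⟨k, -, hk⟩ := SetLike.exists_of_lt (lt_top_iff_ne_top.2
    (span_singleton_ne_top (by omega : 1 < Module.finrank ℂ A) z))
  obtain ⟨l, -, hl⟩ := SetLike.exists_of_lt (lt_top_iff_ne_top.2 (span_pair_ne_top hA z k))
  obtain ⟨a, ha⟩ := hmul z k
  obtain ⟨b, hb⟩ := hmul z l
  by_cases ha₀ : a = 0
  · exact ⟨k, hk, by rw [← ha, ha₀, zero_smul]⟩
  · refine ⟨l - (b / a) • k, fun h => hl ?_, ?_⟩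
    · have h₁ : (b / a) • k ∈ Submodule.span ℂ {z, k} :=
        Submodule.smul_mem _ _ (Submodule.subset_span (by simp))
      have h₂ := Submodule.add_mem _
        (Submodule.span_mono (Set.singleton_subset_iff.2 (Set.mem_insert z {k})) h) h₁
      rwa [sub_add_cancel] at h₂
    · rw [mul_sub, mul_smul_comm, ← ha, ← hb, smul_smul, div_mul_cancel₀ _ ha₀, sub_self]

variable [IsScalarTower ℂ A A] [SMulCommClass ℂ A A]

theorem algIso_extend (hA : Module.finrank ℂ A = 3) {T : Table} (hT : T ∈ planeTables)
    {x y z : A} (hli : LinearIndependent ℂ ![x, y, z]) (hxy : T.Matches x y)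
    (hmul : ∀ s t : A, s * t ∈ Submodule.span ℂ {x, y}) :
    ∃ a b p d v w : ℂ, AlgIso A (T.extend a b p d v w).Alg := by
  obtain ⟨a, b, hab⟩ := Submodule.mem_span_pair.1 (hmul x z)
  obtain ⟨p, d, hpd⟩ := Submodule.mem_span_pair.1 (hmul y z)
  obtain ⟨v, w, hvw⟩ := Submodule.mem_span_pair.1 (hmul z z)
  have h := Table.isPlane_extend hT a b p d v w
  refine ⟨a, b, p, d, v, w, algIso_of_linearIndependent hA _ hli ?_ ?_ ?_ ?_ ?_ ?_⟩
  · rw [h.e1e1, zero_smul, add_zero]; exact hxy.xx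
  · rw [h.e1e2, zero_smul, add_zero]; exact hxy.xy
  · simp [Table.extend, hab]
  · rw [h.e2e2, zero_smul, add_zero]; exact hxy.yy
  · simp [Table.extend, hpd]
  · simp [Table.extend, hvw]

/-- The annihilator of `e` is a complement of `ℂe`. On this plane the product is an `e`-valued
quadratic form, which has a nonzero isotropic vector over `ℂ`. -/
theorem exists_isotropic_of_idempotent (hA : Module.finrank ℂ A = 3) {e : A}
    (he : e * e = e) (hmul : ∀ s t : A, s * t ∈ Submodule.span ℂ {e}) :
    ∃ w, w ∉ Submodule.span ℂ {e} ∧ e * w = 0 ∧ w * w = 0 := by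
  simp only [Submodule.mem_span_singleton] at hmul
  have key : ∀ S : Submodule ℂ A, e ∈ S → S ≠ ⊤ → ∃ w, w ∉ S ∧ e * w = 0 := by
    intro S heS hS
    obtain ⟨k, -, hk⟩ := SetLike.exists_of_lt (lt_top_iff_ne_top.2 hS)
    obtain ⟨c, hc⟩ := hmul e k
    refine ⟨k - c • e, fun h => hk ?_, ?_⟩
    · have := S.add_mem h (S.smul_mem c heS)
      rwa [sub_add_cancel] at this
    · rw [mul_sub, mul_smul_comm, he, hc, sub_self]
  obtain ⟨k, hk, hek⟩ := key _ (Submodule.mem_span_singleton_self e)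
    (span_singleton_ne_top (by omega) e)
  obtain ⟨l, hl, hel⟩ := key _ (Submodule.subset_span (Set.mem_insert e {k}))
    (span_pair_ne_top hA e k)
  obtain ⟨a, ha⟩ := hmul k k
  obtain ⟨b, hb⟩ := hmul k l
  obtain ⟨c, hc⟩ := hmul l l
  by_cases ha₀ : a = 0
  · exact ⟨k, hk, hek, by rw [← ha, ha₀, zero_smul]⟩
  -- The coefficient `(r - b) / a` is a root of `a X² + 2b X + c`, the value of the form at `X k +
  -- l`.
  · obtain ⟨r, hr⟩ := IsAlgClosed.exists_pow_nat_eq (b ^ 2 - a * c) (n := 2) (by norm_num)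
    refine ⟨((r - b) / a) • k + l, fun h => hl ?_, ?_, ?_⟩
    · have h₁ : ((r - b) / a) • k ∈ Submodule.span ℂ {e, k} :=
        Submodule.smul_mem _ _ (Submodule.subset_span (by simp))
      have h₂ := Submodule.sub_mem _
        (Submodule.span_mono (Set.singleton_subset_iff.2 (Set.mem_insert e {k})) h) h₁
      rwa [add_sub_cancel_left] at h₂
    · rw [mul_add, mul_smul_comm, hek, hel, smul_zero, add_zero]
    · simp only [mul_add, add_mul, mul_smul_comm, smul_mul_assoc, mul_comm l k, ← ha, ← hb, ← hc]
      match_scalars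
      field_simp
      linear_combination hr

/-- A one-dimensional `A²` has to be enlarged to a plane. If `z² = 0`, a vector `w` annihilated by
`z` is adjoined, giving the zero plane or `J04`; if `z² ≠ 0`, a multiple of `z` is idempotent and an
isotropic `w` gives `J03`. -/
theorem exists_matches_of_finrank_one (hA : Module.finrank ℂ A = 3) {z : A} (hz₀ : z ≠ 0)
    (hmul : ∀ s t : A, s * t ∈ Submodule.span ℂ {z}) :
    ∃ T ∈ planeTables, ∃ x y : A, LinearIndependent ℂ ![x, y] ∧ T.Matches x y ∧
      ∀ s t : A, s * t ∈ Submodule.span ℂ {x, y} := by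
  obtain ⟨m, hm⟩ := Submodule.mem_span_singleton.1 (hmul z z)
  by_cases hm₀ : m = 0
  · rw [hm₀, zero_smul] at hm
    obtain ⟨w, hw, hzw⟩ := exists_annihilated hA hmul
    obtain ⟨c, hc⟩ := Submodule.mem_span_singleton.1 (hmul w w)
    have hli := linearIndependent_two hz₀ hw
    by_cases hc₀ : c = 0
    · rw [hc₀, zero_smul] at hc
      exact ⟨_, by simp [planeTables], z, w, hli,
        (show zeroTable.Matches z w from ⟨by simp [zeroTable, ← hm],
          by simp [zeroTable, hzw], by simp [zeroTable, ← hc]⟩),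
        fun s t => Submodule.span_mono (by simp) (hmul s t)⟩
    · refine ⟨_, by simp [planeTables], w, c • z, ?_,
        (show AssocLabel.J04.table.Matches w (c • z) from ⟨by simp [AssocLabel.table, ← hc],
          by rw [mul_smul_comm, mul_comm, hzw]; simp [AssocLabel.table],
          by simp [AssocLabel.table, smul_mul_smul_comm, ← hm]⟩), fun s t => ?_⟩
      · rw [LinearIndependent.pair_iff] at hli ⊢
        intro p q hpq
        obtain ⟨h₁, h₂⟩ := hli (q * c) p (by rw [← hpq]; module)
        exact ⟨h₂, by simpa [hc₀] using h₁⟩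
      · obtain ⟨r, hr⟩ := Submodule.mem_span_singleton.1 (hmul s t)
        refine Submodule.mem_span_pair.2 ⟨0, r / c, ?_⟩
        rw [smul_smul, div_mul_cancel₀ _ hc₀, zero_smul, zero_add, hr]
  · have he : (m⁻¹ • z) * (m⁻¹ • z) = m⁻¹ • z := by
      rw [smul_mul_smul_comm, ← hm, smul_smul, inv_mul_cancel_right₀ hm₀]
    have hspan : Submodule.span ℂ {m⁻¹ • z} = Submodule.span ℂ {z} :=
      Submodule.span_singleton_smul_eq (inv_ne_zero hm₀).isUnit z
    rw [← hspan] at hmul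
    have he₀ : m⁻¹ • z ≠ 0 := smul_ne_zero (inv_ne_zero hm₀) hz₀
    obtain ⟨w, hw, hew, hww⟩ := exists_isotropic_of_idempotent hA he hmul
    exact ⟨_, by simp [planeTables], m⁻¹ • z, w, linearIndependent_two he₀ hw,
      (show AssocLabel.J03.table.Matches (m⁻¹ • z) w from
        ⟨by simp only [he]; simp [AssocLabel.table],
        by simp only [hew]; simp [AssocLabel.table], by simp [AssocLabel.table, hww]⟩),
      fun s t => Submodule.span_mono (by simp) (hmul s t)⟩

theorem exists_matches_of_ne_top (hA : Module.finrank ℂ A = 3) (hne : ∃ x y : A, x * y ≠ 0)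
    (hJ : IsDerivedJordan A) (hD : (derivedAlgebra A).toSubmodule ≠ ⊤) :
    ∃ T ∈ planeTables, ∃ x y : A, LinearIndependent ℂ ![x, y] ∧ T.Matches x y ∧
      ∀ s t : A, s * t ∈ Submodule.span ℂ {x, y} := by
  have hfin : FiniteDimensional ℂ A := Module.finite_of_finrank_pos (by omega)
  have hlt := Submodule.finrank_lt hD
  rw [hA] at hlt
  obtain ⟨x, y, hxy⟩ := hne
  have h0 : Module.finrank ℂ (derivedAlgebra A).toSubmodule ≠ 0 := by
    intro h
    rw [Submodule.finrank_eq_zero] at h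
    have : x * y ∈ (derivedAlgebra A).toSubmodule := mul_mem_derivedAlgebra x y
    rw [h] at this
    exact hxy this
  obtain h1 | h2 : Module.finrank ℂ (derivedAlgebra A).toSubmodule = 1 ∨
    Module.finrank ℂ (derivedAlgebra A).toSubmodule = 2 := by omega
  · obtain ⟨⟨z, hz⟩, hz₀, hspan⟩ := finrank_eq_one_iff'.1 h1
    refine exists_matches_of_finrank_one hA (z := z) (fun h => hz₀ (Subtype.ext h)) fun s t => ?_
    obtain ⟨c, hc⟩ := hspan ⟨s * t, mul_mem_derivedAlgebra s t⟩
    exact Submodule.mem_span_singleton.2 ⟨c, congrArg Subtype.val hc⟩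
  · have : IsCommJordan (derivedAlgebra A) := hJ
    have h2' : Module.finrank ℂ (derivedAlgebra A) = 2 := h2
    obtain ⟨T, hT, x, y, hli, hm⟩ := exists_matches_planeTables h2'
    refine ⟨T, hT, x, y, ?_, ⟨congrArg Subtype.val hm.xx, congrArg Subtype.val hm.xy,
      congrArg Subtype.val hm.yy⟩, fun s t => ?_⟩
    · rw [LinearIndependent.pair_iff] at hli ⊢
      exact fun a b h => hli a b (Subtype.ext h)
    · obtain ⟨a, b, hab⟩ := LinearIndependent.exists_coords_two h2' hli
        ⟨s * t, mul_mem_derivedAlgebra s t⟩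
      exact Submodule.mem_span_pair.2 ⟨a, b, (congrArg Subtype.val hab).symm⟩

theorem isCommJordan_J18 : IsCommJordan JordanLabel.J18.table.Alg := by
  rw [Table.isCommJordan_iff]
  intro x y
  ext i
  fin_cases i <;> simp [Table.mul, JordanLabel.table] <;> ring

theorem classification_of_derivedAlgebra_ne_top (hA : Module.finrank ℂ A = 3)
    (hne : ∃ x y : A, x * y ≠ 0)
    (hJ : IsDerivedJordan A) (hD : (derivedAlgebra A).toSubmodule ≠ ⊤) :
    (IsCommJordan A ∧ IsListedJordan A) ∨ (IsDerivedCommAssoc A ∧ IsListedDerivedCommAssoc A) ∨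
      ∃ l : DerJordanLabel, AlgIso A l.table.Alg := by
  obtain ⟨T, hT, x, y, hli, hm, hmul⟩ := exists_matches_of_ne_top hA hne hJ hD
  obtain ⟨z, -, hz⟩ := SetLike.exists_of_lt (lt_top_iff_ne_top.2 (span_pair_ne_top hA x y))
  obtain ⟨a, b, p, d, v, w, h⟩ := algIso_extend hA hT (linearIndependent_three hli hz) hm hmul
  by_cases hT' : T = JordanLabel.J18.table
  · subst hT'
    rcases exists_derJordanLabel a b p d v w with h' | ⟨l, hl⟩
    · exact .inl ⟨(h.trans h').isCommJordan isCommJordan_J18, .inr ⟨.J18, h.trans h'⟩⟩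
    · exact .inr (.inr ⟨l, h.trans hl⟩)
  · refine .inr (.inl ⟨h.isDerivedCommAssoc (isDerivedCommAssoc_extend hT hT' a b p d v w),
      h.isListedDerivedCommAssoc ?_⟩)
    rcases hT with rfl | rfl | rfl | rfl | rfl | rfl
    · exact isListed_extend_J01 a b p d v w
    · exact isListed_extend_J02 a b p d v w
    · exact isListed_extend_J03 a b p d v w
    · exact isListed_extend_J04 a b p d v w
    · refine isListed_extend_zeroTable ?_
      obtain ⟨f, hf⟩ := h
      obtain ⟨x, y, hxy⟩ := hne
      exact ⟨f x, f y, by rwa [← hf, Ne, LinearEquiv.map_eq_zero_iff]⟩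
    · exact absurd rfl hT'

end DerivedAlgebra

/-! ### Peirce types with eigenvalue `1/2`. -/

section PeirceTypes

variable {A : Type*} [NonUnitalNonAssocCommRing A] [Module ℂ A] [SMulCommClass ℂ A A]

theorem linearIndependent_three_swap {V : Type*} [AddCommGroup V] [Module ℂ V] {x y z : V}
    (h : LinearIndependent ℂ ![x, y, z]) : LinearIndependent ℂ ![x, z, y] := by
  rw [linearIndependent_three_iff] at h ⊢
  intro a b c habc
  obtain ⟨h₁, h₂, h₃⟩ := h a c b (by rw [← habc]; abel)
  exact ⟨h₁, h₃, h₂⟩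

/-- A vector with prescribed eigenvalue has no components along the other eigenvectors. -/
theorem coords_of_eigenvector {e u w : A} {i j k : ℂ}
    (hli : LinearIndependent ℂ ![e, u, w]) (he : e * e = e) (hu : e * u = i • u)
    (hw : e * w = j • w) {a b c : ℂ}
    (h : e * (a • e + b • u + c • w) = k • (a • e + b • u + c • w)) :
    (1 - k) * a = 0 ∧ (i - k) * b = 0 ∧ (j - k) * c = 0 := by
  rw [linearIndependent_three_iff] at hli
  simp only [mul_add, mul_smul_comm, he, hu, hw] at h
  apply hli
  linear_combination (norm := module) h

variable [IsScalarTower ℂ A A] [IsCommJordan A]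

/-- Products of two vectors of the half-space satisfy `L²(xy) = L(xy)`, so only components with
eigenvalue `1` or `0` occur. -/
theorem coords_of_half_mul {e u w x y : A} {i j : ℂ}
    (hli : LinearIndependent ℂ ![e, u, w]) (he : e * e = e) (hu : e * u = i • u)
    (hw : e * w = j • w) (hx : e * x = (1 / 2 : ℂ) • x) (hy : e * y = (1 / 2 : ℂ) • y)
    {a b c : ℂ} (h : x * y = a • e + b • u + c • w) :
    i * (i - 1) * b = 0 ∧ j * (j - 1) * c = 0 := by
  rw [linearIndependent_three_iff] at hli
  have h' := peirce_half_mul he hx hy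
  simp only [h, mul_add, mul_smul_comm, he, hu, hw] at h'
  have := hli 0 (i * (i - 1) * b) (j * (j - 1) * c)
    (by linear_combination (norm := module) h')
  exact this.2

/-- Products in the half-space lie in `ℂe`, squares there vanish by `isHalf_sq_eq_zero`, and
polarization kills `uw`. -/
theorem isListedJordan_of_half_half (hA : Module.finrank ℂ A = 3) {e u w : A} (he : e * e = e)
    (hli : LinearIndependent ℂ ![e, u, w]) (hu : e * u = (1 / 2 : ℂ) • u)
    (hw : e * w = (1 / 2 : ℂ) • w) : IsListedJordan A := by
  have he₀ : e ≠ 0 := hli.ne_zero 0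
  have key : ∀ x y : A, e * x = (1 / 2 : ℂ) • x → e * y = (1 / 2 : ℂ) • y →
      ∃ a : ℂ, x * y = a • e := by
    intro x y hx hy
    obtain ⟨a, b, c, h⟩ := LinearIndependent.exists_coords_three hA hli (x * y)
    obtain ⟨hb, hc⟩ := coords_of_half_mul hli he hu hw hx hy h
    norm_num at hb hc
    exact ⟨a, by rw [h, hb, hc]; module⟩
  have hsq : ∀ x : A, e * x = (1 / 2 : ℂ) • x → x * x = 0 := by
    intro x hx
    obtain ⟨a, h⟩ := key x x hx hx
    rw [h, isHalf_sq_eq_zero he he₀ hx h, zero_smul]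
  have huw : u * w = 0 := by
    have h := hsq (u + w) (by rw [mul_add, hu, hw, smul_add])
    rw [mul_add, add_mul, add_mul, hsq u hu, hsq w hw, mul_comm w u, zero_add, add_zero,
      ← two_smul ℂ] at h
    simpa using h
  refine .inr ⟨.J14, algIso_of_linearIndependent hA _ hli ?_ ?_ ?_ ?_ ?_ ?_⟩ <;>
    simp [JordanLabel.table, he, hu, hw, huw, hsq u hu, hsq w hw]

/-- The Peirce rules leave `u² = a e + c w`, `uw = h u`, `w² = g w`. The linearized identity gives
`h(2h - g) = 0`, and `(u²)² = u(u u²)` relates `a` and `c`. For `g ≠ 0`, `w / g` is a second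
idempotent, orthogonal to `e`, acting on `u` by `0` or `1/2`. -/
theorem isListedJordan_of_half_zero (hA : Module.finrank ℂ A = 3) {e u w : A} (he : e * e = e)
    (hli : LinearIndependent ℂ ![e, u, w]) (hu : e * u = (1 / 2 : ℂ) • u)
    (hw : e * w = 0) : IsListedJordan A := by
  have hu₀ : u ≠ 0 := hli.ne_zero 1
  have hw' : e * w = (0 : ℂ) • w := by rw [hw, zero_smul]
  have hli' := linearIndependent_three_iff.1 hli
  obtain ⟨a, b, c, huu⟩ := LinearIndependent.exists_coords_three hA hli (u * u)
  have hb := (coords_of_half_mul hli he hu hw' hu hu huu).1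
  norm_num at hb
  rw [hb, zero_smul, add_zero] at huu
  obtain ⟨a₁, h, c₁, huw⟩ := LinearIndependent.exists_coords_three hA hli (u * w)
  have huw' : e * (u * w) = (1 / 2 : ℂ) • (u * w) := by
    linear_combination (norm := module) (-1 : ℂ) • peirce_mul he hu hw'
  rw [huw] at huw'
  obtain ⟨h₁, -, h₃⟩ := coords_of_eigenvector hli he hu hw' huw'
  norm_num at h₁ h₃
  rw [h₁, h₃, zero_smul, zero_smul, zero_add, add_zero] at huw
  obtain ⟨a₂, b₂, g, hww⟩ := LinearIndependent.exists_coords_three hA hli (w * w)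
  have hww' : e * (w * w) = (0 : ℂ) • (w * w) := by
    linear_combination (norm := module) (-1 : ℂ) • peirce_mul he hw' hw'
  rw [hww] at hww'
  obtain ⟨h₁, h₂, -⟩ := coords_of_eigenvector hli he hu hw' hww'
  norm_num at h₁ h₂
  rw [h₁, h₂, zero_smul, zero_smul, zero_add, zero_add] at hww
  have hwu : w * u = h • u := by rw [mul_comm, huw]
  have hue : u * e = (1 / 2 : ℂ) • u := by rw [mul_comm, hu]
  have hwe : w * e = 0 := by rw [mul_comm, hw]
  have hh : h * (2 * h - g) = 0 := by
    have := jordan_linearized w e u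
    simp only [hwu, hww, hwe, hu, mul_smul_comm, smul_mul_assoc, hw, smul_zero, mul_zero] at this
    have h' : (h * (2 * h - g)) • u = 0 := by
      linear_combination (norm := module) (2 : ℂ) • this
    simpa [hu₀] using h'
  have hpow := sq_mul_sq u
  simp only [huu, mul_add, add_mul, mul_smul_comm, smul_mul_assoc, he, hw, hwe, hue, huw,
    hww, smul_zero, add_zero, zero_add] at hpow
  obtain ⟨p₁, -, p₂⟩ := hli' (a ^ 2 - (a / 2 + c * h) * a) 0 (c ^ 2 * g - (a / 2 + c * h) * c)
    (by linear_combination (norm := module) hpow)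
  by_cases hg : g = 0
  · subst hg
    have hh₀ : h = 0 := by simpa using hh
    have ha : a = 0 := by
      rw [hh₀] at p₁
      have : a ^ 2 = 0 := by linear_combination 2 * p₁
      simpa using this
    subst hh₀ ha
    by_cases hc : c = 0
    · refine .inr ⟨.J18, algIso_of_linearIndependent hA _ hli ?_ ?_ ?_ ?_ ?_ ?_⟩ <;>
        simp [JordanLabel.table, he, hu, hw, huw, hww, huu, hc]
    · have hl : LinearIndependent ℂ ![e, u, c • w] := by
        rw [linearIndependent_three_iff]
        intro p q r hpqr
        obtain ⟨h₁, h₂, h₃⟩ := hli' p q (r * c) (by rw [← hpqr]; module)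
        exact ⟨h₁, h₂, by simpa [hc] using h₃⟩
      refine .inr ⟨.J15, algIso_of_linearIndependent hA _ hl ?_ ?_ ?_ ?_ ?_ ?_⟩ <;>
        simp [JordanLabel.table, he, hu, hw, huw, hww, huu, mul_smul_comm, smul_mul_assoc]
  · set f := g⁻¹ • w with hf
    have hff : f * f = f := by
      rw [hf, smul_mul_smul_comm, hww, smul_smul, inv_mul_cancel_right₀ hg]
    have hef : e * f = 0 := by rw [hf, mul_smul_comm, hw, smul_zero]
    have hfw : w = g • f := by rw [hf, smul_inv_smul₀ hg]
    have hlf : ∀ {k : ℂ}, k ≠ 0 → LinearIndependent ℂ ![e, f, k • u] := by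
      intro k hk
      rw [linearIndependent_three_iff]
      intro p q r hpqr
      obtain ⟨h₁, h₂, h₃⟩ := hli' p (r * k) (q * g⁻¹) (by rw [← hpqr, hf]; module)
      exact ⟨h₁, by simpa [hg] using h₃, by simpa [hk] using h₂⟩
    rcases mul_eq_zero.1 hh with hh | hh
    · subst hh
      have ha : a = 0 := by
        have : a ^ 2 = 0 := by linear_combination 2 * p₁
        simpa using this
      subst ha
      have hc : c = 0 := by simpa [hg] using p₂
      subst hc
      have hfu : f * u = 0 := by rw [hf, smul_mul_assoc, hwu, zero_smul, smul_zero]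
      have huu₀ : u * u = 0 := by simpa using huu
      have hl := hlf one_ne_zero
      rw [one_smul] at hl
      refine .inr ⟨.J19, algIso_of_linearIndependent hA _ hl ?_ ?_ ?_ ?_ ?_ ?_⟩ <;>
        simp [JordanLabel.table, he, hu, hef, hff, hfu, huu₀]
    · have hfu : f * u = (1 / 2 : ℂ) • u := by
        rw [hf, smul_mul_assoc, hwu, smul_smul]
        congr 1
        field_simp
        linear_combination hh
      have hacg : a = c * g := by
        have h₁ : a * (a - c * g) = 0 := by linear_combination 2 * p₁ + c * a * hh
        have h₂ : c * g * (a - c * g) = 0 := by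
          linear_combination -2 * g * p₂ - c ^ 2 * g * hh
        have : (a - c * g) ^ 2 = 0 := by linear_combination h₁ - h₂
        exact sub_eq_zero.1 (by simpa using this)
      have huu' : u * u = a • e + a • f := by rw [huu, hacg, hfw]; module
      by_cases ha : a = 0
      · have huu₀ : u * u = 0 := by simpa [ha] using huu'
        have hl := hlf one_ne_zero
        rw [one_smul] at hl
        refine .inr ⟨.J17, algIso_of_linearIndependent hA _ hl ?_ ?_ ?_ ?_ ?_ ?_⟩ <;>
          simp [JordanLabel.table, he, hu, hef, hff, hfu, huu₀]
      · obtain ⟨k, hk₀, hk⟩ := exists_sq_mul_eq_one ha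
        refine .inr ⟨.J12, algIso_of_linearIndependent hA _ (hlf hk₀) ?_ ?_ ?_ ?_ ?_ ?_⟩
        on_goal 6 =>
          rw [smul_mul_smul_comm, huu']
          simp only [JordanLabel.table, Matrix.cons_val]
          linear_combination (norm := module) hk • (e + f)
        all_goals
          simp [JordanLabel.table, he, hu, hef, hff, hfu, mul_smul_comm, smul_comm k]

/-- In the Peirce one-space of `e` spanned by `e` and `t`, the square of `t` can be made a multiple
of `e`. -/
theorem exists_sq_eq_smul (hA : Module.finrank ℂ A = 3) {e t w : A} {j : ℂ} (he : e * e = e)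
    (hli : LinearIndependent ℂ ![e, t, w]) (ht : e * t = t) (hw : e * w = j • w) (hj : j ≠ 1) :
    ∃ s : A, ∃ k : ℂ, e * s = s ∧ s * s = k • e ∧ LinearIndependent ℂ ![e, s, w] := by
  have ht' : e * t = (1 : ℂ) • t := by rw [ht, one_smul]
  obtain ⟨a, b, c, htt⟩ := LinearIndependent.exists_coords_three hA hli (t * t)
  have htt' : e * (t * t) = (1 : ℂ) • (t * t) := by
    linear_combination (norm := module) peirce_mul he ht' ht'
  rw [htt] at htt'
  obtain ⟨-, -, hc⟩ := coords_of_eigenvector hli he ht' hw htt'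
  have hc : c = 0 := by simpa [sub_ne_zero.2 hj] using hc
  rw [hc, zero_smul, add_zero] at htt
  refine ⟨t - (b / 2) • e, a + b ^ 2 / 4, by rw [mul_sub, mul_smul_comm, ht, he], ?_, ?_⟩
  · simp only [mul_sub, sub_mul, mul_smul_comm, smul_mul_assoc, mul_comm t e, ht, he, htt]
    module
  · rw [linearIndependent_three_iff] at hli ⊢
    intro p q r h
    obtain ⟨h₁, h₂, h₃⟩ := hli (p - q * (b / 2)) q r (by rw [← h]; module)
    exact ⟨by simpa [h₂] using h₁, h₂, h₃⟩

/-- After normalization `s² = k e` and `us = h u` with `h² = k / 4`. If `k = 0`, the result is `J13`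
or `J16`. If `k ≠ 0`, the Peirce one-space splits into two orthogonal idempotents, and one of them
reduces the problem to the half-zero type. -/
theorem isListedJordan_of_one_half (hA : Module.finrank ℂ A = 3) {e t u : A} (he : e * e = e)
    (hli : LinearIndependent ℂ ![e, t, u]) (ht : e * t = t) (hu : e * u = (1 / 2 : ℂ) • u) :
    IsListedJordan A := by
  obtain ⟨s, k, hs, hss, hli⟩ := exists_sq_eq_smul hA he hli ht hu (by norm_num)
  have hu₀ : u ≠ 0 := hli.ne_zero 2
  have hs' : e * s = (1 : ℂ) • s := by rw [hs, one_smul]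
  have hli' := linearIndependent_three_iff.1 hli
  obtain ⟨a, b, c, huu⟩ := LinearIndependent.exists_coords_three hA hli (u * u)
  have hc := (coords_of_half_mul hli he hs' hu hu hu huu).2
  norm_num at hc
  rw [hc, zero_smul, add_zero] at huu
  obtain ⟨a₁, b₁, h, hus⟩ := LinearIndependent.exists_coords_three hA hli (u * s)
  have hus' : e * (u * s) = (1 / 2 : ℂ) • (u * s) := by
    linear_combination (norm := module) peirce_mul he hu hs'
  rw [hus] at hus'
  obtain ⟨h₁, h₂, -⟩ := coords_of_eigenvector hli he hs' hu hus'
  norm_num at h₁ h₂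
  rw [h₁, h₂, zero_smul, zero_smul, zero_add, zero_add] at hus
  have hsu : s * u = h • u := by rw [mul_comm, hus]
  have hue : u * e = (1 / 2 : ℂ) • u := by rw [mul_comm, hu]
  have hse : s * e = s := by rw [mul_comm, hs]
  have hh : h ^ 2 = k / 4 := by
    have := jordan_linearized s e u
    simp only [hsu, hss, hse, hu, hus, hue, he, mul_smul_comm, smul_mul_assoc] at this
    have h' : (h ^ 2 - k / 4) • u = 0 := by
      linear_combination (norm := module) (-1 : ℂ) • this
    exact sub_eq_zero.1 (by simpa [hu₀] using h')
  by_cases hk : k = 0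
  · subst hk
    rw [zero_smul] at hss
    have hh₀ : h = 0 := by simpa using hh
    rw [hh₀, zero_smul] at hus hsu
    have hpow := sq_mul_sq u
    simp only [huu, mul_add, add_mul, mul_smul_comm, smul_mul_assoc, he, hs, hse, hss, hue,
      hus, smul_zero, add_zero] at hpow
    have ha := (hli' (a * a / 2) (a * b * 3 / 2) 0 (by linear_combination (norm := module) hpow)).1
    have ha : a = 0 := by simpa using ha
    subst ha
    rw [zero_smul, zero_add] at huu
    by_cases hb : b = 0
    · refine .inr ⟨.J13, algIso_of_linearIndependent hA _ (linearIndependent_three_swap hli)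
        ?_ ?_ ?_ ?_ ?_ ?_⟩ <;>
        simp [JordanLabel.table, he, hu, hs, hus, hss, huu, hb]
    · have hl : LinearIndependent ℂ ![e, u, b • s] := by
        rw [linearIndependent_three_iff]
        intro p q r hpqr
        obtain ⟨h₁, h₂, h₃⟩ := hli' p (r * b) q (by rw [← hpqr]; module)
        exact ⟨h₁, h₃, by simpa [hb] using h₂⟩
      refine .inr ⟨.J16, algIso_of_linearIndependent hA _ hl ?_ ?_ ?_ ?_ ?_ ?_⟩ <;>
        simp [JordanLabel.table, he, hu, hs, hus, hss, huu, mul_smul_comm, smul_mul_assoc]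
  · have hh₀ : h ≠ 0 := by
      rintro rfl
      exact hk (by linear_combination -4 * hh)
    -- The root `m` of `m² k = 1/4` is chosen with `m h = 1/4`, so that `e/2 + m s` acts on `u` by
    -- `1/2` and `e/2 - m s` lies in its zero-space.
    set m := (4 * h)⁻¹ with hm
    have hm₀ : m ≠ 0 := inv_ne_zero (mul_ne_zero (by norm_num) hh₀)
    have hmh : m * h = 1 / 4 := by rw [hm]; field_simp
    have hmk : m ^ 2 * k = 1 / 4 := by
      have : k = 4 * h ^ 2 := by linear_combination -4 * hh
      rw [this]
      linear_combination (4 * m * h + 1) * hmh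
    refine isListedJordan_of_half_zero hA (e := (1 / 2 : ℂ) • e + m • s) (u := u)
      (w := (1 / 2 : ℂ) • e - m • s) ?_ ?_ ?_ ?_
    · simp only [mul_add, add_mul, mul_smul_comm, smul_mul_assoc, he, hs, hse, hss]
      linear_combination (norm := module) hmk • e
    · rw [linearIndependent_three_iff]
      intro p q r hpqr
      obtain ⟨h₁, h₂, h₃⟩ := hli' ((p + r) / 2) (m * (p - r)) q (by rw [← hpqr]; module)
      have h₂ : p - r = 0 := by simpa [hm₀] using h₂
      exact ⟨by linear_combination h₁ + h₂ / 2, h₃, by linear_combination h₁ - h₂ / 2⟩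
    · simp only [add_mul, smul_mul_assoc, hu, hsu]
      linear_combination (norm := module) hmh • u
    · simp only [mul_sub, add_mul, mul_smul_comm, smul_mul_assoc, he, hs, hse, hss]
      linear_combination (norm := module) (-1 : ℂ) • hmk • e

end PeirceTypes

/-! ### Peirce types that use perfection. -/

section PeirceTypesPerfect

variable {A : Type*} [NonUnitalNonAssocCommRing A] [Module ℂ A] [IsScalarTower ℂ A A]
  [SMulCommClass ℂ A A]

theorem mul_mem_of_basis (hA : Module.finrank ℂ A = 3) {x y z : A}
    (hli : LinearIndependent ℂ ![x, y, z]) {S : Submodule ℂ A} (hxx : x * x ∈ S) (hxy : x * y ∈ S)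
    (hxz : x * z ∈ S) (hyy : y * y ∈ S) (hyz : y * z ∈ S) (hzz : z * z ∈ S) (s t : A) :
    s * t ∈ S := by
  obtain ⟨a, b, c, rfl⟩ := LinearIndependent.exists_coords_three hA hli s
  obtain ⟨a', b', c', rfl⟩ := LinearIndependent.exists_coords_three hA hli t
  simp only [mul_add, add_mul, mul_smul_comm, smul_mul_assoc, mul_comm y x, mul_comm z x,
    mul_comm z y]
  refine S.add_mem (S.add_mem ?_ ?_) ?_ <;>
    refine S.smul_mem _ (S.add_mem (S.add_mem ?_ ?_) ?_) <;> refine S.smul_mem _ ?_ <;> assumption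

variable [IsCommJordan A]

theorem isListedJordan_of_one_zero (hA : Module.finrank ℂ A = 3)
    (hperf : ∀ S : Submodule ℂ A, (∀ x y : A, x * y ∈ S) → S = ⊤) {e t w : A} (he : e * e = e)
    (hli : LinearIndependent ℂ ![e, t, w]) (ht : e * t = t) (hw : e * w = 0) :
    IsListedJordan A := by
  have hw' : e * w = (0 : ℂ) • w := by rw [hw, zero_smul]
  obtain ⟨s, k, hs, hss, hli⟩ := exists_sq_eq_smul hA he hli ht hw' (by norm_num)
  have hs' : e * s = (1 : ℂ) • s := by rw [hs, one_smul]
  have hli' := linearIndependent_three_iff.1 hli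
  have hsw : s * w = 0 := by
    have h₁ := peirce_mul he hs' hw'
    have h₂ := peirce_mul he hw' hs'
    rw [mul_comm w s] at h₂
    linear_combination (norm := module) h₁ + h₂
  obtain ⟨a, b, g, hww⟩ := LinearIndependent.exists_coords_three hA hli (w * w)
  have hww' : e * (w * w) = (0 : ℂ) • (w * w) := by
    linear_combination (norm := module) (-1 : ℂ) • peirce_mul he hw' hw'
  rw [hww] at hww'
  obtain ⟨h₁, h₂, -⟩ := coords_of_eigenvector hli he hs' hw' hww'
  norm_num at h₁ h₂
  rw [h₁, h₂, zero_smul, zero_smul, zero_add, zero_add] at hww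
  -- If `w² = 0`, all products would lie in the span of `e` and `s`, against perfection.
  have hg : g ≠ 0 := by
    rintro rfl
    have heS : e ∈ Submodule.span ℂ {e, s} := Submodule.subset_span (by simp)
    refine span_pair_ne_top hA e s (hperf _ (mul_mem_of_basis hA hli ?_ ?_ ?_ ?_ ?_ ?_))
    · rwa [he]
    · rw [hs]
      exact Submodule.subset_span (by simp)
    · rw [hw]
      exact Submodule.zero_mem _
    · rw [hss]
      exact Submodule.smul_mem _ _ heS
    · rw [hsw]
      exact Submodule.zero_mem _
    · rw [hww, zero_smul]
      exact Submodule.zero_mem _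
  set f := g⁻¹ • w with hf
  have hff : f * f = f := by
    rw [hf, smul_mul_smul_comm, hww, smul_smul, inv_mul_cancel_right₀ hg]
  have hfe : f * e = 0 := by rw [hf, smul_mul_assoc, mul_comm, hw, smul_zero]
  have hfs : f * s = 0 := by rw [hf, smul_mul_assoc, mul_comm, hsw, smul_zero]
  have hse : s * e = s := by rw [mul_comm, hs]
  by_cases hk : k = 0
  · rw [hk, zero_smul] at hss
    have hl : LinearIndependent ℂ ![f, e, s] := by
      rw [linearIndependent_three_iff]
      intro p q r hpqr
      obtain ⟨h₁, h₂, h₃⟩ := hli' q r (p * g⁻¹) (by rw [← hpqr, hf]; module)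
      exact ⟨by simpa [hg] using h₃, h₁, h₂⟩
    refine .inl ⟨.J08, algIso_of_linearIndependent hA _ hl ?_ ?_ ?_ ?_ ?_ ?_⟩ <;>
      simp [AssocLabel.table, he, hs, hss, hff, hfe, hfs]
  · obtain ⟨m, hm₀, hm⟩ := exists_sq_mul_eq_one hk
    have hl : LinearIndependent ℂ ![(1 / 2 : ℂ) • (e + m • s), (1 / 2 : ℂ) • (e - m • s), f] := by
      rw [linearIndependent_three_iff]
      intro p q r hpqr
      obtain ⟨h₁, h₂, h₃⟩ := hli' ((p + q) / 2) (m * (p - q) / 2) (r * g⁻¹)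
        (by rw [← hpqr, hf]; module)
      have h₂ : p - q = 0 := by simpa [hm₀] using h₂
      exact ⟨by linear_combination h₁ + h₂ / 2, by linear_combination h₁ - h₂ / 2,
        by simpa [hg] using h₃⟩
    refine .inl ⟨.J07, algIso_of_linearIndependent hA _ hl ?_ ?_ ?_ ?_ ?_ ?_⟩
    all_goals
      simp only [AssocLabel.table, Matrix.cons_val, mul_sub, sub_mul, mul_add, add_mul,
        mul_smul_comm, smul_mul_assoc, hse, hs, he, hss, mul_comm e f, mul_comm s f, hfe, hfs, hff,
        Pi.zero_apply]
    · linear_combination (norm := module) (1 / 4 : ℂ) • hm • e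
    · linear_combination (norm := module) (-1 / 4 : ℂ) • hm • e
    · module
    · linear_combination (norm := module) (1 / 4 : ℂ) • hm • e
    · module
    · module

/-- The Peirce zero-space of an idempotent. -/
def peirceZero (e : A) (he : e * e = e) : NonUnitalSubalgebra ℂ A where
  carrier := {x | e * x = 0}
  add_mem' {x y} hx hy := by
    simp only [Set.mem_ofPred_eq] at *
    rw [mul_add, hx, hy, add_zero]
  zero_mem' := mul_zero e
  smul_mem' c x hx := by
    simp only [Set.mem_ofPred_eq] at *
    rw [mul_smul_comm, hx, smul_zero]
  mul_mem' {x y} hx hy := by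
    simp only [Set.mem_ofPred_eq] at *
    have := peirce_mul he (i := 0) (j := 0) (y := x) (z := y) (by simpa using hx)
      (by simpa using hy)
    simpa using this

/-- Here `A` is `ℂe` plus the Peirce zero-space, a two-dimensional Jordan algebra. Perfection rules
out `J03`, `J04` and zero for it; `J01`, `J02`, `𝔍04` give `J07`, `J08`, `J19`. -/
theorem isListedJordan_of_zero_zero (hA : Module.finrank ℂ A = 3)
    (hperf : ∀ S : Submodule ℂ A, (∀ x y : A, x * y ∈ S) → S = ⊤) {e u w : A} (he : e * e = e)
    (hli : LinearIndependent ℂ ![e, u, w]) (hu : e * u = 0) (hw : e * w = 0) :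
    IsListedJordan A := by
  have hli' := linearIndependent_three_iff.1 hli
  have he₀ : e ≠ 0 := hli.ne_zero 0
  have hcoords : ∀ x : A, e * x = 0 → ∃ b c : ℂ, x = b • u + c • w := by
    intro x hx
    obtain ⟨a, b, c, rfl⟩ := LinearIndependent.exists_coords_three hA hli x
    simp only [mul_add, mul_smul_comm, he, hu, hw, smul_zero, add_zero, smul_eq_zero, he₀,
      or_false] at hx
    exact ⟨b, c, by rw [hx]; module⟩
  let S := peirceZero e he
  have hSJ : IsCommJordan S :=
    ⟨fun x y => Subtype.ext (mul_sq_mul (x : A) (y : A))⟩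
  have hS₁ : IsScalarTower ℂ S S :=
    ⟨fun c x y => Subtype.ext (smul_mul_assoc c (x : A) (y : A))⟩
  have hS₂ : SMulCommClass ℂ S S :=
    ⟨fun c x y => Subtype.ext (mul_smul_comm c (x : A) (y : A)).symm⟩
  have hS : Module.finrank ℂ S = 2 := by
    have hluw : LinearIndependent ℂ ![(⟨u, hu⟩ : S), ⟨w, hw⟩] := by
      rw [LinearIndependent.pair_iff]
      intro b c h
      have h : b • u + c • w = 0 := congrArg Subtype.val h
      exact (hli' 0 b c (by rw [← h]; module)).2
    have hspan : Submodule.span ℂ (Set.range ![(⟨u, hu⟩ : S), ⟨w, hw⟩]) = ⊤ := by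
      refine (Submodule.eq_top_iff').2 fun x => ?_
      obtain ⟨b, c, hx⟩ := hcoords x x.2
      rw [Matrix.range_cons, Matrix.range_cons, Matrix.range_empty, Set.union_empty,
        Set.singleton_union]
      exact Submodule.mem_span_pair.2 ⟨b, c, Subtype.ext hx.symm⟩
    have := finrank_span_eq_card hluw
    rwa [hspan, finrank_top, Fintype.card_fin] at this
  obtain ⟨T, hT, ⟨x, hx⟩, ⟨y, hy⟩, hxy, hm⟩ := exists_matches_planeTables hS
  have hxx : x * x = T.e1e1 0 • x + T.e1e1 1 • y := congrArg Subtype.val hm.xx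
  have hxy' : x * y = T.e1e2 0 • x + T.e1e2 1 • y := congrArg Subtype.val hm.xy
  have hyy : y * y = T.e2e2 0 • x + T.e2e2 1 • y := congrArg Subtype.val hm.yy
  have hx : e * x = 0 := hx
  have hy : e * y = 0 := hy
  have hxe : x * e = 0 := by rw [mul_comm, hx]
  have hye : y * e = 0 := by rw [mul_comm, hy]
  have hl : LinearIndependent ℂ ![e, x, y] := by
    rw [LinearIndependent.pair_iff] at hxy
    rw [linearIndependent_three_iff]
    intro a b c h
    have h' := congrArg (e * ·) h
    simp only [mul_add, mul_smul_comm, he, hx, hy, smul_zero, add_zero, mul_zero, smul_eq_zero, he₀,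
      or_false] at h'
    rw [h', zero_smul, zero_add] at h
    exact ⟨h', hxy b c (Subtype.ext h)⟩
  have hlx : LinearIndependent ℂ ![x, e, y] := by
    rw [linearIndependent_three_iff] at hl ⊢
    intro a b c h
    obtain ⟨h₁, h₂, h₃⟩ := hl b a c (by rw [← h]; abel)
    exact ⟨h₂, h₁, h₃⟩
  have hnot : ∀ z : A, (x * x ∈ Submodule.span ℂ {e, z}) → (x * y ∈ Submodule.span ℂ {e, z}) →
      (y * y ∈ Submodule.span ℂ {e, z}) → False := by
    intro z h₁ h₂ h₃
    refine span_pair_ne_top hA e z (hperf _ (mul_mem_of_basis hA hl ?_ ?_ ?_ h₁ h₂ h₃))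
    · rw [he]
      exact Submodule.subset_span (by simp)
    · rw [hx]
      exact Submodule.zero_mem _
    · rw [hy]
      exact Submodule.zero_mem _
  rcases hT with rfl | rfl | rfl | rfl | rfl | rfl <;>
    simp [AssocLabel.table, JordanLabel.table, zeroTable] at hxx hxy' hyy
  · refine .inl ⟨.J07, algIso_of_linearIndependent hA _ hl ?_ ?_ ?_ ?_ ?_ ?_⟩ <;>
      simp [AssocLabel.table, he, hx, hy, hxx, hxy', hyy]
  · refine .inl ⟨.J08, algIso_of_linearIndependent hA _ hl ?_ ?_ ?_ ?_ ?_ ?_⟩ <;>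
      simp [AssocLabel.table, he, hx, hy, hxx, hxy', hyy]
  · refine (hnot x ?_ ?_ ?_).elim <;> simp [hxx, hxy', hyy, Submodule.mem_span_of_mem]
  · refine (hnot y ?_ ?_ ?_).elim <;> simp [hxx, hxy', hyy, Submodule.mem_span_of_mem]
  · refine (hnot x ?_ ?_ ?_).elim <;> simp [hxx, hxy', hyy]
  · refine .inr ⟨.J19, algIso_of_linearIndependent hA _ hlx ?_ ?_ ?_ ?_ ?_ ?_⟩ <;>
      simp [JordanLabel.table, he, hxe, hy, hxx, hxy', hyy]

theorem isListedJordan_of_eigenvectors (hA : Module.finrank ℂ A = 3)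
    (hperf : ∀ S : Submodule ℂ A, (∀ x y : A, x * y ∈ S) → S = ⊤) {e u w : A} (he : e * e = e)
    (hli : LinearIndependent ℂ ![e, u, w]) {i j : ℂ} (hi : i = 1 ∨ i = 1 / 2 ∨ i = 0)
    (hj : j = 1 ∨ j = 1 / 2 ∨ j = 0) (hu : e * u = i • u) (hw : e * w = j • w)
    (hij : ¬(i = 1 ∧ j = 1)) : IsListedJordan A := by
  have hli' := linearIndependent_three_swap hli
  rcases hi with rfl | rfl | rfl <;> rcases hj with rfl | rfl | rfl
  · exact absurd ⟨rfl, rfl⟩ hij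
  · exact isListedJordan_of_one_half hA he hli (by rw [hu, one_smul]) hw
  · exact isListedJordan_of_one_zero hA hperf he hli (by rw [hu, one_smul]) (by rw [hw, zero_smul])
  · exact isListedJordan_of_one_half hA he hli' (by rw [hw, one_smul]) hu
  · exact isListedJordan_of_half_half hA he hli hu hw
  · exact isListedJordan_of_half_zero hA he hli hu (by rw [hw, zero_smul])
  · exact isListedJordan_of_one_zero hA hperf he hli' (by rw [hw, one_smul]) (by rw [hu, zero_smul])
  · exact isListedJordan_of_half_zero hA he hli' hw (by rw [hu, zero_smul])
  · exact isListedJordan_of_zero_zero hA hperf he hli (by rw [hu, zero_smul])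
      (by rw [hw, zero_smul])

end PeirceTypesPerfect

/-! ### Perfect Jordan algebras. -/

section Perfect

variable {A : Type*} [NonUnitalNonAssocCommRing A] [Module ℂ A]

/-- The linearization of the identity `x³ = 0`. -/
theorem sq_mul_add_of_cube_eq_zero (h : ∀ x : A, x * (x * x) = 0) (x y : A) :
    x * x * y + (2 : ℂ) • (x * (x * y)) = 0 := by
  have h₁ := h (x + y)
  have h₂ := h (x - y)
  have h₃ := h y
  simp only [mul_add, add_mul, mul_sub, mul_comm] at *
  linear_combination (norm := module) (1 / 2 : ℂ) • (h₁ - h₂ - (2 : ℂ) • h₃)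

variable [IsScalarTower ℂ A A] [SMulCommClass ℂ A A]

/-- With `y = x² ≠ 0` and a third vector `z`, the linearized cube identity at suitable pairs forces
the `z`-coordinates of `xz` and `z²` to vanish, so that all products lie in the span of `x, y`. -/
theorem exists_mul_mem_of_cube_eq_zero [IsCommJordan A] (hA : Module.finrank ℂ A = 3)
    (h : ∀ x : A, x * (x * x) = 0) :
    ∃ S : Submodule ℂ A, S ≠ ⊤ ∧ ∀ s t : A, s * t ∈ S := by
  by_cases hsq : ∀ x : A, x * x = 0
  · refine ⟨Submodule.span ℂ {0}, span_singleton_ne_top (by omega) 0, fun s t => ?_⟩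
    rw [eq_zero_of_mul_self hsq]
    exact Submodule.zero_mem _
  · push Not at hsq
    obtain ⟨x, hx⟩ := hsq
    obtain ⟨y, hy⟩ : ∃ y, y = x * x := ⟨_, rfl⟩
    have hxy : x * y = 0 := by rw [hy, h]
    have hyy : y * y = 0 := by rw [hy, sq_mul_sq, h, mul_zero]
    have hxx := hy.symm
    rw [hxx] at hx
    have hlxy : LinearIndependent ℂ ![x, y] := by
      rw [LinearIndependent.pair_iff]
      intro a b hab
      have h₁ := congrArg (x * ·) hab
      simp only [mul_add, mul_smul_comm, hxx, hxy, smul_zero, add_zero, smul_eq_zero, hx, or_false,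
        mul_zero] at h₁
      simp only [h₁, zero_smul, zero_add, smul_eq_zero, hx, or_false] at hab
      exact ⟨h₁, hab⟩
    obtain ⟨z, -, hz⟩ := SetLike.exists_of_lt (lt_top_iff_ne_top.2 (span_pair_ne_top hA x y))
    have hli := linearIndependent_three hlxy hz
    have hli' := linearIndependent_three_iff.1 hli
    have hxS : x ∈ Submodule.span ℂ {x, y} := Submodule.subset_span (by simp)
    have hyS : y ∈ Submodule.span ℂ {x, y} := Submodule.subset_span (by simp)
    obtain ⟨a, b, l, hxz⟩ := LinearIndependent.exists_coords_three hA hli (x * z)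
    obtain ⟨p, q, r, hzz⟩ := LinearIndependent.exists_coords_three hA hli (z * z)
    have hzx : z * x = a • x + b • y + l • z := by rw [mul_comm, hxz]
    have hyz : y * z = (-2 * a) • y + (-2 * l) • (x * z) := by
      have := sq_mul_add_of_cube_eq_zero h x z
      rw [hxx] at this
      nth_rw 1 [hxz] at this
      simp only [mul_add, mul_smul_comm, hxx, hxy, smul_zero, add_zero] at this
      linear_combination (norm := module) this
    have hl : l = 0 := by
      have := sq_mul_add_of_cube_eq_zero h y z
      rw [hyy, zero_mul, zero_add, hyz, hxz] at this
      simp only [mul_add, mul_smul_comm, hyy, mul_comm y x, hxy, smul_zero, zero_add, hyz,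
        hxz] at this
      have h₃ := (hli' (8 * l ^ 3 * a) (8 * l ^ 2 * a + 8 * l ^ 3 * b) (8 * l ^ 4)
        (by linear_combination (norm := module) this)).2.2
      simpa using h₃
    subst hl
    have hyz : y * z = (-2 * a) • y := by rw [hyz]; module
    have hzy : z * y = (-2 * a) • y := by rw [mul_comm, hyz]
    rw [zero_smul, add_zero] at hxz hzx
    have ha : a = 0 := by
      have h₁ := sq_mul_add_of_cube_eq_zero h z y
      have h₂ := sq_mul_add_of_cube_eq_zero h z x
      simp only [hzz, add_mul, mul_add, smul_mul_assoc, mul_smul_comm, hxy, hyy, hzy, hzx, hxx,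
        mul_comm y x, smul_zero, zero_add] at h₁ h₂
      have h₃ := (hli' 0 (8 * a ^ 2 - 2 * r * a) 0 (by linear_combination (norm := module) h₁)).2.1
      have h₄ := (hli' (r * a + 2 * a ^ 2) (p + r * b - 2 * a * b) 0
        (by linear_combination (norm := module) h₂)).1
      have : a ^ 2 = 0 := by linear_combination (h₃ + 2 * h₄) / 12
      simpa using this
    subst ha
    have hr : r = 0 := by
      have h₁ := h z
      rw [hzz] at h₁
      simp only [mul_add, mul_smul_comm, hzx, hzy, hzz] at h₁
      have h₃ := (hli' (r * p) (p * b + r * q) (r ^ 2)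
        (by linear_combination (norm := module) h₁)).2.2
      simpa using h₃
    subst hr
    refine ⟨Submodule.span ℂ {x, y}, span_pair_ne_top hA x y,
      mul_mem_of_basis hA hli ?_ ?_ ?_ ?_ ?_ ?_⟩
    · rwa [hxx]
    · rw [hxy]
      exact Submodule.zero_mem _
    · rw [hxz]
      exact Submodule.add_mem _ (Submodule.smul_mem _ _ hxS) (Submodule.smul_mem _ _ hyS)
    · rw [hyy]
      exact Submodule.zero_mem _
    · rw [hyz]
      exact Submodule.smul_mem _ _ hyS
    · rw [hzz, zero_smul, add_zero]
      exact Submodule.add_mem _ (Submodule.smul_mem _ _ hxS) (Submodule.smul_mem _ _ hyS)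

variable [IsCommJordan A]

theorem exists_idempotent (hA : Module.finrank ℂ A = 3)
    (hperf : ∀ S : Submodule ℂ A, (∀ x y : A, x * y ∈ S) → S = ⊤) :
    ∃ e : A, e ≠ 0 ∧ e * e = e := by
  have hfin : FiniteDimensional ℂ A := Module.finite_of_finrank_pos (by omega)
  by_contra hid
  have hnil : ∀ x : A, x * (x * (x * x)) = 0 := by
    intro x
    obtain ⟨a, b, c, h⟩ := exists_fourth_power_eq (by omega) x
    by_contra h₀
    obtain ⟨p, q, r, e, -, he₀, he⟩ := exists_idempotent_of_fourth_power h h₀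
    exact hid ⟨e, he₀, he⟩
  by_cases hcube : ∀ x : A, x * (x * x) = 0
  · obtain ⟨S, hS, hmul⟩ := exists_mul_mem_of_cube_eq_zero hA hcube
    exact hS (hperf S hmul)
  · push Not at hcube
    obtain ⟨x, hx⟩ := hcube
    refine span_pair_ne_top hA (x * x) (x * (x * x))
      (hperf _ (mul_mem_of_basis hA (linearIndependent_powers hx (hnil x)) ?_ ?_ ?_ ?_ ?_ ?_))
    · exact Submodule.subset_span (by simp)
    · exact Submodule.subset_span (by simp)
    · rw [hnil]
      exact Submodule.zero_mem _
    · rw [sq_mul_sq, hnil]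
      exact Submodule.zero_mem _
    · rw [sq_mul_cube, hnil, mul_zero]
      exact Submodule.zero_mem _
    · rw [cube_mul_cube, hnil, mul_zero, mul_zero]
      exact Submodule.zero_mem _

/-- A quadratic over `ℂ` has a root. -/
theorem exists_root_quadratic (a b : ℂ) : ∃ l : ℂ, l ^ 2 = a * l + b := by
  obtain ⟨k, hk⟩ := IsAlgClosed.exists_pow_nat_eq (a ^ 2 + 4 * b) (n := 2) (by norm_num)
  exact ⟨(a + k) / 2, by linear_combination hk / 4⟩

theorem exists_root_cubic (a b c : ℂ) : ∃ l : ℂ, l ^ 3 = a * l ^ 2 + b * l + c := by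
  open Polynomial in
  have hdeg : (X ^ 3 - C a * X ^ 2 - C b * X - C c : ℂ[X]).degree = 3 := by
    compute_degree!
  obtain ⟨l, hl⟩ := IsAlgClosed.exists_root _ (by rw [hdeg]; norm_num)
  refine ⟨l, ?_⟩
  simp [Polynomial.IsRoot] at hl
  linear_combination hl

/-- With no idempotents besides `0` and the unit, each element has a single eigenvalue `l`. The
cases follow the degree of its minimal polynomial; `l` is a root, and a nonnilpotent `x - l e` would
produce a forbidden idempotent. -/
theorem exists_sub_smul_cube_eq_zero (hA : Module.finrank ℂ A = 3) {e : A} (he₀ : e ≠ 0)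
    (he : ∀ x : A, e * x = x) (hid : ∀ f : A, f * f = f → f = 0 ∨ f = e) (x : A) :
    ∃ l : ℂ, (x - l • e) * ((x - l • e) * (x - l • e)) = 0 := by
  have hxe : ∀ x : A, x * e = x := fun x => by rw [mul_comm, he]
  by_cases hx : x ∈ Submodule.span ℂ {e}
  · obtain ⟨l, rfl⟩ := Submodule.mem_span_singleton.1 hx
    exact ⟨l, by simp⟩
  have hlex := linearIndependent_two he₀ hx
  have hlex' := LinearIndependent.pair_iff.1 hlex
  by_cases hxx : x * x ∈ Submodule.span ℂ {e, x}
  · obtain ⟨b, a, hab⟩ := Submodule.mem_span_pair.1 hxx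
    obtain ⟨l, hl⟩ := exists_root_quadratic a b
    set y := x - l • e with hy
    have hyy : y * y = (a - 2 * l) • y := by
      simp only [hy, mul_sub, sub_mul, mul_smul_comm, smul_mul_assoc, he, hxe, ← hab]
      linear_combination (norm := module) -hl • e
    by_cases hm : a - 2 * l = 0
    · exact ⟨l, by rw [← hy, hyy, hm, zero_smul, mul_zero]⟩
    · have hf : ((a - 2 * l)⁻¹ • y) * ((a - 2 * l)⁻¹ • y) = (a - 2 * l)⁻¹ • y := by
        rw [smul_mul_smul_comm, hyy, smul_smul, inv_mul_cancel_right₀ hm]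
      rcases hid _ hf with h | h
      · have := hlex' (-(a - 2 * l)⁻¹ * l) (a - 2 * l)⁻¹ (by rw [← h, hy]; module)
        exact absurd this.2 (inv_ne_zero hm)
      · have := hlex' (-(a - 2 * l)⁻¹ * l - 1) (a - 2 * l)⁻¹
          (by linear_combination (norm := (rw [hy]; module)) h)
        exact absurd this.2 (inv_ne_zero hm)
  · have hli := linearIndependent_three hlex hxx
    have hli' := linearIndependent_three_iff.1 hli
    obtain ⟨c, b, a, habc⟩ := LinearIndependent.exists_coords_three hA hli (x * (x * x))
    obtain ⟨l, hl⟩ := exists_root_cubic a b c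
    refine ⟨l, ?_⟩
    set y := x - l • e with hy
    have hyy : y * y = x * x - (2 * l) • x + (l ^ 2) • e := by
      simp only [hy, mul_sub, sub_mul, mul_smul_comm, smul_mul_assoc, he, hxe]
      module
    -- These are the coefficients of the cubic relation rewritten in `y = x - l e`; its constant
    -- term vanishes because `l` is a root.
    set m := a - 3 * l with hm
    set n := b + 2 * a * l - 3 * l ^ 2 with hn
    have hy₃ : y * (y * y) = m • (y * y) + n • y := by
      rw [hyy]
      simp only [hy, mul_sub, mul_add, sub_mul, mul_smul_comm, smul_mul_assoc, he, hxe, habc]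
      linear_combination (norm := module) -hl • e
    have hy₄ : y * (y * (y * y)) = m • (y * (y * y)) + n • (y * y) := by
      conv_lhs => rw [hy₃]
      simp only [mul_add, mul_smul_comm]
    have hliy : ∀ p q : ℂ, p • y + q • (y * y) = 0 → p = 0 ∧ q = 0 := by
      intro p q hpq
      rw [hyy, hy] at hpq
      obtain ⟨-, h₁, h₂⟩ := hli' (-p * l + q * l ^ 2) (p - 2 * l * q) q (by rw [← hpq]; module)
      exact ⟨by linear_combination h₁ + 2 * l * h₂, h₂⟩
    have hy₄₀ : y * (y * (y * y)) = 0 := by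
      by_contra h₀
      obtain ⟨p, q, r, f, hf, hf₀, hff⟩ := exists_idempotent_of_fourth_power
        (a := m) (b := n) (c := 0) (by rw [hy₄]; module) h₀
      have hfe := (hid f hff).resolve_left hf₀
      rw [hf, hy₃, hyy, hy] at hfe
      obtain ⟨h₁, h₂, h₃⟩ := hli' (-(p + r * n) * l + (q + r * m) * l ^ 2 - 1)
        (p + r * n - 2 * l * (q + r * m)) (q + r * m)
        (by linear_combination (norm := module) hfe)
      -- The idempotent is a polynomial in `y` without constant term. Evaluation at `x = l`, that is
      -- `y = 0`, shows it cannot equal the unit.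
      have : (1 : ℂ) = 0 := by linear_combination -h₁ - l * h₂ - l ^ 2 * h₃
      exact one_ne_zero this
    rw [hy₄, hy₃] at hy₄₀
    obtain ⟨h₁, h₂⟩ := hliy (m * n) (m ^ 2 + n) (by rw [← hy₄₀]; module)
    have hm₀ : m = 0 := by
      have : m ^ 3 = 0 := by linear_combination m * h₂ - h₁
      simpa using this
    have hn₀ : n = 0 := by simpa [hm₀] using h₂
    rw [hy₃, hm₀, hn₀, zero_smul, zero_smul, add_zero]

theorem isListedJordan_of_unit (hA : Module.finrank ℂ A = 3) {e : A} (he₀ : e ≠ 0)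
    (he : ∀ x : A, e * x = x) (hid : ∀ f : A, f * f = f → f = 0 ∨ f = e) : IsListedJordan A := by
  have hshift := exists_sub_smul_cube_eq_zero hA he₀ he hid
  have hxe : ∀ x : A, x * e = x := fun x => by rw [mul_comm, he]
  by_cases hy : ∃ y : A, y * (y * y) = 0 ∧ y * y ≠ 0
  · obtain ⟨y, hy₃, hy₂⟩ := hy
    have hli : LinearIndependent ℂ ![e, y, y * y] := by
      rw [linearIndependent_three_iff]
      intro a b c h
      have h₁ := congrArg (y * ·) h
      have h₂ := congrArg (fun z => y * (y * z)) h
      simp only [mul_add, mul_smul_comm, hxe, hy₃, smul_zero, add_zero, mul_zero, smul_eq_zero,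
        hy₂, or_false] at h₂
      subst h₂
      simp only [mul_add, mul_smul_comm, hy₃, smul_zero, add_zero, zero_add, zero_smul, mul_zero,
        smul_eq_zero, hy₂, or_false] at h₁
      subst h₁
      exact ⟨rfl, rfl, by simpa [hy₂] using h⟩
    refine .inl ⟨.J10, algIso_of_linearIndependent hA _ hli ?_ ?_ ?_ ?_ ?_ ?_⟩ <;>
      simp [AssocLabel.table, he, hy₃, sq_mul_sq]
  · push Not at hy
    obtain ⟨u, -, hu⟩ := SetLike.exists_of_lt (lt_top_iff_ne_top.2
      (span_singleton_ne_top (by omega : 1 < Module.finrank ℂ A) e))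
    obtain ⟨w, -, hw⟩ := SetLike.exists_of_lt (lt_top_iff_ne_top.2 (span_pair_ne_top hA e u))
    have hli := linearIndependent_three_iff.1
      (linearIndependent_three (linearIndependent_two he₀ hu) hw)
    obtain ⟨l, hl⟩ := hshift u
    obtain ⟨m, hm⟩ := hshift w
    have hyy := hy _ hl
    have hzz := hy _ hm
    obtain ⟨y, hy'⟩ : ∃ y, y = u - l • e := ⟨_, rfl⟩
    obtain ⟨z, hz'⟩ : ∃ z, z = w - m • e := ⟨_, rfl⟩
    rw [← hy'] at hyy
    rw [← hz'] at hzz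
    have hli' : LinearIndependent ℂ ![e, y, z] := by
      rw [linearIndependent_three_iff]
      intro a b c h
      obtain ⟨h₁, h₂, h₃⟩ := hli (a - b * l - c * m) b c (by rw [← h, hy', hz']; module)
      exact ⟨by linear_combination h₁ + l * h₂ + m * h₃, h₂, h₃⟩
    have hyz : y * z = 0 := by
      -- Both `y + z - n e` and `y - z - k e` square to zero. In the sum of the two expansions `yz`
      -- cancels, and independence gives `n = 0`; the first then gives `yz = 0`.
      obtain ⟨n, hn⟩ := hshift (y + z)
      obtain ⟨k, hk⟩ := hshift (y - z)
      have hn := hy _ hn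
      have hk := hy _ hk
      simp only [mul_add, mul_sub, sub_mul, add_mul, mul_smul_comm, smul_mul_assoc, he, hxe, hyy,
        hzz, mul_comm z y] at hn hk
      have h := linearIndependent_three_iff.1 hli' (n ^ 2 + k ^ 2) (-2 * (n + k)) (-2 * (n - k))
        (by linear_combination (norm := module) hn + hk)
      have hn₀ : n = 0 := by linear_combination -(h.2.1 + h.2.2) / 4
      rw [hn₀] at hn
      have : (2 : ℂ) • (y * z) = 0 := by
        linear_combination (norm := module) hn
      simpa using this
    refine .inl ⟨.J09, algIso_of_linearIndependent hA _ hli' ?_ ?_ ?_ ?_ ?_ ?_⟩ <;>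
      simp [AssocLabel.table, he, hyy, hyz, hzz]

theorem isListedJordan_of_perfect (hA : Module.finrank ℂ A = 3)
    (hperf : ∀ S : Submodule ℂ A, (∀ x y : A, x * y ∈ S) → S = ⊤) : IsListedJordan A := by
  have key : ∀ e : A, e ≠ 0 → e * e = e → IsListedJordan A ∨ ∀ x : A, e * x = x := by
    intro e he₀ he
    obtain ⟨i, hi, u, hu, heu⟩ :=
      exists_eigenvector_notMem he (span_singleton_ne_top (by omega) e)
    obtain ⟨j, hj, w, hw, hew⟩ :=
      exists_eigenvector_notMem he (span_pair_ne_top hA e u)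
    have hli := linearIndependent_three (linearIndependent_two he₀ hu) hw
    by_cases hij : i = 1 ∧ j = 1
    · refine .inr fun x => ?_
      obtain ⟨rfl, rfl⟩ := hij
      obtain ⟨a, b, c, rfl⟩ := LinearIndependent.exists_coords_three hA hli x
      simp only [mul_add, mul_smul_comm, he, heu, hew, one_smul]
    · exact .inl (isListedJordan_of_eigenvectors hA hperf he hli hi hj heu hew hij)
  obtain ⟨e, he₀, he⟩ := exists_idempotent hA hperf
  rcases key e he₀ he with h | hunit
  · exact h
  · by_cases hid : ∀ f : A, f * f = f → f = 0 ∨ f = e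
    · exact isListedJordan_of_unit hA he₀ hunit hid
    · push Not at hid
      obtain ⟨f, hf, hf₀, hfe⟩ := hid
      -- A second idempotent cannot be a unit too, since units are unique; hence it has a Peirce
      -- type already treated.
      refine (key f hf₀ hf).resolve_right fun h => hfe ?_
      rw [← hunit f, mul_comm, h]

end Perfect

/-! ### The classification assembled. -/

theorem classification {A : Type*} [NonUnitalNonAssocCommRing A] [Module ℂ A]
    [IsScalarTower ℂ A A] [SMulCommClass ℂ A A] (hA : Module.finrank ℂ A = 3)
    (hne : ∃ x y : A, x * y ≠ 0) (hJ : IsDerivedJordan A) :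
    (IsCommJordan A ∧ IsListedJordan A) ∨ (IsDerivedCommAssoc A ∧ IsListedDerivedCommAssoc A) ∨
      ∃ l : DerJordanLabel, AlgIso A l.table.Alg := by
  by_cases hD : (derivedAlgebra A).toSubmodule = ⊤
  · have hmem : ∀ x : A, x ∈ derivedAlgebra A := fun x =>
      show x ∈ (derivedAlgebra A).toSubmodule by rw [hD]; trivial
    have hJA : IsCommJordan A :=
      ⟨fun x y => isDerivedJordan_iff.1 hJ x (hmem x) y (hmem y)⟩
    refine .inl ⟨hJA, isListedJordan_of_perfect hA fun S hS => ?_⟩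
    exact (Submodule.eq_top_iff').2 fun x => derivedAlgebra_le hS (hmem x)
  · exact classification_of_derivedAlgebra_ne_top hA hne hJ hD

/-! ### The algebra `𝔍04`. -/

section PlaneAlgebra

theorem J2.finrank : Module.finrank ℂ J2 = 2 :=
  (Module.finrank_fin_fun ℂ : Module.finrank ℂ (Fin 2 → ℂ) = 2)

theorem J2.isCommJordan : IsCommJordan J2 := by
  have key : ∀ x y : Fin 2 → ℂ,
      J2.mul (J2.mul x y) (J2.mul x x) = J2.mul x (J2.mul y (J2.mul x x)) := by
    intro x y
    ext i
    fin_cases i <;> simp [J2.mul] <;> ring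
  exact ⟨fun x y => key x y⟩

theorem J2.not_associative : ¬∀ x y z : J2, (x * y) * z = x * (y * z) := by
  intro h
  have h' : J2.mul (J2.mul ![1, 0] ![1, 0]) ![0, 1] = J2.mul ![1, 0] (J2.mul ![1, 0] ![0, 1]) :=
    h ![1, 0] ![1, 0] ![0, 1]
  have := congrFun h' 1
  norm_num [J2.mul] at this

end PlaneAlgebra

/-! ### Invariants of the extensions of `𝔍04`. -/

section Extensions

variable (p d v w : ℂ)

theorem J18_mem_planeTables : JordanLabel.J18.table ∈ planeTables := by simp [planeTables]

theorem isDerivedJordan_extend_J18 :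
    IsDerivedJordan (JordanLabel.J18.table.extend 0 0 p d v w).Alg := by
  have key : ∀ x y : Fin 3 → ℂ, x 2 = 0 → y 2 = 0 →
      let t := JordanLabel.J18.table.extend 0 0 p d v w
      t.mul (t.mul x y) (t.mul x x) = t.mul x (t.mul y (t.mul x x)) := by
    intro x y hx hy t
    ext i
    fin_cases i <;> simp [t, Table.mul, Table.extend, JordanLabel.table, hx, hy] <;> ring
  have h := Table.isPlane_extend J18_mem_planeTables 0 0 p d v w
  exact isDerivedJordan_iff.2 fun x hx y hy => key x y (h.mem hx) (h.mem hy)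

theorem mem_derivedAlgebra_extend_J18 (a b : ℂ) :
    (show (JordanLabel.J18.table.extend 0 0 p d v w).Alg from (![a, b, 0] : Fin 3 → ℂ)) ∈
      derivedAlgebra (JordanLabel.J18.table.extend 0 0 p d v w).Alg := by
  have h : (JordanLabel.J18.table.extend 0 0 p d v w).mul ![1, 0, 0] ![a, 2 * b, 0] =
      ![a, b, 0] := by
    ext i
    fin_cases i <;> simp [Table.mul, Table.extend, JordanLabel.table]
    ring
  have := mul_mem_derivedAlgebra
    (A := (JordanLabel.J18.table.extend 0 0 p d v w).Alg) ![1, 0, 0] ![a, 2 * b, 0]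
  rw [← h]
  exact this

theorem not_isDerivedCommAssoc_extend_J18 :
    ¬IsDerivedCommAssoc (JordanLabel.J18.table.extend 0 0 p d v w).Alg := by
  intro h
  rw [isDerivedCommAssoc_iff] at h
  have h₁ := mem_derivedAlgebra_extend_J18 p d v w 1 0
  have h₂ := mem_derivedAlgebra_extend_J18 p d v w 0 1
  have h₃ : Table.mul _ (Table.mul _ ![1, 0, 0] ![1, 0, 0]) ![0, 1, 0] =
    Table.mul _ ![1, 0, 0] (Table.mul _ ![1, 0, 0] ![0, 1, 0]) := h _ h₁ _ h₁ _ h₂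
  have := congrFun h₃ 1
  simp [Table.mul, Table.extend, JordanLabel.table] at this

theorem derivedAlgebra_extend_J18_algIso :
    AlgIso (derivedAlgebra (JordanLabel.J18.table.extend 0 0 p d v w).Alg) J2 := by
  let t := JordanLabel.J18.table.extend 0 0 p d v w
  have hp := Table.isPlane_extend J18_mem_planeTables 0 0 p d v w
  let f : derivedAlgebra t.Alg ≃ₗ[ℂ] J2 :=
    { toFun := fun x => (![(show Fin 3 → ℂ from x.1) 0, (show Fin 3 → ℂ from x.1) 1] : Fin 2 → ℂ)
      map_add' := fun x y => funext fun i => by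
        fin_cases i <;> rfl
      map_smul' := fun c x => funext fun i => by
        fin_cases i <;> rfl
      invFun := fun y => ⟨(![(show Fin 2 → ℂ from y) 0, (show Fin 2 → ℂ from y) 1, 0] : Fin 3 → ℂ),
        mem_derivedAlgebra_extend_J18 p d v w _ _⟩
      left_inv := fun x => Subtype.ext (funext fun i => by
        fin_cases i
        exacts [rfl, rfl, (hp.mem x.2).symm])
      right_inv := fun y => funext fun i => by
        fin_cases i <;> rfl }
  have key : ∀ x y : Fin 3 → ℂ, x 2 = 0 → y 2 = 0 →
      ![t.mul x y 0, t.mul x y 1] = J2.mul ![x 0, x 1] ![y 0, y 1] := by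
    intro x y hx hy
    ext i
    fin_cases i <;> simp [t, Table.mul, Table.extend, JordanLabel.table, J2.mul, hx, hy]
    ring
  exact ⟨f, fun x y => key x.1 y.1 (hp.mem x.2) (hp.mem y.2)⟩

variable {p d v w}

/-- In a Jordan algebra `z` lies in the zero-space of `x` and `y` in the half-space. Then `yz` is in
the half-space, so `p = 0`; `z²` is in the zero-space, so `v = w = 0`; and the linearized identity
leaves `d² y = 0`. -/
theorem eq_zero_of_isCommJordan {A : Type*} [NonUnitalNonAssocCommRing A] [Module ℂ A]
    [IsScalarTower ℂ A A] [SMulCommClass ℂ A A] [IsCommJordan A] {x y z : A}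
    (hli : LinearIndependent ℂ ![x, y, z]) (hx : x * x = x) (hxy : x * y = (1 / 2 : ℂ) • y)
    (hxz : x * z = 0) (hyz : y * z = p • x + d • y) (hzz : z * z = v • x + w • y) :
    p = 0 ∧ d = 0 ∧ v = 0 ∧ w = 0 := by
  have hli' := linearIndependent_three_iff.1 hli
  have hy₀ : y ≠ 0 := hli.ne_zero 1
  have hxz' : x * z = (0 : ℂ) • z := by rw [hxz, zero_smul]
  have h₁ := peirce_mul hx hxy hxz'
  rw [hyz, mul_add, mul_smul_comm, mul_smul_comm, hx, hxy] at h₁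
  have h₂ := peirce_mul hx hxz' hxz'
  rw [hzz, mul_add, mul_smul_comm, mul_smul_comm, hx, hxy] at h₂
  have hp := (hli' (p / 2) 0 0 (by linear_combination (norm := module) -h₁)).1
  obtain ⟨hv, hw, -⟩ := hli' v (w / 2) 0 (by linear_combination (norm := module) -h₂)
  have hp : p = 0 := by simpa using hp
  have hw : w = 0 := by simpa using hw
  subst hp hv hw
  have h₃ := jordan_linearized z x y
  have hzy : z * y = d • y := by rw [mul_comm, hyz]; module
  simp only [hzy, hzz, mul_comm z x, hxz, hxy, mul_smul_comm, zero_smul, mul_zero,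
    smul_zero, add_zero, zero_mul] at h₃
  have h₄ : d ^ 2 • y = 0 := by
    linear_combination (norm := module) h₃
  exact ⟨rfl, by simpa [hy₀] using h₄, rfl, rfl⟩

theorem eq_zero_of_isCommJordan_extend_J18
    (h : IsCommJordan (JordanLabel.J18.table.extend 0 0 p d v w).Alg) :
    p = 0 ∧ d = 0 ∧ v = 0 ∧ w = 0 := by
  have hli : LinearIndependent ℂ ![(![1, 0, 0] : Fin 3 → ℂ), ![0, 1, 0], ![0, 0, 1]] := by
    rw [linearIndependent_three_iff]
    intro a b c habc
    have h₀ := congrFun habc 0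
    have h₁ := congrFun habc 1
    have h₂ := congrFun habc 2
    simp at h₀ h₁ h₂
    exact ⟨h₀, h₁, h₂⟩
  refine eq_zero_of_isCommJordan (A := (JordanLabel.J18.table.extend 0 0 p d v w).Alg)
    (x := (![1, 0, 0] : Fin 3 → ℂ)) (y := (![0, 1, 0] : Fin 3 → ℂ))
    (z := (![0, 0, 1] : Fin 3 → ℂ)) ?_ ?_ ?_ ?_ ?_ ?_
  · exact hli
  · show Table.mul _ ![1, 0, 0] ![1, 0, 0] = ![1, 0, 0]
    ext i
    fin_cases i <;> simp [Table.mul, Table.extend, JordanLabel.table]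
  · show Table.mul _ ![1, 0, 0] ![0, 1, 0] = (1 / 2 : ℂ) • (![0, 1, 0] : Fin 3 → ℂ)
    ext i
    fin_cases i <;> simp [Table.mul, Table.extend, JordanLabel.table]
  · show Table.mul _ ![1, 0, 0] ![0, 0, 1] = 0
    ext i
    fin_cases i <;> simp [Table.mul, Table.extend, JordanLabel.table]
  · show Table.mul _ ![0, 1, 0] ![0, 0, 1] =
      p • (![1, 0, 0] : Fin 3 → ℂ) + d • (![0, 1, 0] : Fin 3 → ℂ)
    ext i
    fin_cases i <;> simp [Table.mul, Table.extend, JordanLabel.table]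
  · show Table.mul _ ![0, 0, 1] ![0, 0, 1] =
      v • (![1, 0, 0] : Fin 3 → ℂ) + w • (![0, 1, 0] : Fin 3 → ℂ)
    ext i
    fin_cases i <;> simp [Table.mul, Table.extend, JordanLabel.table]

/-- An isomorphism between two extensions of `𝔍04` is the composite of an automorphism
`e₁ ↦ e₁ + u e₂`, `e₂ ↦ s e₂` of `𝔍04` with a change of the third basis vector. -/
theorem params_of_algIso_extend_J18 {p' d' v' w' : ℂ}
    (h : AlgIso (JordanLabel.J18.table.extend 0 0 p d v w).Alg
      (JordanLabel.J18.table.extend 0 0 p' d' v' w').Alg) :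
    ∃ s c u b₁ b₂ : ℂ, s ≠ 0 ∧ c ≠ 0 ∧ b₁ = -(u * c * p') ∧ b₂ = -2 * u * c * d' - u * b₁ ∧
      p = s * c * p' ∧ d = c * d' - 3 / 2 * (u * c * p') ∧
      v = c ^ 2 * v' + 2 * c * b₂ * p' + b₁ ^ 2 ∧
      v * u + w * s = c ^ 2 * w' + 2 * c * b₂ * d' + b₁ * b₂ := by
  obtain ⟨f, hf⟩ := h
  let t := JordanLabel.J18.table.extend 0 0 p d v w
  let t' := JordanLabel.J18.table.extend 0 0 p' d' v' w'
  have hplane := Table.isPlane_extend J18_mem_planeTables 0 0 p' d' v' w'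
  let F : (Fin 3 → ℂ) ≃ₗ[ℂ] (Fin 3 → ℂ) := f
  have hF : ∀ x y : Fin 3 → ℂ, F (t.mul x y) = t'.mul (F x) (F y) := hf
  obtain ⟨x, hx⟩ : ∃ x, x = F ![1, 0, 0] := ⟨_, rfl⟩
  obtain ⟨y, hy⟩ : ∃ y, y = F ![0, 1, 0] := ⟨_, rfl⟩
  obtain ⟨z, hz⟩ : ∃ z, z = F ![0, 0, 1] := ⟨_, rfl⟩
  have hcomb : ∀ a b c : ℂ, F ![a, b, c] = a • x + b • y + c • z := by
    intro a b c
    rw [hx, hy, hz, ← map_smul, ← map_smul, ← map_smul, ← map_add, ← map_add]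
    congr 1
    ext i
    fin_cases i <;> simp
  have hmul : ∀ r s q : Fin 3 → ℂ, t.mul r s = q → F q = t'.mul (F r) (F s) := by
    rintro r s _ rfl
    exact hF r s
  have hxx := hmul ![1, 0, 0] ![1, 0, 0] ![1, 0, 0] (by
    ext i; fin_cases i <;> simp [t, Table.mul, Table.extend, JordanLabel.table])
  have hxy := hmul ![1, 0, 0] ![0, 1, 0] ![0, 1 / 2, 0] (by
    ext i; fin_cases i <;> simp [t, Table.mul, Table.extend, JordanLabel.table])
  have hxz := hmul ![1, 0, 0] ![0, 0, 1] ![0, 0, 0] (by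
    ext i; fin_cases i <;> simp [t, Table.mul, Table.extend, JordanLabel.table])
  have hyz := hmul ![0, 1, 0] ![0, 0, 1] ![p, d, 0] (by
    ext i; fin_cases i <;> simp [t, Table.mul, Table.extend, JordanLabel.table])
  have hzz := hmul ![0, 0, 1] ![0, 0, 1] ![v, w, 0] (by
    ext i; fin_cases i <;> simp [t, Table.mul, Table.extend, JordanLabel.table])
  rw [← hx] at hxx
  rw [← hx, ← hy, hcomb] at hxy
  rw [← hx, ← hz, hcomb] at hxz
  rw [← hy, ← hz, hcomb] at hyz
  rw [← hz, hcomb] at hzz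
  have hx₂ : x 2 = 0 := by rw [hxx, hplane.mul_two]
  have hy₂ : y 2 = 0 := by
    have := congrFun hxy 2
    rw [hplane.mul_two] at this
    simpa using this
  have hz₂ : z 2 ≠ 0 := by
    intro hz₂
    obtain ⟨q, hq⟩ := F.surjective ![0, 0, 1]
    have hq' : q = ![q 0, q 1, q 2] := by ext i; fin_cases i <;> rfl
    rw [hq', hcomb] at hq
    have := congrFun hq 2
    simp [hx₂, hy₂, hz₂] at this
  have hx₀ : x ≠ 0 := by
    rw [hx, Ne, LinearEquiv.map_eq_zero_iff]
    exact fun h => by simpa using congrFun h 0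
  have hy₀ : y ≠ 0 := by
    rw [hy, Ne, LinearEquiv.map_eq_zero_iff]
    exact fun h => by simpa using congrFun h 1
  have hxx₀ := congrFun hxx 0
  have hxx₁ := congrFun hxx 1
  have hxy₀ := congrFun hxy 0
  have hxy₁ := congrFun hxy 1
  have hxz₀ := congrFun hxz 0
  have hxz₁ := congrFun hxz 1
  have hyz₀ := congrFun hyz 0
  have hyz₁ := congrFun hyz 1
  have hzz₀ := congrFun hzz 0
  have hzz₁ := congrFun hzz 1
  simp [t', Table.mul, Table.extend, JordanLabel.table, hx₂, hy₂, -mul_eq_mul_left_iff,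
    -mul_eq_mul_right_iff, -left_eq_mul₀, -right_eq_mul₀]
    at hxx₀ hxx₁ hxy₀ hxy₁ hxz₀ hxz₁ hyz₀ hyz₁ hzz₀ hzz₁
  -- The nonzero idempotents of `𝔍04` are the vectors `e₁ + u e₂`.
  have hx1 : x 0 = 1 := by
    by_contra hne
    have h₀ : x 0 = 0 := by
      have : x 0 * (x 0 - 1) = 0 := by linear_combination -hxx₀
      exact (mul_eq_zero.1 this).resolve_right (sub_ne_zero.2 hne)
    have h₁ : x 1 = 0 := by
      linear_combination hxx₁ + x 1 * h₀
    refine hx₀ ?_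
    ext i
    fin_cases i
    exacts [h₀, h₁, hx₂]
  have hy0 : y 0 = 0 := by
    linear_combination -2 * hxy₀ - 2 * y 0 * hx1
  have hy1 : y 1 ≠ 0 := by
    intro h₁
    refine hy₀ ?_
    ext i
    fin_cases i
    exacts [hy0, h₁, hy₂]
  have hz0 : z 0 = -(x 1 * z 2 * p') := by
    linear_combination -hxz₀ - z 0 * hx1
  have hz1 : z 1 = -2 * x 1 * z 2 * d' - x 1 * z 0 := by
    linear_combination -2 * hxz₁ - z 1 * hx1
  have hp : p = y 1 * z 2 * p' := by
    linear_combination hyz₀ - p * hx1 + (z 0 - d) * hy0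
  refine ⟨y 1, z 2, x 1, z 0, z 1, hy1, hz₂, hz0, hz1, hp, ?_, ?_, ?_⟩
  · refine mul_left_cancel₀ hy1 ?_
    linear_combination hyz₁ - x 1 * hp + z 1 / 2 * hy0 + y 1 / 2 * hz0
  · linear_combination hzz₀ - v * hx1 - w * hy0
  · linear_combination hzz₁

end Extensions

/-! ### The seven families and their isomorphisms. -/

section DerJordan

/-- The coordinates of `e₂ e₃` and `e₃ e₃`. -/
def DerJordanLabel.params : DerJordanLabel → Fin 4 → ℂ
  | .DJ01 α => ![1, 0, 1, α]
  | .DJ02 => ![1, 0, 0, 1]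
  | .DJ03 => ![1, 0, 0, 0]
  | .DJ04 α => ![0, 1, α, 0]
  | .DJ05 => ![0, 1, -4, 1]
  | .DJ06 => ![0, 0, 1, 0]
  | .DJ07 => ![0, 0, 0, 1]

theorem DerJordanLabel.table_eq (l : DerJordanLabel) : l.table =
    JordanLabel.J18.table.extend 0 0 (l.params 0) (l.params 1) (l.params 2) (l.params 3) := by
  cases l <;>
    simp [DerJordanLabel.table, DerJordanLabel.params, JordanLabel.table, Table.extend, vec3_zero]

theorem DerJordanLabel.params_ne_zero (l : DerJordanLabel) :
    ¬(l.params 0 = 0 ∧ l.params 1 = 0 ∧ l.params 2 = 0 ∧ l.params 3 = 0) := by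
  cases l <;> simp [DerJordanLabel.params]

theorem DerJordanLabel.properties (l : DerJordanLabel) :
    IsDerivedJordan l.table.Alg ∧ AlgIso (derivedAlgebra l.table.Alg) J2 ∧
      ¬IsCommJordan l.table.Alg ∧ ¬IsDerivedCommAssoc l.table.Alg := by
  rw [l.table_eq]
  exact ⟨isDerivedJordan_extend_J18 _ _ _ _, derivedAlgebra_extend_J18_algIso _ _ _ _,
    fun h => l.params_ne_zero (eq_zero_of_isCommJordan_extend_J18 h),
    not_isDerivedCommAssoc_extend_J18 _ _ _ _⟩

theorem DerJordanLabel.algIso_neg (α : ℂ) :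
    AlgIso (DerJordanLabel.DJ01 α).table.Alg (DerJordanLabel.DJ01 (-α)).table.Alg := by
  rw [DerJordanLabel.table_eq, DerJordanLabel.table_eq]
  refine Table.extend_J18_algIso (-1) (-1) 0 0 0 (by norm_num) (by norm_num) ?_ ?_ ?_ ?_ ?_ ?_ <;>
    simp [DerJordanLabel.params]

/-- The vanishing of `p` is invariant. If `p = 1`, then `d = 0` forces `u = 0`, and only scalings
with `s c = 1` remain; for `𝒥01` also `c² = 1`, so `α` is fixed up to sign. If `p = 0` and `d = 1`,
then `c = 1`, so `v` is invariant, and at `v = -4` so is the vanishing of `w`. If `p = d = 0`, the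
vanishing of `v` separates the last two. -/
theorem DerJordanLabel.eq_of_algIso {l m : DerJordanLabel}
    (h : AlgIso l.table.Alg m.table.Alg) :
    l = m ∨ ∃ α : ℂ, l = .DJ01 α ∧ m = .DJ01 (-α) := by
  rw [l.table_eq, m.table_eq] at h
  obtain ⟨s, c, u, b₁, b₂, hs, hc, hb₁, hb₂, hp, hd, hv, hw⟩ := params_of_algIso_extend_J18 h
  subst hb₁
  subst hb₂
  clear h
  cases l <;> cases m <;> simp [DerJordanLabel.params, hs, hc] at hp hd hv hw ⊢
  all_goals grind

end DerJordan

end DerivedJordan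

/-! ### The theorem. -/

theorem theoremA3 :
    -- the classification
    (∀ (A : Type*) [NonUnitalNonAssocCommRing A] [Module ℂ A] [IsScalarTower ℂ A A]
        [SMulCommClass ℂ A A],
      Module.finrank ℂ A = 3 → (∃ x y : A, x * y ≠ 0) → DerivedJordan.IsDerivedJordan A →
        (IsCommJordan A ∧ DerivedJordan.IsListedJordan A) ∨
        (DerivedJordan.IsDerivedCommAssoc A ∧ DerivedJordan.IsListedDerivedCommAssoc A) ∨
        ∃ l : DerivedJordan.DerJordanLabel, DerivedJordan.AlgIso A l.table.Alg) ∧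
    -- the algebra `𝔍04` is Jordan and not associative
    (Module.finrank ℂ DerivedJordan.J2 = 2 ∧ IsCommJordan DerivedJordan.J2 ∧
      ¬ ∀ x y z : DerivedJordan.J2, (x * y) * z = x * (y * z)) ∧
    -- the seven families are derived Jordan, of neither of the first two kinds, and their
    -- derived algebras are isomorphic to `𝔍04`
    (∀ l : DerivedJordan.DerJordanLabel,
      DerivedJordan.IsDerivedJordan l.table.Alg ∧
      DerivedJordan.AlgIso (DerivedJordan.derivedAlgebra l.table.Alg) DerivedJordan.J2 ∧
      ¬ IsCommJordan l.table.Alg ∧ ¬ DerivedJordan.IsDerivedCommAssoc l.table.Alg) ∧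
    -- the only isomorphisms between them are `𝒥01^α ≅ 𝒥01^{-α}`
    (∀ l m : DerivedJordan.DerJordanLabel,
      DerivedJordan.AlgIso l.table.Alg m.table.Alg ↔
        l = m ∨ ∃ α : ℂ, l = .DJ01 α ∧ m = .DJ01 (-α)) := by
  refine ⟨fun A _ _ _ _ hA hne hJ => DerivedJordan.classification hA hne hJ,
    ⟨DerivedJordan.J2.finrank, DerivedJordan.J2.isCommJordan, DerivedJordan.J2.not_associative⟩,
    fun l => l.properties, fun l m => ⟨DerivedJordan.DerJordanLabel.eq_of_algIso, ?_⟩⟩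
  rintro (rfl | ⟨α, rfl, rfl⟩)
  · exact DerivedJordan.AlgIso.refl _
  · exact DerivedJordan.DerJordanLabel.algIso_neg α
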